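/- **Theorem 2 (spectrum of $\hat H_0$).** Let $d\in\{1,2,3\}$, $\beta>0$, $\alpha\in\mathbb R$. On $L^2(\mathbb R^d)\otimes\mathbb C^2$ write $\Psi=\sum_{\sigma=\pm}\psi_\sigma\otimes\chi_\sigma$, where $\chi_\pm$ are the normalized eigenvectors of the first Pauli matrix $\hat\sigma^{(1)}$, and let $H=-\Delta\otimes 1+1\otimes\beta\hat\sigma^{(1)}$ with domain $D(H)=H^2(\mathbb R^d)\otimes\mathbb C^2$. For $w\in\mathbb C\setminus[0,\infty)$ let $\operatorname{Im}\sqrt w>0$ and let $G^w$ be the integral kernel of $(-\Delta-w)^{-1}$: $G^w(x)=\frac{i e^{i\sqrt w|x|}}{2\sqrt w}$ ($d=1$), $\frac i4H_0^{(1)}(\sqrt w|x|)$ ($d=2$), $\frac{e^{i\sqrt w|x|}}{4\pi|x|}$ ($d=3$); for $z\in\mathbb C\setminus\mathbb R$ put $\Phi^z_\sigma=G^{z-\sigma\beta}\otimes\chi_\sigma$. Fix any $z\in\mathbb C\setminus\mathbb R$ (the operator does not depend on it). The domain of $\hat H_0$ consists of all $\Psi=\Psi^z+\sum_\sigma q_\sigma\Phi^z_\sigma$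 with $\Psi^z\in D(H)$, $q_\pm\in\mathbb C$, such that $q_\sigma=-\alpha f_\sigma$ with $f_\sigma=\psi_\sigma(0)$ if $d=1$; $\alpha q_\sigma=f_\sigma$ with $f_\sigma=\lim_{|x|\to0}\big[\psi_\sigma(x)+\frac{q_\sigma}{2\pi}\ln|x|\big]$ if $d=2$; $\alpha q_\sigma=f_\sigma$ with $f_\sigma=\lim_{|x|\to0}\big[\psi_\sigma(x)-\frac{q_\sigma}{4\pi|x|}\big]$ if $d=3$; and $\hat H_0\Psi=H\Psi^z+z\sum_\sigma q_\sigma\Phi^z_\sigma$. Let $\mu=e^{2(\gamma+2\pi\alpha)}/4$, $\gamma$ being Euler's constant, and for $z\in\mathbb C\setminus\mathbb R$ let $\Gamma_0(z)$ be the diagonal $2\times2$ matrix with entries, for $\sigma=\pm$, $$-\frac{i}{2\sqrt{z-\sigma\beta}}-\frac1\alpha\ \ (d=1,\ \alpha\neq0),\qquad \frac{\ln\sqrt{\mu(z-\sigma\beta)}-i\pi/2}{2\pi}\ \ (d=2),\qquad \frac{\sqrt{z-\sigma\beta}}{4\pi i}+\alpha\ \ (d=3).$$ A real root of $\det\Gamma_0(z)=0$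 is a point $x\in\mathbb R$ such that $\det\Gamma_0(z)\to0$ as $z\to x$, $z\in\mathbb C\setminus\mathbb R$. Then: * The essential spectrum of $\hat H_0$ is $[-\beta,\infty)$. The point spectrum (the set of eigenvalues) is the set of the real roots of $\det\Gamma_0(z)=0$; here $\alpha\ne0$ is assumed if $d=1$ or $d=3$. * $d=1$. If $\alpha\ge0$, the point spectrum is empty. If $\alpha<0$, it consists of the two simple eigenvalues $E_{0,-}=-\beta-\frac{\alpha^2}4$ and $E_{0,+}=\beta-\frac{\alpha^2}4$, and $E_{0,-}<-\beta$. If $\alpha<-2\sqrt{2\beta}$, then also $E_{0,+}<-\beta$, the point spectrum is only discrete, and the essential spectrum is only absolutely continuous. If $-2\sqrt{2\beta}\le\alpha<0$, then $E_{0,+}$ is embedded in the continuous spectrum, $-\beta\le E_{0,+}<\beta$. * $d=2$. For every $\alpha\in\mathbb R$ (that is, every $\mu>0$), the point spectrum consists of the two simple eigenvalues $E_{0,-}=-\beta-\frac1\mu$ and $E_{0,+}=\beta-\frac1\mu$, and $E_{0,-}<-\beta$. If $2\beta\mu<1$, then also $E_{0,+}<-\beta$, the point spectrum is only discrete, and the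 essential spectrum is only absolutely continuous. If $2\beta\mu\ge1$, then $E_{0,+}$ is embedded in the continuous spectrum, $-\beta\le E_{0,+}<\beta$. * $d=3$. If $\alpha\ge0$, the point spectrum is empty. If $\alpha<0$, it consists of the two simple eigenvalues $E_{0,-}=-\beta-(4\pi\alpha)^2$ and $E_{0,+}=\beta-(4\pi\alpha)^2$, and $E_{0,-}<-\beta$. If $\alpha<-\sqrt{2\beta}/(4\pi)$, then also $E_{0,+}<-\beta$, the point spectrum is only discrete, and the essential spectrum is only absolutely continuous. If $-\sqrt{2\beta}/(4\pi)\le\alpha<0$, then $E_{0,+}$ is embedded in the continuous spectrum, $-\beta\le E_{0,+}<\beta$. -/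

import Mathlib

open MeasureTheory Filter Topology
open scoped SchwartzMap Laplacian

noncomputable section

/-! ### Spectral notions for a linear operator `A` on a subspace of a complex inner product space -/

section SpectralTheory

variable {E : Type*} [NormedAddCommGroup E] [InnerProductSpace ℂ E]

/-- The resolvent set of `A`: the numbers `z` for which `A - z : D(A) → E` is a bijection with
bounded inverse `R`. -/
def opResolventSet (A : E →ₗ.[ℂ] E) : Set ℂ :=
  {z | ∃ R : E →L[ℂ] E,
    (∀ y : E, (R y, y + z • R y) ∈ A.graph) ∧ ∀ x : A.domain, R (A x - z • (x : E)) = x}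

/-- The spectrum of `A`. -/
def opSpectrum (A : E →ₗ.[ℂ] E) : Set ℂ := (opResolventSet A)ᶜ

/-- The space of all `x ∈ D(A)` with `A x = z x`. -/
def opEigenspace (A : E →ₗ.[ℂ] E) (z : ℂ) : Submodule ℂ E :=
  A.graph.comap (LinearMap.id.prod (z • LinearMap.id))

/-- The point spectrum of `A`: the set of its eigenvalues. -/
def pointSpectrum (A : E →ₗ.[ℂ] E) : Set ℂ := {z | opEigenspace A z ≠ ⊥}

/-- `z` is a simple eigenvalue: its eigenspace is one-dimensional. -/
def IsSimpleEigenvalue (A : E →ₗ.[ℂ] E) (z : ℂ) : Prop :=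
  Module.finrank ℂ (opEigenspace A z) = 1

/-- `μ` is the spectral measure of the self-adjoint operator `A` at the vector `ψ`: the finite Borel
measure on `ℝ` with `⟪ψ, (A - z)⁻¹ ψ⟫ = ∫ (x - z)⁻¹ dμ(x)` for all nonreal `z`. -/
def IsSpectralMeasure (A : E →ₗ.[ℂ] E) (ψ : E) (μ : Measure ℝ) : Prop :=
  IsFiniteMeasure μ ∧ ∀ z : ℂ, z.im ≠ 0 →
    ∃ φ : E, (φ, ψ + z • φ) ∈ A.graph ∧ inner ℂ ψ φ = ∫ x : ℝ, ((x : ℂ) - z)⁻¹ ∂μ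

/-- The range of the spectral projection of `A` onto the Borel set `B`: the vectors whose spectral
measure is carried by `B`. (For self-adjoint `A` these vectors already form a subspace; the same
applies to the spans below.) -/
def spectralSubspace (A : E →ₗ.[ℂ] E) (B : Set ℝ) : Submodule ℂ E :=
  Submodule.span ℂ {ψ | ∃ μ, IsSpectralMeasure A ψ μ ∧ μ Bᶜ = 0}

/-- The essential spectrum: the points of the spectrum all of whose neighbourhoods have an
infinite-dimensional spectral subspace. -/
def essSpectrum (A : E →ₗ.[ℂ] E) : Set ℂ :=
  {z ∈ opSpectrum A | ∀ ε > 0,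
    ¬ FiniteDimensional ℂ (spectralSubspace A {x : ℝ | ‖(x : ℂ) - z‖ < ε})}

/-- The discrete spectrum: the points of the spectrum with a neighbourhood whose spectral subspace
is finite-dimensional. -/
def discreteSpectrum (A : E →ₗ.[ℂ] E) : Set ℂ :=
  {z ∈ opSpectrum A | ∃ ε > 0,
    FiniteDimensional ℂ (spectralSubspace A {x : ℝ | ‖(x : ℂ) - z‖ < ε})}

/-- The absolutely continuous subspace of `A`. -/
def acSubspace (A : E →ₗ.[ℂ] E) : Submodule ℂ E :=
  Submodule.span ℂ {ψ | ∃ μ, IsSpectralMeasure A ψ μ ∧ μ ≪ volume}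

/-- The singular continuous subspace of `A`. -/
def scSubspace (A : E →ₗ.[ℂ] E) : Submodule ℂ E :=
  Submodule.span ℂ {ψ | ∃ μ, IsSpectralMeasure A ψ μ ∧ (∀ x, μ {x} = 0) ∧ μ ⟂ₘ volume}

/-- The continuous subspace of `A`. -/
def contSubspace (A : E →ₗ.[ℂ] E) : Submodule ℂ E :=
  Submodule.span ℂ {ψ | ∃ μ, IsSpectralMeasure A ψ μ ∧ (∀ x, μ {x} = 0)}

/-- The part of `A` in a subspace `K`, with domain `{x ∈ K | x ∈ D(A), A x ∈ K}`. -/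
def opPart (A : E →ₗ.[ℂ] E) (K : Submodule ℂ E) : K →ₗ.[ℂ] K :=
  (A.graph.comap (K.subtype.prodMap K.subtype)).toLinearPMap

/-- The absolutely continuous spectrum. -/
def acSpectrum (A : E →ₗ.[ℂ] E) : Set ℂ := opSpectrum (opPart A (acSubspace A))

/-- The singular continuous spectrum. -/
def scSpectrum (A : E →ₗ.[ℂ] E) : Set ℂ := opSpectrum (opPart A (scSubspace A))

/-- The continuous spectrum. -/
def contSpectrum (A : E →ₗ.[ℂ] E) : Set ℂ := opSpectrum (opPart A (contSubspace A))

/-- The essential spectrum is only absolutely continuous: it equals the absolutely continuous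
spectrum, there is no singular continuous spectrum, and it contains no eigenvalue. -/
def EssSpectrumOnlyAC (A : E →ₗ.[ℂ] E) : Prop :=
  essSpectrum A = acSpectrum A ∧ scSpectrum A = ∅ ∧ Disjoint (essSpectrum A) (pointSpectrum A)

end SpectralTheory

/-! ### The two-channel point interaction Hamiltonian -/

/-- Configuration space `ℝ^d`. -/
abbrev Pos (d : ℕ) := EuclideanSpace ℝ (Fin d)

/-- `L²(ℝ^d)`. -/
abbrev L2 (d : ℕ) := Lp ℂ 2 (volume : Measure (Pos d))

/-- `L²(ℝ^d) ⊗ ℂ²`, a vector `Ψ = ∑ ψ_σ ⊗ χ_σ` being given by its components `ψ_σ`, `σ = ±1`, in the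
orthonormal eigenbasis `χ_σ` of the first Pauli matrix. -/
abbrev StateSpace (d : ℕ) := PiLp 2 (fun _ : ℤˣ => L2 d)

/-- The sign `σ = ±1` as a complex number. -/
def sgn (σ : ℤˣ) : ℂ := ((σ : ℤ) : ℂ)

/-- The square root with `Im √w > 0`, for `w ∉ [0, ∞)`. -/
def upperSqrt (w : ℂ) : ℂ := Complex.I * (-w) ^ (1 / 2 : ℂ)

/-- The Hankel function `H₀⁽¹⁾(η)` for `Im η > 0`, by the integral
`(1 / (π i)) ∫_{-∞}^{∞} exp(i η cosh t) dt`. -/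
def hankelH1 (η : ℂ) : ℂ :=
  (Real.pi * Complex.I)⁻¹ * ∫ t : ℝ, Complex.exp (Complex.I * η * (Real.cosh t : ℂ))

/-- The kernel `G^w(x)` of `(-Δ - w)⁻¹` in dimension `d = 1, 2, 3`, as a function of `r = |x|`. -/
def green (d : ℕ) (w : ℂ) (r : ℝ) : ℂ :=
  match d with
  | 1 => Complex.I * Complex.exp (Complex.I * upperSqrt w * r) / (2 * upperSqrt w)
  | 2 => Complex.I / 4 * hankelH1 (upperSqrt w * r)
  | 3 => Complex.exp (Complex.I * upperSqrt w * r) / (4 * Real.pi * r)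
  | _ => 0

/-- The leading singularity of `G^w` at the origin. -/
def singularPart (d : ℕ) (r : ℝ) : ℂ :=
  match d with
  | 2 => -(Real.log r : ℂ) / (2 * Real.pi)
  | 3 => 1 / (4 * Real.pi * r)
  | _ => 0

/-- `f = lim_{|x| → 0} [ψ(x) - q s(x)]`, with `s` the leading singularity of `G^w`, for a suitable
representative of `ψ`; for `d = 1` this says `f = ψ(0)`. -/
def HasRegularValue (d : ℕ) (ψ : L2 d) (q f : ℂ) : Prop :=
  ∃ g : Pos d → ℂ, g =ᵐ[volume] ψ ∧
    Tendsto (fun x => g x - q * singularPart d ‖x‖) (𝓝[≠] 0) (𝓝 f)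

/-- The boundary condition: `q = -α f` for `d = 1`, and `α q = f` for `d = 2, 3`. -/
def BoundaryCondition (d : ℕ) (α : ℝ) (q f : ℂ) : Prop :=
  match d with
  | 1 => q = -(α : ℂ) * f
  | _ => (α : ℂ) * q = f

/-- The graph of the free Hamiltonian `H = -Δ ⊗ 1 + 1 ⊗ β σ̂⁽¹⁾` on `H²(ℝ^d) ⊗ ℂ²`. -/
def freeGraph (d : ℕ) (β : ℝ) : Submodule ℂ (StateSpace d × StateSpace d) where
  carrier := {p | ∀ σ : ℤˣ,
    TemperedDistribution.MemSobolev 2 2 (p.1 σ : 𝓢'(Pos d, ℂ)) ∧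
    (p.2 σ : 𝓢'(Pos d, ℂ)) =
      -Δ (p.1 σ : 𝓢'(Pos d, ℂ)) + (sgn σ * (β : ℂ)) • (p.1 σ : 𝓢'(Pos d, ℂ))}
  zero_mem' := by
    intro σ
    have h0 : ((0 : L2 d) : 𝓢'(Pos d, ℂ)) = 0 := by
      rw [← Lp.toTemperedDistributionCLM_apply, map_zero]
    change TemperedDistribution.MemSobolev 2 2 ((0 : L2 d) : 𝓢'(Pos d, ℂ)) ∧
      ((0 : L2 d) : 𝓢'(Pos d, ℂ)) = -Δ ((0 : L2 d) : 𝓢'(Pos d, ℂ)) +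
        (sgn σ * (β : ℂ)) • ((0 : L2 d) : 𝓢'(Pos d, ℂ))
    have h1 : Δ (0 : 𝓢'(Pos d, ℂ)) = 0 := by
      rw [← TemperedDistribution.laplacianCLM_apply, map_zero]
    rw [h0, h1]
    simp
  add_mem' := by
    intro a b ha hb σ
    obtain ⟨ha1, ha2⟩ := ha σ
    obtain ⟨hb1, hb2⟩ := hb σ
    have h1 := ha1.add hb1
    simp only [← Lp.toTemperedDistributionCLM_apply, ← TemperedDistribution.laplacianCLM_apply]
      at h1 ha2 hb2 ⊢
    refine ⟨by simpa only [Prod.fst_add, PiLp.add_apply, map_add] using h1, ?_⟩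
    simp only [Prod.fst_add, Prod.snd_add, PiLp.add_apply, map_add, ha2, hb2, smul_add]
    abel
  smul_mem' := by
    intro c a ha σ
    obtain ⟨ha1, ha2⟩ := ha σ
    have h1 := ha1.smul c
    simp only [← Lp.toTemperedDistributionCLM_apply, ← TemperedDistribution.laplacianCLM_apply]
      at h1 ha2 ⊢
    refine ⟨by simpa only [Prod.smul_fst, PiLp.smul_apply, map_smul] using h1, ?_⟩
    simp only [Prod.smul_fst, Prod.smul_snd, PiLp.smul_apply, map_smul, ha2, smul_add, smul_neg]
    rw [smul_comm]

/-- The graph of `Ĥ₀`: the pairs `(Ψ, Ĥ₀ Ψ)` with `Ψ = Ψ^z + ∑ q_σ Φ_σ^z`, `Ψ^z ∈ D(H)`,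
`Φ_σ^z = G^{z - βσ} ⊗ χ_σ`, the boundary condition between the charges `q_σ` and the regular values
`f_σ`, and `Ĥ₀ Ψ = H Ψ^z + z ∑ q_σ Φ_σ^z`. -/
def hamiltonianGraph (d : ℕ) (α β : ℝ) (z : ℂ) :
    Submodule ℂ (StateSpace d × StateSpace d) where
  carrier := {p | ∃ r ∈ freeGraph d β, ∃ q f : ℤˣ → ℂ, ∀ σ : ℤˣ,
    (p.1 σ =ᵐ[volume] fun x => r.1 σ x + q σ * green d (z - sgn σ * β) ‖x‖) ∧
    (p.2 σ =ᵐ[volume] fun x => r.2 σ x + z * (q σ * green d (z - sgn σ * β) ‖x‖)) ∧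
    HasRegularValue d (p.1 σ) (q σ) (f σ) ∧
    BoundaryCondition d α (q σ) (f σ)}
  zero_mem' := by
    refine ⟨0, zero_mem _, 0, 0, fun σ => ⟨?_, ?_, ⟨fun _ => 0, ?_, ?_⟩, ?_⟩⟩
    · filter_upwards [Lp.coeFn_zero ℂ 2 (volume : Measure (Pos d))] with x hx
      change (0 : L2 d) x = (0 : L2 d) x + 0 * _
      simp
    · filter_upwards [Lp.coeFn_zero ℂ 2 (volume : Measure (Pos d))] with x hx
      change (0 : L2 d) x = (0 : L2 d) x + z * (0 * _)
      simp
    · exact (Lp.coeFn_zero ℂ 2 volume).symm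
    · simpa using tendsto_const_nhds
    · unfold BoundaryCondition; split <;> simp
  add_mem' := by
    rintro a b ⟨r, hr, q, f, h⟩ ⟨r', hr', q', f', h'⟩
    refine ⟨r + r', add_mem hr hr', q + q', f + f', fun σ => ?_⟩
    obtain ⟨h1, h2, ⟨g, hg, hgt⟩, h4⟩ := h σ
    obtain ⟨h1', h2', ⟨g', hg', hgt'⟩, h4'⟩ := h' σ
    refine ⟨?_, ?_, ⟨g + g', ?_, ?_⟩, ?_⟩
    · filter_upwards [h1, h1', Lp.coeFn_add (a.1 σ) (b.1 σ), Lp.coeFn_add (r.1 σ) (r'.1 σ)]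
        with x e1 e2 e3 e4
      simp only [Prod.fst_add, PiLp.add_apply, Pi.add_apply] at e3 e4 ⊢
      rw [e3, e4, e1, e2]; ring
    · filter_upwards [h2, h2', Lp.coeFn_add (a.2 σ) (b.2 σ), Lp.coeFn_add (r.2 σ) (r'.2 σ)]
        with x e1 e2 e3 e4
      simp only [Prod.snd_add, PiLp.add_apply, Pi.add_apply] at e3 e4 ⊢
      rw [e3, e4, e1, e2]; ring
    · exact (hg.add hg').trans (Lp.coeFn_add (a.1 σ) (b.1 σ)).symm
    · refine (hgt.add hgt').congr fun x => ?_
      simp only [Pi.add_apply]; ring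
    · unfold BoundaryCondition at h4 h4' ⊢
      split at h4 <;> simp only [Pi.add_apply] at h4' ⊢ <;> grind
  smul_mem' := by
    rintro c a ⟨r, hr, q, f, h⟩
    refine ⟨c • r, Submodule.smul_mem _ c hr, c • q, c • f, fun σ => ?_⟩
    obtain ⟨h1, h2, ⟨g, hg, hgt⟩, h4⟩ := h σ
    refine ⟨?_, ?_, ⟨c • g, ?_, ?_⟩, ?_⟩
    · filter_upwards [h1, Lp.coeFn_smul c (a.1 σ), Lp.coeFn_smul c (r.1 σ)] with x e1 e3 e4
      simp only [Prod.smul_fst, PiLp.smul_apply, Pi.smul_apply, smul_eq_mul] at e3 e4 ⊢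
      rw [e3, e4, e1]; ring
    · filter_upwards [h2, Lp.coeFn_smul c (a.2 σ), Lp.coeFn_smul c (r.2 σ)] with x e1 e3 e4
      simp only [Prod.smul_snd, PiLp.smul_apply, Pi.smul_apply, smul_eq_mul] at e3 e4 ⊢
      rw [e3, e4, e1]; ring
    · exact (hg.const_smul c).trans (Lp.coeFn_smul c (a.1 σ)).symm
    · refine (hgt.const_mul c).congr fun x => ?_
      simp only [Pi.smul_apply, smul_eq_mul]; ring
    · unfold BoundaryCondition at h4 ⊢
      split at h4 <;> simp only [Pi.smul_apply, smul_eq_mul] <;> grind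

/-- The unperturbed Hamiltonian `Ĥ₀` in dimension `d` with parameters `α`, `β`, written with the
auxiliary number `z ∈ ℂ ∖ ℝ` (on which it does not depend). -/
def hamiltonian (d : ℕ) (α β : ℝ) (z : ℂ) : StateSpace d →ₗ.[ℂ] StateSpace d :=
  (hamiltonianGraph d α β z).toLinearPMap

/-- `μ = e^{2(γ + 2πα)} / 4`. -/
def muOf (α : ℝ) : ℝ :=
  Real.exp (2 * (Real.eulerMascheroniConstant + 2 * Real.pi * α)) / 4

/-- The diagonal entry of `Γ₀` as a function of `w = z - σβ`. -/
def gammaEntry (d : ℕ) (α : ℝ) (w : ℂ) : ℂ :=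
  match d with
  | 1 => -Complex.I / (2 * upperSqrt w) - 1 / (α : ℂ)
  | 2 => (Complex.log (upperSqrt ((muOf α : ℂ) * w)) - Complex.I * Real.pi / 2) / (2 * Real.pi)
  | 3 => upperSqrt w / (4 * Real.pi * Complex.I) + (α : ℂ)
  | _ => 0

/-- The matrix `Γ₀(z)`, for nonreal `z`. -/
def gammaZero (d : ℕ) (α β : ℝ) (z : ℂ) : Matrix ℤˣ ℤˣ ℂ :=
  Matrix.diagonal fun σ => gammaEntry d α (z - sgn σ * β)

/-- `x ∈ ℝ` is a real root of `det Γ₀(z) = 0`: as `Γ₀` is defined off the real axis (the half-line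
`z ≥ -β` is a branch cut), this means that `det Γ₀(z)` has boundary value `0` at `x`. -/
def IsRealRoot (d : ℕ) (α β x : ℝ) : Prop :=
  Tendsto (fun z => (gammaZero d α β z).det) (𝓝[{z : ℂ | z.im ≠ 0}] (x : ℂ)) (𝓝 0)

end

/-!
The Hamiltonian is diagonal in the spin: after a Fourier transform its component `σ` is one fixed
operator `T`, the Laplacian with a point interaction at the origin, shifted by `σβ`
(`isShiftedSum_hamiltonian`). Everything therefore reduces to the spectral theory of `T`, and to the
way in which spectra, eigenspaces and spectral measures behave under orthogonal sums and shifts.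

In Fourier space a pair `(ψ, φ)` belongs to the graph of `T` when `φ = 4π²|k|² ψ - q` for a number
`q`, the charge, which is tied by the boundary condition `a q = c f` to the regular value `f` of the
function at the origin. This rests on the identity of `G^w` with the inverse Fourier transform of
`ĝ_w = 1 / (4π²|k|² - w)` (`green_ae_eq`: for real `w < 0` by writing `G^w` as a Laplace transform of
the heat kernel, for other `w` by analytic continuation) and on the value `regVal d w` of `G^w` minus
its singular part at the origin (`hasRegularValue_gL`). Solving `(T - w) ψ = η` then gives Krein's
formula: `ψ̂ = ĝ_w η̂ + (c / D(w)) (∫ ĝ_w η̂) ĝ_w` with `D(w) = a - c regVal d w`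
(`isResolventFamily_chanOp`). As `regVal` is a Nevanlinna function (`regVal_sub`), `D` has no nonreal
zero and is injective on the negative half-line.

*Eigenvalues.* A solution of `T ψ = e ψ` is a multiple of `ĝ_e`, which is square integrable only
for `e < 0`; so the eigenvalues of `T` are the negative zeros of `D`, all simple
(`opEigenspace_chanOp_ne_bot_iff`). The diagonal entries of `Γ₀` are constant multiples of the shifted
`D` (`kreinD_eq_gammaEntry`). A zero of one factor forces the determinant to tend to zero, since the
zero is at least of first order while the other factor is `O(|w|^{-1/2})` at worst; elsewhere `D` is
bounded below along vertical lines (`isRealRoot_iff_exists`).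

*Continuous spectrum.* Spectral measures come from the resolvent, through the continuous functional
calculus of a bounded self-adjoint resolvent and the uniqueness of a finite measure with given
Stieltjes transform. Where the boundary values of `Im ⟪ψ, (A - x - iδ)⁻¹ ψ⟫` stay bounded, the
spectral measure is absolutely continuous, and an atom produces an eigenvector. For the vectors `ĝ_w` and
for vectors orthogonal to all `ĝ_w` those boundary values are explicit, and these vectors span a dense
subspace, so that the spectral measures of `T` are absolutely continuous on the positive half-line, have
no atom at `0`, and are carried by eigenvalues below it (`isACAbove_chanOp`). Conversely, functions
supported in a thin shell `{4π²|k|² ∈ J}` and odd in one coordinate do not feel the point interaction and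
give infinitely many orthogonal vectors of absolutely continuous spectral type concentrated near any
prescribed energy (`hasShells_chanOp`). These two facts, `IsACAbove` and `HasShells`, pass to shifted
sums and determine the essential, absolutely continuous, singular continuous and discrete spectra.
-/

noncomputable section

/-! ### Stieltjes transforms of finite measures on the line -/

section Stieltjes

lemma norm_inv_ofReal_sub_le (t : ℝ) {z : ℂ} (hz : z.im ≠ 0) :
    ‖((t : ℂ) - z)⁻¹‖ ≤ |z.im|⁻¹ := by
  rw [norm_inv]
  apply inv_anti₀ (abs_pos.2 hz)
  simpa using Complex.abs_im_le_norm ((t : ℂ) - z)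

lemma integrable_inv_ofReal_sub (μ : Measure ℝ) [IsFiniteMeasure μ] {z : ℂ} (hz : z.im ≠ 0) :
    Integrable (fun t : ℝ => ((t : ℂ) - z)⁻¹) μ := by
  refine Integrable.mono' (integrable_const (|z.im|⁻¹)) ?_
    (Eventually.of_forall fun t => norm_inv_ofReal_sub_le t hz)
  exact (by fun_prop : Measurable fun t : ℝ => ((t : ℂ) - z)⁻¹).aestronglyMeasurable

lemma im_inv_ofReal_sub (t x δ : ℝ) :
    (((t : ℂ) - (x + δ * Complex.I))⁻¹).im = δ / ((t - x) ^ 2 + δ ^ 2) := by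
  rw [Complex.inv_im]
  simp [Complex.normSq_apply, sq]

/-- The imaginary part of the Stieltjes transform is the Poisson integral (times `π`). -/
lemma im_stieltjes (μ : Measure ℝ) [IsFiniteMeasure μ] (x : ℝ) {δ : ℝ} (hδ : δ ≠ 0) :
    (∫ t : ℝ, ((t : ℂ) - (x + δ * Complex.I))⁻¹ ∂μ).im
      = ∫ t : ℝ, δ / ((t - x) ^ 2 + δ ^ 2) ∂μ := by
  have h := integrable_inv_ofReal_sub μ (z := x + δ * Complex.I) (by simpa using hδ)
  have := integral_im h
  simp only [RCLike.im_to_complex, im_inv_ofReal_sub] at this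
  exact this.symm

lemma integrable_poisson (μ : Measure ℝ) [IsFiniteMeasure μ] (x : ℝ) {δ : ℝ} (hδ : δ ≠ 0) :
    Integrable (fun t : ℝ => δ / ((t - x) ^ 2 + δ ^ 2)) μ := by
  have h := (integrable_inv_ofReal_sub μ (z := x + δ * Complex.I) (by simpa using hδ)).im
  simpa only [RCLike.im_to_complex, im_inv_ofReal_sub] using h

lemma integral_mul_poisson_eq (F : ℝ → ℝ) (t : ℝ) {ε : ℝ} (hε : 0 < ε) :
    (∫ s : ℝ, F s * (ε / ((t - s) ^ 2 + ε ^ 2)))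
      = ∫ y : ℝ, F (t + ε * y) * (1 + y ^ 2)⁻¹ := by
  have h1 := Measure.integral_comp_mul_left (fun s => F (t + s) * (ε / (s ^ 2 + ε ^ 2))) ε
  have h2 := integral_add_left_eq_self (μ := volume)
    (fun s => F s * (ε / ((t - s) ^ 2 + ε ^ 2))) t
  rw [← h2]
  simp only [sub_add_cancel_left, even_two, Even.neg_pow]
  rw [abs_of_pos (inv_pos.2 hε), eq_comm, inv_smul_eq_iff₀ hε.ne', ← integral_smul] at h1
  rw [h1]
  refine integral_congr_ae (Eventually.of_forall fun y => ?_)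
  simp only [smul_eq_mul]
  have : 1 + y ^ 2 ≠ 0 := by positivity
  have : (ε * y) ^ 2 + ε ^ 2 ≠ 0 := by positivity
  field_simp
  ring

lemma integrable_mul_poisson (f : BoundedContinuousFunction ℝ ℝ) (t : ℝ) {ε : ℝ} (hε : 0 < ε) :
    Integrable (fun s : ℝ => f s * (ε / ((t - s) ^ 2 + ε ^ 2))) := by
  have h : Integrable (fun y : ℝ => (1 + y ^ 2)⁻¹) := integrable_inv_one_add_sq
  have h2 : Integrable (fun s : ℝ => (1 + (ε⁻¹ * (s - t)) ^ 2)⁻¹) :=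
    (h.comp_mul_left' (inv_ne_zero hε.ne')).comp_sub_right t
  refine ((h2.const_mul ε⁻¹).bdd_mul (c := ‖f‖) f.continuous.aestronglyMeasurable
    (Eventually.of_forall fun x => f.norm_coe_le_norm x)).congr
    (Eventually.of_forall fun s => ?_)
  have h3 : (t - s) ^ 2 + ε ^ 2 ≠ 0 := by positivity
  have h4 : 1 + (ε⁻¹ * (s - t)) ^ 2 ≠ 0 := by positivity
  simp only
  congr 1
  field_simp
  ring

/-- The Poisson integrals of a finite measure recover the measure. -/
lemma tendsto_integral_poisson (μ : Measure ℝ) [IsFiniteMeasure μ]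
    (f : BoundedContinuousFunction ℝ ℝ) :
    Tendsto (fun ε : ℝ => ∫ s : ℝ, f s * ∫ t : ℝ, ε / ((t - s) ^ 2 + ε ^ 2) ∂μ)
      (𝓝[>] 0) (𝓝 (∫ t, f t * Real.pi ∂μ)) := by
  have hbd : ∀ t ε y : ℝ, ‖f (t + ε * y) * (1 + y ^ 2)⁻¹‖ ≤ ‖f‖ * (1 + y ^ 2)⁻¹ := by
    intro t ε y
    rw [norm_mul, Real.norm_of_nonneg (by positivity : 0 ≤ (1 + y ^ 2)⁻¹)]
    gcongr
    exact f.norm_coe_le_norm _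
  have hint : Integrable (fun y : ℝ => ‖f‖ * (1 + y ^ 2)⁻¹) :=
    integrable_inv_one_add_sq.const_mul _
  have hbd2 : ∀ t ε : ℝ, ‖∫ y : ℝ, f (t + ε * y) * (1 + y ^ 2)⁻¹‖
      ≤ ∫ y : ℝ, ‖f‖ * (1 + y ^ 2)⁻¹ := fun t ε =>
    norm_integral_le_of_norm_le hint (Eventually.of_forall fun y => hbd t ε y)
  -- by Fubini and the substitution `s = t + ε y` the kernel becomes `1 / (1 + y²)`, whatever `ε` is
  have key : ∀ ε : ℝ, 0 < ε → (∫ s : ℝ, f s * ∫ t : ℝ, ε / ((t - s) ^ 2 + ε ^ 2) ∂μ)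
      = ∫ t, (∫ y : ℝ, f (t + ε * y) * (1 + y ^ 2)⁻¹) ∂μ := by
    intro ε hε
    simp_rw [← integral_mul_poisson_eq f _ hε, ← integral_const_mul]
    refine integral_integral_swap ?_
    have hm : AEStronglyMeasurable (Function.uncurry fun s t : ℝ =>
        f s * (ε / ((t - s) ^ 2 + ε ^ 2))) (volume.prod μ) := by
      refine Continuous.aestronglyMeasurable ?_
      have : ∀ p : ℝ × ℝ, (p.2 - p.1) ^ 2 + ε ^ 2 ≠ 0 := fun p => by positivity
      exact (f.continuous.comp continuous_fst).mul (continuous_const.div (by fun_prop) this)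
    rw [integrable_prod_iff' hm]
    refine ⟨Eventually.of_forall fun t => integrable_mul_poisson f t hε, ?_⟩
    refine Integrable.mono' (integrable_const (∫ y : ℝ, ‖f‖ * (1 + y ^ 2)⁻¹))
      hm.norm.prod_swap.integral_prod_right' (Eventually.of_forall fun t => ?_)
    have h5 := integral_mul_poisson_eq (fun s => ‖f s‖) t hε
    have h6 : ∀ s : ℝ, ‖Function.uncurry (fun s t : ℝ => f s * (ε / ((t - s) ^ 2 + ε ^ 2))) (s, t)‖
        = ‖f s‖ * (ε / ((t - s) ^ 2 + ε ^ 2)) := by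
      intro s
      rw [Function.uncurry_apply_pair, norm_mul,
        Real.norm_of_nonneg (by positivity : 0 ≤ ε / ((t - s) ^ 2 + ε ^ 2))]
    simp only [h6]
    rw [h5]
    refine norm_integral_le_of_norm_le hint (Eventually.of_forall fun y => ?_)
    have := hbd t ε y
    rw [norm_mul] at this ⊢
    rwa [norm_norm]
  -- dominated convergence twice, with the majorant `‖f‖ / (1 + y²)`
  have hlim : Tendsto (fun ε : ℝ => ∫ t, (∫ y : ℝ, f (t + ε * y) * (1 + y ^ 2)⁻¹) ∂μ)
      (𝓝[>] 0) (𝓝 (∫ t, f t * Real.pi ∂μ)) := by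
    refine tendsto_integral_filter_of_dominated_convergence
      (fun _ => ∫ y : ℝ, ‖f‖ * (1 + y ^ 2)⁻¹) (Eventually.of_forall fun ε => ?_)
      (Eventually.of_forall fun ε => Eventually.of_forall fun t => hbd2 t ε)
      (integrable_const _) (Eventually.of_forall fun t => ?_)
    · have : Continuous fun p : ℝ × ℝ => f (p.1 + ε * p.2) * (1 + p.2 ^ 2)⁻¹ :=
        (f.continuous.comp (by fun_prop)).mul
          (Continuous.inv₀ (by fun_prop) fun p => by positivity)
      exact (this.aestronglyMeasurable (μ := μ.prod volume)).integral_prod_right'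
    · have h7 : ∫ y : ℝ, f t * (1 + y ^ 2)⁻¹ = f t * Real.pi := by
        rw [integral_const_mul, integral_univ_inv_one_add_sq]
      rw [← h7]
      refine tendsto_integral_filter_of_dominated_convergence
        (fun y => ‖f‖ * (1 + y ^ 2)⁻¹) (Eventually.of_forall fun ε => ?_)
        (Eventually.of_forall fun ε => Eventually.of_forall fun y => hbd t ε y)
        hint (Eventually.of_forall fun y => ?_)
      · exact ((f.continuous.comp (by fun_prop)).mul
          (Continuous.inv₀ (by fun_prop) fun p => by positivity)).aestronglyMeasurable
      · refine Tendsto.mul_const _ ((f.continuous.tendsto t).comp ?_)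
        have : Tendsto (fun ε : ℝ => t + ε * y) (𝓝 0) (𝓝 (t + 0 * y)) :=
          Continuous.tendsto (by fun_prop) 0
        simp only [zero_mul, add_zero] at this
        exact this.mono_left nhdsWithin_le_nhds
  refine hlim.congr' ?_
  filter_upwards [self_mem_nhdsWithin] with ε hε using (key ε hε).symm

/-- A finite measure on the line is determined by its Stieltjes transform. -/
theorem Measure.ext_of_stieltjes {μ ν : Measure ℝ} [IsFiniteMeasure μ] [IsFiniteMeasure ν]
    (h : ∀ z : ℂ, z.im ≠ 0 → ∫ t : ℝ, ((t : ℂ) - z)⁻¹ ∂μ = ∫ t : ℝ, ((t : ℂ) - z)⁻¹ ∂ν) :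
    μ = ν := by
  refine ext_of_forall_integral_eq_of_IsFiniteMeasure fun f => ?_
  have h1 := tendsto_integral_poisson μ f
  have h2 := tendsto_integral_poisson ν f
  have h3 : ∀ᶠ ε : ℝ in 𝓝[>] 0, (∫ s : ℝ, f s * ∫ t : ℝ, ε / ((t - s) ^ 2 + ε ^ 2) ∂μ)
      = ∫ s : ℝ, f s * ∫ t : ℝ, ε / ((t - s) ^ 2 + ε ^ 2) ∂ν := by
    filter_upwards [self_mem_nhdsWithin] with ε hε
    refine integral_congr_ae (Eventually.of_forall fun s => ?_)
    simp only
    rw [← im_stieltjes μ s (ne_of_gt hε), ← im_stieltjes ν s (ne_of_gt hε), h]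
    simpa using ne_of_gt hε
  have h4 := tendsto_nhds_unique (h1.congr' h3) h2
  rw [integral_mul_const, integral_mul_const] at h4
  exact mul_right_cancel₀ Real.pi_ne_zero h4

lemma measureReal_closedBall_le_poisson (μ : Measure ℝ) [IsFiniteMeasure μ] (x : ℝ) {δ : ℝ}
    (hδ : 0 < δ) : μ.real (Metric.closedBall x δ)
      ≤ 2 * δ * ∫ t : ℝ, δ / ((t - x) ^ 2 + δ ^ 2) ∂μ := by
  have h : ∫ t : ℝ, (Metric.closedBall x δ).indicator (fun _ => (2 * δ)⁻¹) t ∂μ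
      ≤ ∫ t : ℝ, δ / ((t - x) ^ 2 + δ ^ 2) ∂μ := by
    refine integral_mono ((integrable_const _).indicator measurableSet_closedBall)
      (integrable_poisson μ x hδ.ne') fun t => ?_
    by_cases ht : t ∈ Metric.closedBall x δ
    · rw [Set.indicator_of_mem ht]
      rw [Metric.mem_closedBall, Real.dist_eq] at ht
      have : (t - x) ^ 2 ≤ δ ^ 2 := sq_le_sq' (by linarith [neg_abs_le (t - x)])
        (by linarith [le_abs_self (t - x)])
      rw [inv_eq_one_div, div_le_div_iff₀ (by positivity) (by positivity)]
      nlinarith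
    · rw [Set.indicator_of_notMem ht]
      positivity
  rw [integral_indicator_const _ measurableSet_closedBall, smul_eq_mul] at h
  have h2 := mul_le_mul_of_nonneg_left h (by positivity : 0 ≤ 2 * δ)
  rwa [mul_comm (μ.real _), ← mul_assoc, mul_inv_cancel₀ (by positivity), one_mul] at h2

/-- If the Poisson integrals of `μ` at the points of `s` are frequently bounded by `C` near the
real axis, then `μ ≤ C · volume` on `s`, by Besicovitch differentiation. -/
theorem measure_le_of_poisson_le (μ : Measure ℝ) [IsFiniteMeasure μ] (s : Set ℝ) (C : NNReal)
    (h : ∀ x ∈ s, ∃ᶠ δ : ℝ in 𝓝[>] 0, ∫ t : ℝ, δ / ((t - x) ^ 2 + δ ^ 2) ∂μ ≤ C) :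
    μ s ≤ C * volume s := by
  have := (Besicovitch.vitaliFamily μ).measure_le_of_frequently_le (C • (volume : Measure ℝ))
    (ρ := μ) (s := s) Measure.AbsolutelyContinuous.rfl fun x hx => ?_
  · simpa using this
  · refine (Besicovitch.tendsto_filterAt μ x).frequently ?_
    refine ((h x hx).and_eventually self_mem_nhdsWithin).mono fun δ hδ => ?_
    obtain ⟨h1, h2⟩ := hδ
    have h2 : 0 < δ := h2
    have h3 := measureReal_closedBall_le_poisson μ x h2
    have h4 : μ.real (Metric.closedBall x δ) ≤ C * (2 * δ) :=
      h3.trans (by rw [mul_comm]; gcongr)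
    rw [Measure.smul_apply, Real.volume_closedBall, ← ofReal_measureReal]
    refine (ENNReal.ofReal_le_ofReal h4).trans ?_
    rw [ENNReal.ofReal_mul (by positivity), ENNReal.ofReal_coe_nnreal]
    rfl

/-- Where the Poisson integrals of `μ` stay bounded, `μ` is absolutely continuous. -/
theorem measure_eq_zero_of_poisson_bounded (μ : Measure ℝ) [IsFiniteMeasure μ] {s : Set ℝ}
    (hs : volume s = 0)
    (h : ∀ x ∈ s, ∃ C : ℝ, ∀ᶠ δ : ℝ in 𝓝[>] 0, ∫ t : ℝ, δ / ((t - x) ^ 2 + δ ^ 2) ∂μ ≤ C) :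
    μ s = 0 := by
  let S : ℕ → Set ℝ := fun n =>
    {x ∈ s | ∀ᶠ δ : ℝ in 𝓝[>] 0, ∫ t : ℝ, δ / ((t - x) ^ 2 + δ ^ 2) ∂μ ≤ n}
  -- `S n` consists of the points of `s` at which the bound `n` serves
  have hS : s ⊆ ⋃ n, S n := by
    intro x hx
    obtain ⟨C, hC⟩ := h x hx
    obtain ⟨n, hn⟩ := exists_nat_ge C
    exact Set.mem_iUnion.2 ⟨n, hx, hC.mono fun δ hδ => hδ.trans hn⟩
  refine measure_mono_null hS (measure_iUnion_null fun n => ?_)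
  have h1 := measure_le_of_poisson_le μ (S n) n fun x hx => by simpa using hx.2.frequently
  have h2 : volume (S n) = 0 := measure_mono_null (Set.sep_subset _ _) hs
  rw [h2, mul_zero] at h1
  exact le_antisymm h1 zero_le

/-- Where the Poisson integrals of `μ` tend to zero, `μ` vanishes. -/
theorem measure_eq_zero_of_poisson_tendsto_zero (μ : Measure ℝ) [IsFiniteMeasure μ] {s : Set ℝ}
    (h : ∀ x ∈ s, Tendsto (fun δ : ℝ => ∫ t : ℝ, δ / ((t - x) ^ 2 + δ ^ 2) ∂μ) (𝓝[>] 0) (𝓝 0)) :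
    μ s = 0 := by
  have hS : s ⊆ ⋃ n : ℕ, s ∩ Metric.closedBall 0 n := by
    intro x hx
    obtain ⟨n, hn⟩ := exists_nat_ge ‖x‖
    exact Set.mem_iUnion.2 ⟨n, hx, by simpa using hn⟩
  refine measure_mono_null hS (measure_iUnion_null fun n => ?_)
  have hfin : volume (s ∩ Metric.closedBall (0 : ℝ) n) ≠ ⊤ :=
    ((measure_mono Set.inter_subset_right).trans_lt measure_closedBall_lt_top).ne
  refine le_antisymm (ENNReal.le_of_forall_pos_le_add fun ε hε _ => ?_) zero_le
  rw [zero_add]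
  set V := (volume (s ∩ Metric.closedBall (0 : ℝ) n)).toNNReal with hV
  have hV' : volume (s ∩ Metric.closedBall (0 : ℝ) n) = V := (ENNReal.coe_toNNReal hfin).symm
  have h1 := measure_le_of_poisson_le μ (s ∩ Metric.closedBall (0 : ℝ) n) (ε / (V + 1))
    fun x hx => ((h x hx.1).eventually (eventually_le_nhds (by positivity))).frequently
  refine h1.trans ?_
  rw [hV', ← ENNReal.coe_mul, ENNReal.coe_le_coe, div_mul_eq_mul_div]
  exact div_le_of_le_mul₀ (by positivity) (by positivity) (by gcongr; simp)

end Stieltjes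

/-! ### Resolvents and spectral measures of a self-adjoint operator -/

section Resolvent

variable {E : Type*} [NormedAddCommGroup E] [InnerProductSpace ℂ E]

open scoped ComplexConjugate

/-- `R` is a family of resolvents of `A` on a set `ρ` which contains all nonreal numbers and at
least one real number, compatible with adjoints. The existence of such a family says that `A` is
self-adjoint and that its spectrum is not the whole line. -/
structure IsResolventFamily (A : E →ₗ.[ℂ] E) (ρ : Set ℂ) (R : ℂ → E →L[ℂ] E) : Prop where
  mem_of_im_ne_zero : ∀ z : ℂ, z.im ≠ 0 → z ∈ ρ
  exists_real : ∃ c : ℝ, (c : ℂ) ∈ ρ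
  mem_graph : ∀ z ∈ ρ, ∀ y, (R z y, y + z • R z y) ∈ A.graph
  left_inv : ∀ z ∈ ρ, ∀ p ∈ A.graph, R z (p.2 - z • p.1) = p.1
  inner_left : ∀ z ∈ ρ, ∀ x y, inner ℂ (R z x) y = inner ℂ x (R (conj z) y)

namespace IsResolventFamily

variable {A : E →ₗ.[ℂ] E} {ρ : Set ℂ} {R : ℂ → E →L[ℂ] E} (hA : IsResolventFamily A ρ R)

include hA

lemma eq_of_mem_graph {z : ℂ} (hz : z ∈ ρ) {φ ψ : E} (h : (φ, ψ + z • φ) ∈ A.graph) :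
    φ = R z ψ := by
  simpa using (hA.left_inv z hz _ h).symm

lemma mem_opResolventSet {z : ℂ} (hz : z ∈ ρ) : z ∈ opResolventSet A :=
  ⟨R z, hA.mem_graph z hz, fun x => hA.left_inv z hz _ (A.mem_graph x)⟩

/-- The first resolvent identity. -/
lemma resolvent_sub {z w : ℂ} (hz : z ∈ ρ) (hw : w ∈ ρ) (x : E) :
    R z x - R w x = (z - w) • R z (R w x) := by
  have h := hA.left_inv z hz _ (hA.mem_graph w hw x)
  simp only [map_sub, map_add, map_smul] at h
  rw [sub_smul, ← sub_eq_zero, ← sub_eq_zero.2 h]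
  abel

lemma resolvent_eigenvector {z e : ℂ} (hz : z ∈ ρ) (hze : z ≠ e) {x : E}
    (hx : x ∈ opEigenspace A e) : R z x = (e - z)⁻¹ • x := by
  have h : R z (e • x - z • x) = x := hA.left_inv z hz (x, e • x) hx
  rw [← sub_smul, map_smul] at h
  rw [eq_inv_smul_iff₀ (sub_ne_zero.2 hze.symm), h]

lemma eigenspace_eq_bot {z : ℂ} (hz : z ∈ ρ) : opEigenspace A z = ⊥ := by
  rw [eq_bot_iff]
  intro x hx
  have h : R z (z • x - z • x) = x := hA.left_inv z hz (x, z • x) hx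
  simpa using h.symm

lemma ne_zero_resolvent {z : ℂ} (hz : z ∈ ρ) {x : E} (h : R z x = 0) : x = 0 := by
  have h1 := hA.mem_graph z hz x
  rw [h, smul_zero, add_zero] at h1
  exact A.graph_fst_eq_zero_snd h1 rfl

lemma inner_resolvent_sub {z w : ℂ} (hz : z ∈ ρ) (hw : w ∈ ρ) (x : E) :
    inner ℂ x (R z x) - inner ℂ x (R (conj w) x)
      = (z - conj w) * inner ℂ (R w x) (R z x) := by
  by_cases hw' : conj w ∈ ρ
  · rw [hA.inner_left w hw, ← inner_sub_right,
      ← neg_sub (R (conj w) x), hA.resolvent_sub hw' hz, inner_neg_right, inner_smul_right]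
    ring
  · exfalso
    have : w.im = 0 := by
      by_contra h
      exact hw' (hA.mem_of_im_ne_zero _ (by simpa using h))
    exact hw' (by rwa [Complex.conj_eq_iff_im.2 this])

lemma im_inner_resolvent {z : ℂ} (hz : z ∈ ρ) (x : E) :
    (inner ℂ x (R z x)).im = z.im * ‖R z x‖ ^ 2 := by
  have h := hA.inner_resolvent_sub hz hz x
  have h2 : inner ℂ x (R (conj z) x) = conj (inner ℂ x (R z x)) := by
    rw [← hA.inner_left z hz, inner_conj_symm]
  rw [h2, Complex.sub_conj, Complex.sub_conj, inner_self_eq_norm_sq_to_K] at h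
  have := congrArg Complex.im h
  simp only [Complex.coe_algebraMap, ← Complex.ofReal_pow] at this
  simp [-Complex.ofReal_pow] at this
  linarith

lemma norm_resolvent_le {z : ℂ} (hz : z.im ≠ 0) (x : E) : ‖R z x‖ ≤ |z.im|⁻¹ * ‖x‖ := by
  have h := hA.im_inner_resolvent (hA.mem_of_im_ne_zero z hz) x
  have h1 : |z.im| * ‖R z x‖ ^ 2 ≤ ‖x‖ * ‖R z x‖ := by
    calc |z.im| * ‖R z x‖ ^ 2 = |(inner ℂ x (R z x)).im| := by
          rw [h, abs_mul, abs_of_nonneg (sq_nonneg ‖R z x‖)]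
      _ ≤ ‖inner ℂ x (R z x)‖ := Complex.abs_im_le_norm _
      _ ≤ _ := norm_inner_le_norm _ _
  have h0 : 0 < |z.im| := abs_pos.2 hz
  rcases (norm_nonneg (R z x)).eq_or_lt with h2 | h2
  · rw [← h2]; positivity
  · rw [le_inv_mul_iff₀ h0]
    nlinarith

lemma isSpectralMeasure_iff {ψ : E} {μ : Measure ℝ} : IsSpectralMeasure A ψ μ ↔
    IsFiniteMeasure μ ∧ ∀ z : ℂ, z.im ≠ 0 →
      inner ℂ ψ (R z ψ) = ∫ x : ℝ, ((x : ℂ) - z)⁻¹ ∂μ := by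
  refine and_congr_right fun _ => forall_congr' fun z => forall_congr' fun hz => ?_
  have hz' := hA.mem_of_im_ne_zero z hz
  constructor
  · rintro ⟨φ, h1, h2⟩
    rw [← hA.eq_of_mem_graph hz' h1, h2]
  · intro h
    exact ⟨R z ψ, hA.mem_graph z hz' ψ, h⟩

omit hA in
lemma _root_.IsSpectralMeasure.unique {ψ : E} {μ ν : Measure ℝ} (hA : IsResolventFamily A ρ R)
    (hμ : IsSpectralMeasure A ψ μ) (hν : IsSpectralMeasure A ψ ν) : μ = ν := by
  rw [hA.isSpectralMeasure_iff] at hμ hν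
  have := hμ.1
  have := hν.1
  exact Measure.ext_of_stieltjes fun z hz => (hμ.2 z hz).symm.trans (hν.2 z hz)

/-- Every vector has a spectral measure. It is the image of the measure which represents
`f ↦ ⟪ψ, f(T) ψ⟫`, for `T` the resolvent at a real point `c`, under `r ↦ 1 / r + c`. -/
theorem exists_spectralMeasure [CompleteSpace E] (ψ : E) : ∃ μ, IsSpectralMeasure A ψ μ := by
  obtain ⟨c, hc⟩ := hA.exists_real
  set T : E →L[ℂ] E := R c with hT
  have hsa : IsSelfAdjoint T := by
    rw [ContinuousLinearMap.isSelfAdjoint_iff_isSymmetric]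
    intro x y
    have := hA.inner_left c hc x y
    rwa [Complex.conj_ofReal] at this
  have hn : IsStarNormal T := hsa.isStarNormal
  let Φ := cfcHom (R := ℂ) hn
  let J : C(spectrum ℂ T, ℝ) → C(spectrum ℂ T, ℂ) := fun f => ⟨fun r => (f r : ℂ), by fun_prop⟩
  have hJstar : ∀ f, star (J f) = J f := fun f => by
    ext r; exact Complex.conj_ofReal _
  have hsymm : ∀ f x y, inner ℂ (Φ (J f) x) y = inner ℂ x (Φ (J f) y) := by
    intro f
    have : IsSelfAdjoint (Φ (J f)) := by
      rw [isSelfAdjoint_iff, ← map_star, hJstar]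
    exact (ContinuousLinearMap.isSelfAdjoint_iff_isSymmetric.1 this)
  have hreal : ∀ f, ((inner ℂ ψ (Φ (J f) ψ)).re : ℂ) = inner ℂ ψ (Φ (J f) ψ) := fun f => by
    rw [← Complex.conj_eq_iff_re, inner_conj_symm, hsymm]
  -- the functional `f ↦ ⟪ψ, f(T) ψ⟫`; it is positive as `⟪ψ, f(T) ψ⟫ = ‖√f(T) ψ‖²` for `f ≥ 0`
  let Λ : CompactlySupportedContinuousMap (spectrum ℂ T) ℝ →ₚ[ℝ] ℝ :=
    PositiveLinearMap.mk₀
      { toFun := fun f => (inner ℂ ψ (Φ (J f) ψ)).re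
        map_add' := fun f g => by
          have : J (f + g : CompactlySupportedContinuousMap (spectrum ℂ T) ℝ)
              = J f + J g := by ext r; simp [J]
          rw [this, map_add, add_apply, inner_add_right, Complex.add_re]
        map_smul' := fun a f => by
          have : J (a • f : CompactlySupportedContinuousMap (spectrum ℂ T) ℝ)
              = (a : ℂ) • J f := by ext r; simp [J]
          rw [this, map_smul, smul_apply, inner_smul_right,
            Complex.re_ofReal_mul, RingHom.id_apply, smul_eq_mul] }
      (fun f hf => by
        let g : C(spectrum ℂ T, ℝ) := ⟨fun r => √(f r), by fun_prop⟩
        have hg : J f = J g * J g := by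
          ext r
          have h0 : 0 ≤ f r := hf r
          simp only [J, g, ContinuousMap.coe_mk, ContinuousMap.mul_apply, ← Complex.ofReal_mul,
            Real.mul_self_sqrt h0]
        change 0 ≤ (inner ℂ ψ (Φ (J f) ψ)).re
        rw [hg, map_mul, mul_apply_eq_comp, ← hsymm, inner_self_eq_norm_sq_to_K]
        simp only [Complex.coe_algebraMap]
        rw [← Complex.ofReal_pow, Complex.ofReal_re]
        positivity)
  let m : Measure (spectrum ℂ T) := RealRMK.rieszMeasure Λ
  have hmfin : IsFiniteMeasure m := by
    constructor
    exact isCompact_univ.measure_lt_top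
  have hm : ∀ f : C(spectrum ℂ T, ℝ), ((∫ r, f r ∂m : ℝ) : ℂ) = inner ℂ ψ (Φ (J f) ψ) := by
    intro f
    have := RealRMK.integral_rieszMeasure Λ
      (CompactlySupportedContinuousMap.continuousMapEquiv f)
    rw [← hreal]
    exact congrArg _ this
  have hmc : ∀ f : C(spectrum ℂ T, ℂ), ∫ r, f r ∂m = inner ℂ ψ (Φ f ψ) := by
    intro f
    let u : C(spectrum ℂ T, ℝ) := ⟨fun r => (f r).re, by fun_prop⟩
    let v : C(spectrum ℂ T, ℝ) := ⟨fun r => (f r).im, by fun_prop⟩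
    have hf : f = J u + Complex.I • J v := by
      ext r
      simp only [J, u, v, ContinuousMap.add_apply, ContinuousMap.smul_apply, ContinuousMap.coe_mk,
        smul_eq_mul]
      rw [mul_comm, Complex.re_add_im]
    have hi : Integrable f m := f.continuous.integrable_of_hasCompactSupport
      (HasCompactSupport.of_compactSpace f)
    have h1 := hm u
    have h2 := hm v
    conv_rhs => rw [hf]
    rw [map_add, map_smul, add_apply, smul_apply,
      inner_add_right, inner_smul_right, ← h1, ← h2, mul_comm Complex.I]
    exact (integral_re_add_im hi).symm
  have him : ∀ r : spectrum ℂ T, (r : ℂ).im = 0 := fun r => by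
    rw [hsa.mem_spectrum_eq_re r.2, Complex.ofReal_im]
  let φ : spectrum ℂ T → ℝ := fun r => ((r : ℂ)⁻¹).re + c
  have hφm : Measurable φ := by fun_prop
  -- the point `0` of the spectrum of `T` stands for `∞` in the spectrum of `A`
  let N : Set (spectrum ℂ T) := {r | (r : ℂ) ≠ 0}
  have hN : MeasurableSet N :=
    (isOpen_compl_singleton.preimage continuous_subtype_val).measurableSet
  refine ⟨(m.restrict N).map φ, hA.isSpectralMeasure_iff.2 ⟨inferInstance, fun z hz => ?_⟩⟩
  have hden : ∀ r : spectrum ℂ T, 1 - (z - c) * (r : ℂ) ≠ 0 := by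
    intro r h
    have h1 := congrArg Complex.im h
    have h2 := congrArg Complex.re h
    simp [him r, hz] at h1
    have : (r : ℂ) = 0 := Complex.ext h1 (him r)
    simp [this] at h2
  -- the resolvent at `z` is the function `r / (1 - (z - c) r)` of `T`, as `1 / r + c - z` shows
  let s : C(spectrum ℂ T, ℂ) := ⟨fun r => (1 - (z - c) * (r : ℂ))⁻¹,
    Continuous.inv₀ (by fun_prop) hden⟩
  let i : C(spectrum ℂ T, ℂ) := ⟨fun r => r, by fun_prop⟩
  have hi : Φ i = T := cfcHom_id hn
  have hsi : s * (1 - (z - c) • i) = 1 := by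
    ext r
    simp only [s, i, ContinuousMap.mul_apply, ContinuousMap.sub_apply, ContinuousMap.one_apply,
      ContinuousMap.smul_apply, ContinuousMap.coe_mk, smul_eq_mul]
    exact inv_mul_cancel₀ (hden r)
  have hTR : (1 - (z - c) • T) (R z ψ) = T ψ := by
    have h1 := hA.resolvent_sub hc (hA.mem_of_im_ne_zero z hz) ψ
    simp only [sub_apply, one_apply_eq_self,
      smul_apply, ← hT] at h1 ⊢
    rw [← neg_sub z, neg_smul] at h1
    rw [sub_eq_iff_eq_add] at h1
    rw [h1]; abel
  have hRz : R z ψ = Φ (s * i) ψ := by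
    have h1 : Φ s * (1 - (z - c) • T) = 1 := by
      have h2 := congrArg Φ hsi
      rwa [map_mul, map_sub, map_one, map_smul, hi] at h2
    rw [map_mul, hi, mul_apply_eq_comp, ← hTR, ← mul_apply_eq_comp, h1,
      one_apply_eq_self]
  rw [hRz, ← hmc, integral_map hφm.aemeasurable
    (by fun_prop : Measurable fun t : ℝ => ((t : ℂ) - z)⁻¹).aestronglyMeasurable,
    ← integral_indicator hN]
  refine integral_congr_ae (Eventually.of_forall fun r => ?_)
  simp only [Set.indicator_apply]
  split_ifs with hr
  · have hr : (r : ℂ) ≠ 0 := hr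
    have h3 : (((r : ℂ)⁻¹).re : ℂ) = (r : ℂ)⁻¹ := by
      rw [← Complex.conj_eq_iff_re, Complex.conj_eq_iff_im, Complex.inv_im, him r]; simp
    simp only [s, i, φ, ContinuousMap.mul_apply, ContinuousMap.coe_mk, Complex.ofReal_add, h3]
    have h4 := hden r
    have h5 : (r : ℂ)⁻¹ + c - z = (1 - (z - c) * r) * (r : ℂ)⁻¹ := by
      field_simp; ring
    rw [h5, mul_inv, inv_inv]
  -- a possible mass at `0` is lost on the left-hand side as well, where the integrand vanishes
  · have hr : (r : ℂ) = 0 := by simpa [N] using hr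
    simp [s, i, hr]

end IsResolventFamily

end Resolvent

/-! ### Null sets of spectral measures, and atoms -/

section SpectralMeasure

variable {E : Type*} [NormedAddCommGroup E] [InnerProductSpace ℂ E]

open scoped ComplexConjugate

open Classical in
/-- The spectral measure of `A` at `ψ` (zero if there is none). -/
def specMeasure (A : E →ₗ.[ℂ] E) (ψ : E) : Measure ℝ :=
  if h : ∃ μ, IsSpectralMeasure A ψ μ then h.choose else 0

instance (A : E →ₗ.[ℂ] E) (ψ : E) : IsFiniteMeasure (specMeasure A ψ) := by
  unfold specMeasure
  split_ifs with h
  · exact h.choose_spec.1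
  · infer_instance

lemma integrable_conj_mul (μ : Measure ℝ) [IsFiniteMeasure μ] {z w : ℂ} (hz : z.im ≠ 0)
    (hw : w.im ≠ 0) : Integrable (fun x : ℝ => conj ((x : ℂ) - w)⁻¹ * ((x : ℂ) - z)⁻¹) μ := by
  refine (integrable_inv_ofReal_sub μ hz).bdd_mul (c := |w.im|⁻¹) ?_
    (Eventually.of_forall fun x => ?_)
  · exact (by fun_prop : Measurable fun t : ℝ => conj ((t : ℂ) - w)⁻¹).aestronglyMeasurable
  · rw [RCLike.norm_conj]
    exact norm_inv_ofReal_sub_le x hw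

namespace IsResolventFamily

variable {A : E →ₗ.[ℂ] E} {ρ : Set ℂ} {R : ℂ → E →L[ℂ] E} (hA : IsResolventFamily A ρ R)
  [CompleteSpace E]

include hA

lemma isSpectralMeasure (ψ : E) : IsSpectralMeasure A ψ (specMeasure A ψ) := by
  have h := hA.exists_spectralMeasure ψ
  rw [specMeasure, dif_pos h]
  exact h.choose_spec

lemma specMeasure_eq {ψ : E} {μ : Measure ℝ} (h : IsSpectralMeasure A ψ μ) :
    specMeasure A ψ = μ :=
  (hA.isSpectralMeasure ψ).unique hA h

lemma inner_resolvent_eq (ψ : E) {z : ℂ} (hz : z.im ≠ 0) :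
    inner ℂ ψ (R z ψ) = ∫ x : ℝ, ((x : ℂ) - z)⁻¹ ∂(specMeasure A ψ) :=
  (hA.isSpectralMeasure_iff.1 (hA.isSpectralMeasure ψ)).2 z hz

lemma specMeasure_parallelogram (ψ φ : E) :
    specMeasure A (ψ + φ) + specMeasure A (ψ - φ)
      = (specMeasure A ψ + specMeasure A ψ) + (specMeasure A φ + specMeasure A φ) := by
  refine Measure.ext_of_stieltjes fun z hz => ?_
  have hi : ∀ χ, Integrable (fun t : ℝ => ((t : ℂ) - z)⁻¹) (specMeasure A χ) :=
    fun χ => integrable_inv_ofReal_sub _ hz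
  rw [integral_add_measure (hi _) (hi _), integral_add_measure
    ((hi _).add_measure (hi _)) ((hi _).add_measure (hi _)), integral_add_measure (hi _) (hi _),
    integral_add_measure (hi _) (hi _)]
  simp only [← hA.inner_resolvent_eq _ hz, map_add, map_sub, inner_add_left, inner_add_right,
    inner_sub_left, inner_sub_right]
  ring

lemma specMeasure_add_le (ψ φ : E) (B : Set ℝ) :
    specMeasure A (ψ + φ) B ≤ 2 * specMeasure A ψ B + 2 * specMeasure A φ B := by
  have h := congrArg (fun μ : Measure ℝ => μ B) (hA.specMeasure_parallelogram ψ φ)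
  simp only [Measure.add_apply] at h
  rw [two_mul, two_mul, ← h]
  exact le_self_add

lemma specMeasure_smul (c : ℂ) (ψ : E) :
    specMeasure A (c • ψ) = (‖c‖₊ ^ 2) • specMeasure A ψ := by
  refine Measure.ext_of_stieltjes fun z hz => ?_
  rw [integral_smul_nnreal_measure, ← hA.inner_resolvent_eq _ hz, ← hA.inner_resolvent_eq _ hz,
    map_smul, inner_smul_left, inner_smul_right, ← mul_assoc, Complex.conj_mul', NNReal.smul_def]
  simp

lemma specMeasure_univ_le (ψ : E) : (specMeasure A ψ).real Set.univ ≤ ‖ψ‖ ^ 2 := by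
  set μ := specMeasure A ψ
  -- the total mass is the limit of `y Im ⟪ψ, R(iy) ψ⟫ = ‖y R(iy) ψ‖² ≤ ‖ψ‖²`
  have hlim : Tendsto (fun y : ℝ => ∫ t : ℝ, y * (y / ((t - 0) ^ 2 + y ^ 2)) ∂μ) atTop
      (𝓝 (∫ t : ℝ, 1 ∂μ)) := by
    refine tendsto_integral_filter_of_dominated_convergence (fun _ => 1)
      (Eventually.of_forall fun y => ?_) (Eventually.of_forall fun y =>
        Eventually.of_forall fun t => ?_) (integrable_const _) (Eventually.of_forall fun t => ?_)
    · exact (by fun_prop : Measurable fun t : ℝ =>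
        y * (y / ((t - 0) ^ 2 + y ^ 2))).aestronglyMeasurable
    · rw [← mul_div_assoc, Real.norm_of_nonneg (div_nonneg (mul_self_nonneg y) (by positivity))]
      exact div_le_one_of_le₀ (by nlinarith [sq_nonneg (t - 0)]) (by positivity)
    · have h1 : Tendsto (fun y : ℝ => (t ^ 2 * (y⁻¹) ^ 2 + 1)⁻¹) atTop
          (𝓝 ((t ^ 2 * 0 ^ 2 + 1)⁻¹)) := by
        refine Tendsto.inv₀ (((tendsto_inv_atTop_zero.pow 2).const_mul _).add_const 1) (by simp)
      simp only [ne_eq, OfNat.ofNat_ne_zero, not_false_eq_true, zero_pow, mul_zero, zero_add,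
        inv_one] at h1
      refine h1.congr' ?_
      filter_upwards [eventually_gt_atTop 0] with y hy
      have : t ^ 2 + y ^ 2 ≠ 0 := by positivity
      rw [sub_zero]
      field_simp
  have hle : ∀ᶠ y : ℝ in atTop, ∫ t : ℝ, y * (y / ((t - 0) ^ 2 + y ^ 2)) ∂μ ≤ ‖ψ‖ ^ 2 := by
    filter_upwards [eventually_gt_atTop 0] with y hy
    have hz : ((0 : ℝ) + y * Complex.I : ℂ).im = y := by simp
    have hz' : ((0 : ℝ) + y * Complex.I : ℂ).im ≠ 0 := by rw [hz]; exact hy.ne'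
    rw [integral_const_mul, ← im_stieltjes μ 0 hy.ne', ← hA.inner_resolvent_eq _ hz',
      hA.im_inner_resolvent (hA.mem_of_im_ne_zero _ hz'), hz]
    have h2 := hA.norm_resolvent_le hz' ψ
    rw [hz, abs_of_pos hy, le_inv_mul_iff₀ hy] at h2
    calc y * (y * ‖R ((0 : ℝ) + y * Complex.I) ψ‖ ^ 2)
        = (y * ‖R ((0 : ℝ) + y * Complex.I) ψ‖) ^ 2 := by ring
      _ ≤ _ := by gcongr
  have := le_of_tendsto hlim hle
  simpa using this

lemma eq_zero_of_specMeasure_eq_zero {ψ : E} (h : specMeasure A ψ = 0) : ψ = 0 := by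
  have h1 := hA.im_inner_resolvent (z := Complex.I) (hA.mem_of_im_ne_zero _ (by simp)) ψ
  rw [hA.inner_resolvent_eq _ (by simp), h] at h1
  simp only [integral_zero_measure, Complex.zero_im, Complex.I_im, one_mul] at h1
  exact hA.ne_zero_resolvent (hA.mem_of_im_ne_zero _ (by simp : Complex.I.im ≠ 0))
    (by simpa using h1.symm)

/-- The closed subspace of all vectors whose spectral measure vanishes on `B`. It is closed under
addition by `specMeasure_add_le` and topologically closed by `specMeasure_univ_le`. -/
lemma exists_nullSubspace (B : Set ℝ) : ∃ K : Submodule ℂ E,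
    IsClosed (K : Set E) ∧ ∀ ψ, ψ ∈ K ↔ specMeasure A ψ B = 0 := by
  refine ⟨{ carrier := {ψ | specMeasure A ψ B = 0}
            zero_mem' := ?_
            add_mem' := ?_
            smul_mem' := ?_ }, ?_, fun ψ => Iff.rfl⟩
  · intro a b ha hb
    have := hA.specMeasure_add_le a b B
    rw [ha, hb] at this
    simpa using this
  · have := hA.specMeasure_smul 0 0
    simp only [smul_zero, nnnorm_zero, ne_eq, OfNat.ofNat_ne_zero, not_false_eq_true, zero_pow,
      zero_smul] at this
    simp [this]
  · intro c a ha
    have ha : specMeasure A a B = 0 := ha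
    change specMeasure A (c • a) B = 0
    rw [hA.specMeasure_smul, Measure.smul_apply, ha, smul_zero]
  · refine isClosed_of_closure_subset fun ψ hψ => ?_
    change specMeasure A ψ B = 0
    refine le_antisymm (ENNReal.le_of_forall_pos_le_add fun ε hε _ => ?_) zero_le
    obtain ⟨φ, hφ, hd⟩ := Metric.mem_closure_iff.1 hψ (√(ε / 2))
      (Real.sqrt_pos.2 (by positivity))
    have hφ : specMeasure A φ B = 0 := hφ
    have h1 := hA.specMeasure_add_le φ (ψ - φ) B
    rw [add_sub_cancel, hφ, mul_zero, zero_add] at h1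
    have h2 : specMeasure A (ψ - φ) B ≤ ENNReal.ofReal (ε / 2) := by
      refine (measure_mono (Set.subset_univ B)).trans ?_
      rw [← ofReal_measureReal]
      refine ENNReal.ofReal_le_ofReal ((hA.specMeasure_univ_le _).trans ?_)
      rw [← dist_eq_norm]
      have h3 : dist ψ φ ^ 2 ≤ √((ε : ℝ) / 2) ^ 2 := by gcongr
      rwa [Real.sq_sqrt (by positivity)] at h3
    rw [zero_add]
    calc specMeasure A ψ B ≤ 2 * specMeasure A (ψ - φ) B := h1
      _ ≤ 2 * ENNReal.ofReal (ε / 2) := by gcongr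
      _ = ε := by
        rw [← ENNReal.ofReal_ofNat, ← ENNReal.ofReal_mul (by norm_num),
          mul_div_cancel₀ _ (by norm_num), ENNReal.ofReal_coe_nnreal]

/-- If the spectral measures of all vectors in `S` and of all vectors orthogonal to `S` vanish on
`B`, then so do those of all vectors. -/
theorem specMeasure_eq_zero_of_total {B : Set ℝ} {S : Set E}
    (h1 : ∀ ψ ∈ S, specMeasure A ψ B = 0)
    (h2 : ∀ ψ, (∀ φ ∈ S, inner ℂ φ ψ = 0) → specMeasure A ψ B = 0) (ψ : E) :
    specMeasure A ψ B = 0 := by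
  obtain ⟨K, hKc, hK⟩ := hA.exists_nullSubspace B
  have hcomp : CompleteSpace K := hKc.completeSpace_coe
  have hbot : Kᗮ = ⊥ := by
    rw [eq_bot_iff]
    intro φ hφ
    have h3 : φ ∈ K := (hK φ).2 (h2 φ fun χ hχ =>
      (Submodule.mem_orthogonal K φ).1 hφ χ ((hK χ).2 (h1 χ hχ)))
    have := (Submodule.mem_orthogonal K φ).1 hφ φ h3
    simpa using this
  rw [← hK ψ, (Submodule.orthogonal_eq_bot_iff).1 hbot]
  trivial

/-- The functional calculus is isometric on combinations of two resolvents. -/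
lemma inner_resolvent_resolvent (ψ : E) {z w : ℂ} (hz : 0 < z.im) (hw : 0 < w.im) :
    inner ℂ (R w ψ) (R z ψ)
      = ∫ x : ℝ, conj ((x : ℂ) - w)⁻¹ * ((x : ℂ) - z)⁻¹ ∂(specMeasure A ψ) := by
  have hwc : (conj w).im ≠ 0 := by simpa using hw.ne'
  have h := hA.inner_resolvent_sub (hA.mem_of_im_ne_zero z hz.ne') (hA.mem_of_im_ne_zero w hw.ne') ψ
  have hzw : z - conj w ≠ 0 := by
    intro h
    have := congrArg Complex.im h
    simp at this
    linarith
  rw [← mul_right_inj' hzw, ← h, hA.inner_resolvent_eq _ hz.ne', hA.inner_resolvent_eq _ hwc,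
    ← integral_sub (integrable_inv_ofReal_sub _ hz.ne') (integrable_inv_ofReal_sub _ hwc),
    ← integral_const_mul]
  refine integral_congr_ae (Eventually.of_forall fun x => ?_)
  have h1 : (x : ℂ) - z ≠ 0 := fun h => hz.ne' (by simpa using congrArg Complex.im h)
  have h2 : (x : ℂ) - conj w ≠ 0 := fun h => hw.ne' (by simpa using congrArg Complex.im h)
  simp only [map_inv₀, map_sub, Complex.conj_ofReal]
  field_simp
  ring

lemma norm_smul_resolvent_sub_sq (ψ : E) {z w : ℂ} (hz : 0 < z.im) (hw : 0 < w.im) (a b : ℂ) :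
    ‖a • R z ψ - b • R w ψ‖ ^ 2
      = ∫ x : ℝ, ‖a * ((x : ℂ) - z)⁻¹ - b * ((x : ℂ) - w)⁻¹‖ ^ 2 ∂(specMeasure A ψ) := by
  apply Complex.ofReal_injective
  rw [← integral_complex_ofReal]
  have h := inner_self_eq_norm_sq_to_K (𝕜 := ℂ) (a • R z ψ - b • R w ψ)
  simp only [Complex.coe_algebraMap, ← Complex.ofReal_pow] at h
  rw [← h]
  simp only [inner_sub_left, inner_sub_right, inner_smul_left, inner_smul_right, mul_sub,
    hA.inner_resolvent_resolvent ψ hz hz, hA.inner_resolvent_resolvent ψ hz hw,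
    hA.inner_resolvent_resolvent ψ hw hz, hA.inner_resolvent_resolvent ψ hw hw,
    ← integral_const_mul]
  have hi := fun {z w : ℂ} (hz : 0 < z.im) (hw : 0 < w.im) (c d : ℂ) =>
    ((integrable_conj_mul (specMeasure A ψ) hz.ne' hw.ne').const_mul c).const_mul d
  rw [← integral_sub (hi hz hz _ _) (hi hz hw _ _), ← integral_sub (hi hw hz _ _) (hi hw hw _ _)]
  refine (integral_sub ((hi hz hz _ _).sub (hi hz hw _ _))
    ((hi hw hz _ _).sub (hi hw hw _ _))).symm.trans
    (integral_congr_ae (Eventually.of_forall fun x => ?_))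
  simp only [Pi.sub_apply, Complex.ofReal_pow, ← Complex.conj_mul', map_sub, map_mul]
  ring

/-- The atom of the spectral measure of `ψ` at a real point `e` comes from the projection `v` of
`ψ` to the eigenspace, which is the limit of `-iδ (A - e - iδ)⁻¹ ψ` as `δ → 0`. -/
theorem exists_eigenprojection (ψ : E) (e : ℝ) : ∃ v ∈ opEigenspace A e,
    inner ℂ ψ v = ((specMeasure A ψ).real {e} : ℂ) ∧
    ∀ x ∈ opEigenspace A e, inner ℂ x v = inner ℂ x ψ := by
  set μ := specMeasure A ψ with hμ
  let δ : ℕ → ℝ := fun n => 1 / ((n : ℝ) + 1)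
  have hδ : ∀ n, 0 < δ n := fun n => Nat.one_div_pos_of_nat
  have hδ0 : Tendsto δ atTop (𝓝 0) := tendsto_one_div_add_atTop_nhds_zero_nat
  let z : ℕ → ℂ := fun n => e + δ n * Complex.I
  have hz : ∀ n, (z n).im = δ n := fun n => by simp [z]
  have hz' : ∀ n, 0 < (z n).im := fun n => by rw [hz]; exact hδ n
  have hzρ : ∀ n, z n ∈ ρ := fun n => hA.mem_of_im_ne_zero _ (hz' n).ne'
  let a : ℕ → ℂ := fun n => -(Complex.I * δ n)
  let v : ℕ → E := fun n => a n • R (z n) ψ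
  -- `v n` is the function `p n` of the operator; `p n` tends to the indicator function of `{e}`
  -- and is bounded by `1`
  let p : ℕ → ℝ → ℂ := fun n x => a n * ((x : ℂ) - z n)⁻¹
  have hpm : ∀ n, Measurable (p n) := fun n => by fun_prop
  have hp1 : ∀ n x, ‖p n x‖ ≤ 1 := by
    intro n x
    have h := norm_inv_ofReal_sub_le x (hz' n).ne'
    rw [hz, abs_of_pos (hδ n)] at h
    have h2 : ‖a n‖ = δ n := by simp [a, abs_of_pos (hδ n)]
    calc ‖p n x‖ = δ n * ‖((x : ℂ) - z n)⁻¹‖ := by rw [norm_mul, h2]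
      _ ≤ δ n * (δ n)⁻¹ := by gcongr
      _ = 1 := mul_inv_cancel₀ (hδ n).ne'
  have hz0 : Tendsto z atTop (𝓝 (e : ℂ)) := by
    have h : Tendsto (fun n => (e : ℂ) + δ n * Complex.I) atTop
      (𝓝 ((e : ℂ) + (0 : ℝ) * Complex.I)) :=
      (((Complex.continuous_ofReal.tendsto 0).comp hδ0).mul_const _).const_add _
    simpa using h
  have ha0 : Tendsto a atTop (𝓝 0) := by
    have h : Tendsto (fun n => -(Complex.I * δ n)) atTop (𝓝 (-(Complex.I * (0 : ℝ)))) :=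
      (((Complex.continuous_ofReal.tendsto 0).comp hδ0).const_mul _).neg
    simpa using h
  have hlim : ∀ x : ℝ, Tendsto (fun n => p n x) atTop
      (𝓝 (({e} : Set ℝ).indicator (fun _ => (1 : ℂ)) x)) := by
    intro x
    by_cases hx : x = e
    · rw [Set.indicator_of_mem (by simpa using hx)]
      refine tendsto_const_nhds.congr fun n => ?_
      have h3 : (δ n : ℂ) ≠ 0 := Complex.ofReal_ne_zero.2 (hδ n).ne'
      simp only [p, a, z, hx]
      field_simp
      simp
    · rw [Set.indicator_of_notMem (by simpa using hx)]
      have h3 : (x : ℂ) - e ≠ 0 := by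
        rw [← Complex.ofReal_sub]; exact Complex.ofReal_ne_zero.2 (sub_ne_zero.2 hx)
      have h4 := ha0.mul ((tendsto_const_nhds (x := (x : ℂ))).sub hz0 |>.inv₀ h3)
      rwa [zero_mul] at h4
  have hcauchy : CauchySeq v := by
    rw [cauchySeq_iff_tendsto_dist_atTop_0]
    -- the functional calculus is isometric, so it is enough that `p n` is Cauchy in `L²(μ)`
    have h5 : Tendsto (fun n : ℕ × ℕ => ∫ x, ‖p n.1 x - p n.2 x‖ ^ 2 ∂μ) atTop
        (𝓝 (∫ x, ‖({e} : Set ℝ).indicator (fun _ => (1 : ℂ)) x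
          - ({e} : Set ℝ).indicator (fun _ => (1 : ℂ)) x‖ ^ 2 ∂μ)) := by
      rw [← prod_atTop_atTop_eq]
      refine tendsto_integral_filter_of_dominated_convergence (fun _ => 2 ^ 2)
        (Eventually.of_forall fun n => ?_) (Eventually.of_forall fun n =>
          Eventually.of_forall fun x => ?_) (integrable_const _) (Eventually.of_forall fun x => ?_)
      · exact (((hpm _).sub (hpm _)).norm.pow_const 2).aestronglyMeasurable
      · rw [norm_pow, norm_norm]
        have := norm_sub_le (p n.1 x) (p n.2 x)
        gcongr
        linarith [hp1 n.1 x, hp1 n.2 x]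
      · exact (((hlim x).comp tendsto_fst).sub ((hlim x).comp tendsto_snd)).norm.pow 2
    simp only [sub_self, norm_zero, ne_eq, OfNat.ofNat_ne_zero, not_false_eq_true, zero_pow,
      integral_zero] at h5
    have h6 : (fun n : ℕ × ℕ => ∫ x, ‖p n.1 x - p n.2 x‖ ^ 2 ∂μ)
        = fun n : ℕ × ℕ => dist (v n.1) (v n.2) ^ 2 := by
      ext n
      rw [dist_eq_norm, hA.norm_smul_resolvent_sub_sq ψ (hz' _) (hz' _)]
    rw [h6] at h5
    have h7 := (Real.continuous_sqrt.tendsto 0).comp h5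
    simp only [Real.sqrt_zero] at h7
    refine h7.congr fun n => ?_
    simp [Real.sqrt_sq dist_nonneg]
  obtain ⟨w, hw⟩ := cauchySeq_tendsto_of_complete hcauchy
  refine ⟨w, ?_, ?_, ?_⟩
  -- the limit is an eigenvector: the equation for `v n`, with `R(i)` applied to it, is continuous
  · have hI : Complex.I ∈ ρ := hA.mem_of_im_ne_zero _ (by simp)
    have h8 : ∀ n, R Complex.I (a n • ψ + z n • v n - Complex.I • v n) = v n := by
      intro n
      have h9 := A.graph.smul_mem (a n) (hA.mem_graph (z n) (hzρ n) ψ)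
      have h10 := hA.left_inv Complex.I hI _ h9
      simp only [Prod.smul_mk, smul_add] at h10
      rw [smul_comm (a n) (z n)] at h10
      exact h10
    have h11 : Tendsto (fun n => a n • ψ + z n • v n - Complex.I • v n) atTop
        (𝓝 ((0 : ℂ) • ψ + (e : ℂ) • w - Complex.I • w)) :=
      ((ha0.smul_const ψ).add (hz0.smul hw)).sub (hw.const_smul _)
    have h12 := ((R Complex.I).continuous.tendsto _).comp h11
    have h13 := tendsto_nhds_unique (h12.congr h8) hw
    have h14 := hA.mem_graph Complex.I hI ((0 : ℂ) • ψ + (e : ℂ) • w - Complex.I • w)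
    rw [h13, sub_add_cancel, zero_smul, zero_add] at h14
    exact h14
  · have h15 : Tendsto (fun n => ∫ x, p n x ∂μ) atTop
        (𝓝 (∫ x, ({e} : Set ℝ).indicator (fun _ => (1 : ℂ)) x ∂μ)) := by
      refine tendsto_integral_filter_of_dominated_convergence (fun _ => 1)
        (Eventually.of_forall fun n => (hpm n).aestronglyMeasurable) (Eventually.of_forall fun n =>
          Eventually.of_forall fun x => hp1 n x) (integrable_const _) (Eventually.of_forall hlim)
    rw [integral_indicator_const _ (measurableSet_singleton e)] at h15
    have h16 : ∀ n, ∫ x, p n x ∂μ = inner ℂ ψ (v n) := by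
      intro n
      rw [inner_smul_right, hA.inner_resolvent_eq _ (hz' n).ne', ← integral_const_mul]
    have h17 := tendsto_nhds_unique (h15.congr h16) ((tendsto_const_nhds (x := ψ)).inner hw)
    simpa using h17.symm
  · intro x hx
    have h18 : ∀ n, inner ℂ x (v n) = inner ℂ x ψ := by
      intro n
      have h19 : conj (z n) ∈ ρ := hA.mem_of_im_ne_zero _ (by simpa using (hz' n).ne')
      have h20 : inner ℂ x (R (z n) ψ) = inner ℂ (R (conj (z n)) x) ψ := by
        rw [hA.inner_left _ h19, Complex.conj_conj]
      have h3 : (δ n : ℂ) ≠ 0 := Complex.ofReal_ne_zero.2 (hδ n).ne'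
      have h21 : conj (z n) ≠ e := fun h => by
        have := congrArg Complex.im h
        simp [hz, (hδ n).ne'] at this
      rw [inner_smul_right, h20, hA.resolvent_eigenvector h19 h21 hx, inner_smul_left,
        ← mul_assoc]
      convert one_mul _
      simp only [map_inv₀, map_sub, Complex.conj_conj, Complex.conj_ofReal, a, z]
      field_simp
      simp
    exact tendsto_nhds_unique ((tendsto_const_nhds (x := x)).inner hw)
      (tendsto_const_nhds.congr fun n => (h18 n).symm)

/-- The spectral measure of `ψ` has no atom at `e` if and only if `ψ` is orthogonal to the
eigenspace. -/
lemma specMeasure_singleton_eq_zero_iff (ψ : E) (e : ℝ) : specMeasure A ψ {e} = 0 ↔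
    ∀ x ∈ opEigenspace A e, inner ℂ x ψ = 0 := by
  obtain ⟨v, hv, h1, h2⟩ := hA.exists_eigenprojection ψ e
  constructor
  · intro h x hx
    rw [measureReal_def, h, ENNReal.toReal_zero, Complex.ofReal_zero] at h1
    have h3 := h2 v hv
    rw [← inner_conj_symm v ψ, h1, map_zero, inner_self_eq_zero] at h3
    rw [← h2 x hx, h3, inner_zero_right]
  · intro h
    have h3 := h v hv
    rw [← inner_conj_symm, h1, Complex.conj_ofReal, Complex.ofReal_eq_zero,
      measureReal_eq_zero_iff] at h3
    exact h3

/-- The spectral measure of an eigenvector is a point mass at the eigenvalue. -/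
lemma specMeasure_of_mem_eigenspace {x : E} {e : ℝ} (hx : x ∈ opEigenspace A e) :
    specMeasure A x {e}ᶜ = 0 := by
  have : IsSpectralMeasure A x (ENNReal.ofReal (‖x‖ ^ 2) • Measure.dirac e) := by
    rw [hA.isSpectralMeasure_iff]
    refine ⟨(Measure.dirac e).smul_finite ENNReal.ofReal_ne_top, fun z hz => ?_⟩
    have hze : z ≠ e := fun h => hz (by rw [h, Complex.ofReal_im])
    rw [hA.resolvent_eigenvector (hA.mem_of_im_ne_zero z hz) hze hx, inner_smul_right,
      inner_self_eq_norm_sq_to_K, integral_smul_measure, integral_dirac,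
      ENNReal.toReal_ofReal (by positivity), Complex.real_smul, mul_comm]
    simp
  rw [hA.specMeasure_eq this, Measure.smul_apply]
  simp

end IsResolventFamily

end SpectralMeasure

/-! ### Parts of the spectrum -/

section Spectra

variable {E : Type*} [NormedAddCommGroup E] [InnerProductSpace ℂ E]

open scoped ComplexConjugate

lemma mem_opPart_graph {A : E →ₗ.[ℂ] E} {K : Submodule ℂ E} {p : K × K} :
    p ∈ (opPart A K).graph ↔ ((p.1 : E), (p.2 : E)) ∈ A.graph := by
  rw [opPart, Submodule.toLinearPMap_graph_eq]
  · rfl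
  · intro q hq h0
    have hq : ((q.1 : E), (q.2 : E)) ∈ A.graph := hq
    have := A.graph_fst_eq_zero_snd hq (by simp [h0])
    exact Subtype.ext this

/-- Approximate eigenvectors force a point into the spectrum. -/
lemma mem_opSpectrum_of_approx {B : E →ₗ.[ℂ] E} {z : ℂ}
    (h : ∀ ε > 0, ∃ p ∈ B.graph, p.1 ≠ 0 ∧ ‖p.2 - z • p.1‖ ≤ ε * ‖p.1‖) : z ∈ opSpectrum B := by
  rintro ⟨S, -, h2⟩
  obtain ⟨⟨x, y⟩, hp, hx, hle⟩ := h (‖S‖ + 1)⁻¹ (by positivity)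
  obtain ⟨⟨x', hx'⟩, rfl, rfl⟩ := B.mem_graph_iff.1 hp
  have h3 := h2 ⟨x', hx'⟩
  simp only at hx hle h3
  have h4 := S.le_opNorm (B ⟨x', hx'⟩ - z • x')
  rw [h3] at h4
  have hpos : 0 < ‖x'‖ := norm_pos_iff.2 hx
  have : ‖x'‖ < ‖x'‖ := calc
    ‖x'‖ ≤ ‖S‖ * ((‖S‖ + 1)⁻¹ * ‖x'‖) := h4.trans (by gcongr)
    _ = ‖S‖ / (‖S‖ + 1) * ‖x'‖ := by ring
    _ < 1 * ‖x'‖ := by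
      gcongr
      rw [div_lt_one (by positivity)]
      linarith
    _ = ‖x'‖ := one_mul _
  exact lt_irrefl _ this

/-- The resolvent set contains the disc around `z₀` on which the Neumann series converges. -/
lemma mem_opResolventSet_of_norm_lt [CompleteSpace E] {B : E →ₗ.[ℂ] E} {z₀ z : ℂ}
    (S : E →L[ℂ] E) (h1 : ∀ y, (S y, y + z₀ • S y) ∈ B.graph)
    (h2 : ∀ p ∈ B.graph, S (p.2 - z₀ • p.1) = p.1) (h3 : ‖z - z₀‖ * ‖S‖ < 1) :
    z ∈ opResolventSet B := by
  set T : E →L[ℂ] E := (z - z₀) • S with hT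
  have hTn : ‖T‖ < 1 := by rwa [hT, norm_smul]
  set V := Units.oneSub T hTn
  have hV : (V : E →L[ℂ] E) = 1 - T := rfl
  set U : E →L[ℂ] E := ((V⁻¹ : (E →L[ℂ] E)ˣ) : E →L[ℂ] E) with hU
  have hUV : U * (1 - T) = 1 := by rw [← hV, hU, Units.inv_mul]
  have hVU : (1 - T) * U = 1 := by rw [← hV, hU, Units.mul_inv]
  have hcomm : S * U = U * S := by
    have hc : (1 - T) * S = S * (1 - T) := by
      rw [hT, sub_mul, mul_sub, one_mul, mul_one, smul_mul_assoc, mul_smul_comm]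
    calc S * U = U * (1 - T) * (S * U) := by rw [hUV, one_mul]
      _ = U * ((1 - T) * S) * U := by simp only [mul_assoc]
      _ = U * S * ((1 - T) * U) := by rw [hc]; simp only [mul_assoc]
      _ = U * S := by rw [hVU, mul_one]
  refine ⟨S * U, fun y => ?_, fun x => ?_⟩
  · have h4 : U y - (z - z₀) • S (U y) = y := DFunLike.congr_fun hVU y
    have h5 := h1 (U y)
    have h6 : U y + z₀ • S (U y) = y + z • S (U y) := by
      rw [sub_smul] at h4
      rw [← sub_eq_zero, ← sub_eq_zero.2 h4]
      abel
    rwa [h6] at h5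
  · have h4 := h2 _ (B.mem_graph x)
    simp only at h4
    have h5 : S (B x - z • (x : E)) = (x : E) - (z - z₀) • S x := by
      have h7 : B x - z • (x : E) = (B x - z₀ • (x : E)) - (z - z₀) • (x : E) := by
        rw [sub_smul]; abel
      rw [h7, map_sub, map_smul, h4]
    have h6 : U ((x : E) - (z - z₀) • S x) = x := DFunLike.congr_fun hUV (x : E)
    rw [hcomm, mul_apply_eq_comp, h5, h6]

/-- An operator whose spectral measures are, apart from finitely many eigenvalues, absolutely
continuous and carried by `[m, ∞)`. -/
structure IsACAbove (A : E →ₗ.[ℂ] E) (m : ℝ) : Prop where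
  finite : {e : ℝ | opEigenspace A e ≠ ⊥}.Finite
  finiteDimensional : ∀ e : ℝ, FiniteDimensional ℂ (opEigenspace A e)
  null : ∀ ψ, ∀ B : Set ℝ, volume B = 0 → (∀ x ∈ B, opEigenspace A (x : ℂ) = ⊥) →
    specMeasure A ψ B = 0
  below : ∀ ψ, ∀ B : Set ℝ, B ⊆ Set.Iio m → (∀ x ∈ B, opEigenspace A (x : ℂ) = ⊥) →
    specMeasure A ψ B = 0

/-- Near every point of `[m, ∞)` there is an infinite orthogonal family of vectors in the domain
with absolutely continuous spectral measures carried by a small neighbourhood of the point. -/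
def HasShells (A : E →ₗ.[ℂ] E) (m : ℝ) : Prop :=
  ∀ x : ℝ, m ≤ x → ∀ ε > 0, ∃ u v : ℕ → E, (∀ n, u n ≠ 0) ∧
    (Pairwise fun i j => inner ℂ (u i) (u j) = 0) ∧ (∀ n, (u n, v n) ∈ A.graph) ∧
    (∀ n, ‖v n - (x : ℂ) • u n‖ ≤ ε * ‖u n‖) ∧
    (∀ n, specMeasure A (u n) {t : ℝ | ‖(t : ℂ) - x‖ < ε}ᶜ = 0) ∧
    ∀ n, specMeasure A (u n) ≪ volume

namespace IsResolventFamily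

variable {A : E →ₗ.[ℂ] E} {ρ : Set ℂ} {R : ℂ → E →L[ℂ] E} (hA : IsResolventFamily A ρ R)

include hA

/-- Restriction of a resolvent to a reducing subspace. -/
lemma resolvent_opPart {K : Submodule ℂ E} {z : ℂ} (hz : z ∈ ρ) (hK : ∀ x ∈ K, R z x ∈ K) :
    ∃ S : K →L[ℂ] K, (∀ x, (S x : E) = R z x) ∧
      (∀ y, (S y, y + z • S y) ∈ (opPart A K).graph) ∧
      ∀ p ∈ (opPart A K).graph, S (p.2 - z • p.1) = p.1 := by
  refine ⟨((R z).comp K.subtypeL).codRestrict K fun x => hK x x.2, fun x => rfl,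
    fun y => ?_, fun p hp => ?_⟩
  · rw [mem_opPart_graph]
    exact hA.mem_graph z hz y
  · rw [mem_opPart_graph] at hp
    exact Subtype.ext (hA.left_inv z hz _ hp)

lemma mem_pointSpectrum_iff {z : ℂ} :
    z ∈ pointSpectrum A ↔ ∃ e : ℝ, z = e ∧ opEigenspace A (e : ℂ) ≠ ⊥ := by
  constructor
  · intro hz
    have h0 : z.im = 0 := by
      by_contra h
      exact hz (hA.eigenspace_eq_bot (hA.mem_of_im_ne_zero z h))
    have : z = (z.re : ℂ) := by apply Complex.ext <;> simp [h0]
    exact ⟨z.re, this, this ▸ hz⟩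
  · rintro ⟨e, rfl, h⟩
    exact h

variable [CompleteSpace E]

lemma norm_resolvent_le_of_specMeasure_eq_zero (ψ : E) {x r δ : ℝ} (hr : 0 < r) (hδ : 0 < δ)
    (h : specMeasure A ψ (Metric.ball x r) = 0) :
    ‖R (x + δ * Complex.I) ψ‖ ≤ r⁻¹ * ‖ψ‖ := by
  have hz : 0 < ((x : ℂ) + δ * Complex.I).im := by simpa using hδ
  have h1 := hA.norm_smul_resolvent_sub_sq ψ hz hz 1 0
  simp only [one_smul, zero_smul, sub_zero, one_mul, zero_mul] at h1
  have h2 : ∫ t : ℝ, ‖((t : ℂ) - (x + δ * Complex.I))⁻¹‖ ^ 2 ∂(specMeasure A ψ)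
      ≤ ∫ t : ℝ, r⁻¹ ^ 2 ∂(specMeasure A ψ) := by
    refine integral_mono_of_nonneg (Eventually.of_forall fun t => by positivity)
      (integrable_const _) ?_
    have h3 : ∀ᵐ t ∂(specMeasure A ψ), t ∉ Metric.ball x r := by
      rw [ae_iff]; simpa only [not_not, Set.ofPred_mem_eq] using h
    filter_upwards [h3] with t ht
    have h4 : r ≤ |t - x| := by simpa [Real.dist_eq] using ht
    have h5 : |t - x| ≤ ‖(t : ℂ) - (x + δ * Complex.I)‖ := by
      simpa using Complex.abs_re_le_norm ((t : ℂ) - (x + δ * Complex.I))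
    rw [norm_inv]
    have := h4.trans h5
    gcongr
  rw [← h1, integral_const, smul_eq_mul] at h2
  have h6 := hA.specMeasure_univ_le ψ
  have h7 : ‖R (x + δ * Complex.I) ψ‖ ^ 2 ≤ (r⁻¹ * ‖ψ‖) ^ 2 := by
    rw [mul_pow, mul_comm (r⁻¹ ^ 2)]
    exact h2.trans (by gcongr)
  exact (sq_le_sq₀ (norm_nonneg _) (by positivity)).1 h7

/-- A real point off the eigenvalues near which no spectral measure of a vector of a reducing
subspace has mass belongs to the resolvent set of the part in that subspace. -/
lemma mem_opResolventSet_opPart {K : Submodule ℂ E} [CompleteSpace K]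
    (hK : ∀ z : ℂ, z.im ≠ 0 → ∀ x ∈ K, R z x ∈ K) {x r : ℝ} (hr : 0 < r)
    (h : ∀ ψ ∈ K, specMeasure A ψ (Metric.ball x r) = 0) : (x : ℂ) ∈ opResolventSet (opPart A K) := by
  -- at `x + ir/2` the resolvent has norm at most `1 / r`, so its Neumann series reaches `x`
  have hz : ((x : ℂ) + (r / 2 : ℝ) * Complex.I).im ≠ 0 := by simpa using hr.ne'
  obtain ⟨S, hS, h1, h2⟩ := hA.resolvent_opPart (hA.mem_of_im_ne_zero _ hz) (hK _ hz)
  refine mem_opResolventSet_of_norm_lt S h1 h2 ?_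
  have h3 : ‖S‖ ≤ r⁻¹ := S.opNorm_le_bound (by positivity) fun y => by
    change ‖(S y : E)‖ ≤ _
    rw [hS]
    exact hA.norm_resolvent_le_of_specMeasure_eq_zero y hr (by positivity) (h y y.2)
  have h4 : ‖(x : ℂ) - (x + (r / 2 : ℝ) * Complex.I)‖ = r / 2 := by
    rw [sub_add_cancel_left, norm_neg, norm_mul, Complex.norm_I, mul_one, Complex.norm_real,
      Real.norm_of_nonneg (by positivity)]
  rw [h4]
  calc r / 2 * ‖S‖ ≤ r / 2 * r⁻¹ := by gcongr
    _ < 1 := by field_simp; norm_num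

lemma mem_opResolventSet_of_specMeasure {x r : ℝ} (hr : 0 < r)
    (h : ∀ ψ, specMeasure A ψ (Metric.ball x r) = 0) : (x : ℂ) ∈ opResolventSet A := by
  have hz : ((x : ℂ) + (r / 2 : ℝ) * Complex.I).im ≠ 0 := by simpa using hr.ne'
  have hz' := hA.mem_of_im_ne_zero _ hz
  refine mem_opResolventSet_of_norm_lt _ (hA.mem_graph _ hz') (hA.left_inv _ hz') ?_
  have h3 : ‖R ((x : ℂ) + (r / 2 : ℝ) * Complex.I)‖ ≤ r⁻¹ :=
    ContinuousLinearMap.opNorm_le_bound _ (by positivity) fun y =>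
      hA.norm_resolvent_le_of_specMeasure_eq_zero y hr (by positivity) (h y)
  have h4 : ‖(x : ℂ) - (x + (r / 2 : ℝ) * Complex.I)‖ = r / 2 := by
    rw [sub_add_cancel_left, norm_neg, norm_mul, Complex.norm_I, mul_one, Complex.norm_real,
      Real.norm_of_nonneg (by positivity)]
  rw [h4]
  calc r / 2 * ‖_‖ ≤ r / 2 * r⁻¹ := by gcongr
    _ < 1 := by field_simp; norm_num

omit hA [CompleteSpace E] in
lemma _root_.pointSpectrum_subset_opSpectrum {A : E →ₗ.[ℂ] E} :
    pointSpectrum A ⊆ opSpectrum A := by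
  intro z hz
  obtain ⟨x, hx, hx0⟩ := (Submodule.ne_bot_iff _).1 hz
  refine mem_opSpectrum_of_approx fun ε hε => ⟨(x, z • x), hx, hx0, ?_⟩
  simp only [sub_self, norm_zero]
  positivity

/-! The following lemmas concern an operator with `IsACAbove A m`. -/

section Above

variable {m : ℝ} (hm : IsACAbove A m)

include hm

/-- Below `m`, the spectral subspace of a small interval around `x` lies in the eigenspace. -/
lemma exists_spectralSubspace_le {x : ℝ} (hx : x < m) :
    ∃ r > 0, (∀ y ∈ Metric.ball x r, y < m) ∧
      (∀ y ∈ Metric.ball x r, y ≠ x → opEigenspace A (y : ℂ) = ⊥) ∧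
      spectralSubspace A (Metric.ball x r) ≤ opEigenspace A (x : ℂ) := by
  have h1 : ∀ᶠ y in 𝓝 x, y < m := eventually_lt_nhds hx
  have h2 : ∀ᶠ y in 𝓝 x, y ∉ {e : ℝ | opEigenspace A e ≠ ⊥} \ {x} :=
    (hm.finite.subset Set.sdiff_subset).isClosed.isOpen_compl.mem_nhds (by simp)
  obtain ⟨r, hr, hball⟩ := Metric.eventually_nhds_iff_ball.1 (h1.and h2)
  have h3 : ∀ y ∈ Metric.ball x r, y ≠ x → opEigenspace A (y : ℂ) = ⊥ := by
    intro y hy hyx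
    by_contra h
    exact (hball y hy).2 ⟨h, hyx⟩
  refine ⟨r, hr, fun y hy => (hball y hy).1, h3, ?_⟩
  rw [spectralSubspace, Submodule.span_le]
  rintro ψ ⟨μ, hμ, hμB⟩
  rw [← hA.specMeasure_eq hμ] at hμB
  have hψ : specMeasure A ψ {x}ᶜ = 0 := by
    have h4 : specMeasure A ψ (Metric.ball x r \ {x}) = 0 :=
      hm.below ψ _ (fun y hy => (hball y hy.1).1) fun y hy => h3 y hy.1 hy.2
    refine measure_mono_null ?_ (measure_union_null hμB h4)
    intro y hy
    by_cases hyr : y ∈ Metric.ball x r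
    · exact Or.inr ⟨hyr, hy⟩
    · exact Or.inl hyr
  -- after subtraction of the eigenprojection nothing is left of the spectral measure
  obtain ⟨v, hv, h5, h6⟩ := hA.exists_eigenprojection ψ x
  have h7 : specMeasure A (ψ - v) {x} = 0 := by
    rw [hA.specMeasure_singleton_eq_zero_iff]
    intro y hy
    rw [inner_sub_right, h6 y hy, sub_self]
  have h8 : specMeasure A (ψ - v) {x}ᶜ = 0 := by
    have h9 := hA.specMeasure_add_le ψ (-v) {x}ᶜ
    rw [hψ, hA.specMeasure_of_mem_eigenspace (neg_mem hv)] at h9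
    simpa [sub_eq_add_neg] using h9
  have h10 : specMeasure A (ψ - v) = 0 := by
    rw [← Measure.measure_univ_eq_zero, ← Set.union_compl_self {x}]
    exact measure_union_null h7 h8
  rw [sub_eq_zero.1 (hA.eq_zero_of_specMeasure_eq_zero h10)]
  exact hv

lemma essSpectrum_subset : essSpectrum A ⊆ ((↑) : ℝ → ℂ) '' Set.Ici m := by
  rintro z ⟨hz, hz2⟩
  have h0 : z.im = 0 := by
    by_contra h
    exact hz (hA.mem_opResolventSet (hA.mem_of_im_ne_zero z h))
  obtain ⟨x, rfl⟩ : ∃ x : ℝ, z = x := ⟨z.re, by apply Complex.ext <;> simp [h0]⟩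
  refine ⟨x, ?_, rfl⟩
  by_contra hx
  obtain ⟨r, hr, -, -, hle⟩ := hA.exists_spectralSubspace_le hm (not_le.1 hx)
  refine hz2 r hr ?_
  have hset : {t : ℝ | ‖(t : ℂ) - x‖ < r} = Metric.ball x r := by
    ext t
    rw [Set.mem_ofPred_eq, Metric.mem_ball, Real.dist_eq, ← Complex.ofReal_sub, Complex.norm_real,
      Real.norm_eq_abs]
  rw [hset]
  have := hm.finiteDimensional x
  exact Submodule.finiteDimensional_of_le hle

lemma specMeasure_ac_of_orthogonal {ψ : E}
    (h : ∀ e : ℝ, ∀ x ∈ opEigenspace A (e : ℂ), inner ℂ x ψ = 0) :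
    specMeasure A ψ ≪ volume := by
  intro B hB
  have h1 : specMeasure A ψ (B \ {e : ℝ | opEigenspace A e ≠ ⊥}) = 0 :=
    hm.null ψ _ (measure_mono_null Set.sdiff_subset hB) fun x hx => not_not.1 hx.2
  have h2 : specMeasure A ψ {e : ℝ | opEigenspace A e ≠ ⊥} = 0 := by
    rw [← Set.biUnion_of_singleton {e : ℝ | opEigenspace A e ≠ ⊥},
      measure_biUnion_null_iff hm.finite.countable]
    exact fun e _ => (hA.specMeasure_singleton_eq_zero_iff ψ e).2 (h e)
  exact measure_mono_null (by rw [Set.sdiff_union_self]; exact Set.subset_union_left)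
    (measure_union_null h1 h2)

omit hm in
lemma orthogonal_of_noAtoms {ψ : E} {μ : Measure ℝ} (hμ : IsSpectralMeasure A ψ μ)
    (h : ∀ x, μ {x} = 0) (e : ℝ) : ∀ x ∈ opEigenspace A (e : ℂ), inner ℂ x ψ = 0 := by
  rw [← hA.specMeasure_singleton_eq_zero_iff, hA.specMeasure_eq hμ, h]

omit hA hm [CompleteSpace E] in
/-- The orthogonal complement of the eigenvectors of `A` with real eigenvalues. -/
lemma exists_orthogonal_eigenspaces (A : E →ₗ.[ℂ] E) : ∃ K : Submodule ℂ E,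
    IsClosed (K : Set E) ∧
    ∀ ψ, ψ ∈ K ↔ ∀ e : ℝ, ∀ x ∈ opEigenspace A (e : ℂ), inner ℂ x ψ = 0 := by
  refine ⟨(⨆ e : ℝ, opEigenspace A (e : ℂ))ᗮ, Submodule.isClosed_orthogonal _, fun ψ => ?_⟩
  rw [← Submodule.iInf_orthogonal]
  simp only [Submodule.mem_iInf, Submodule.mem_orthogonal]

lemma mem_acSubspace_iff {ψ : E} : ψ ∈ acSubspace A ↔
    ∀ e : ℝ, ∀ x ∈ opEigenspace A (e : ℂ), inner ℂ x ψ = 0 := by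
  obtain ⟨K, -, hK⟩ := exists_orthogonal_eigenspaces A
  rw [← hK]
  suffices h : acSubspace A = K by rw [h]
  refine le_antisymm (Submodule.span_le.2 ?_) fun ψ hψ => Submodule.subset_span ?_
  · rintro ψ ⟨μ, hμ, hac⟩
    exact (hK ψ).2 (hA.orthogonal_of_noAtoms hμ fun x => hac (by simp))
  · exact ⟨_, hA.isSpectralMeasure ψ, hA.specMeasure_ac_of_orthogonal hm ((hK ψ).1 hψ)⟩

lemma mem_contSubspace_iff {ψ : E} : ψ ∈ contSubspace A ↔
    ∀ e : ℝ, ∀ x ∈ opEigenspace A (e : ℂ), inner ℂ x ψ = 0 := by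
  obtain ⟨K, -, hK⟩ := exists_orthogonal_eigenspaces A
  rw [← hK]
  suffices h : contSubspace A = K by rw [h]
  refine le_antisymm (Submodule.span_le.2 ?_) fun ψ hψ => Submodule.subset_span ?_
  · rintro ψ ⟨μ, hμ, hna⟩
    exact (hK ψ).2 (hA.orthogonal_of_noAtoms hμ hna)
  · exact ⟨_, hA.isSpectralMeasure ψ, fun x =>
      hA.specMeasure_ac_of_orthogonal hm ((hK ψ).1 hψ) (by simp)⟩

lemma scSubspace_eq_bot : scSubspace A = ⊥ := by
  rw [scSubspace, Submodule.span_eq_bot]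
  rintro ψ ⟨μ, hμ, hna, hsing⟩
  have hac := hA.specMeasure_ac_of_orthogonal hm (hA.orthogonal_of_noAtoms hμ hna)
  rw [hA.specMeasure_eq hμ] at hac
  refine hA.eq_zero_of_specMeasure_eq_zero ?_
  rw [hA.specMeasure_eq hμ]
  exact Measure.eq_zero_of_absolutelyContinuous_of_mutuallySingular hac hsing

lemma scSpectrum_eq_empty : scSpectrum A = ∅ := by
  -- on the zero space every point belongs to the resolvent set
  have hbot := hA.scSubspace_eq_bot hm
  have hsub : Subsingleton (scSubspace A) := by rw [hbot]; infer_instance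
  rw [scSpectrum, opSpectrum, Set.compl_empty_iff, Set.eq_univ_iff_forall]
  refine fun z => ⟨0, fun y => ?_, fun x => Subsingleton.elim _ _⟩
  rw [Subsingleton.elim ((0 : scSubspace A →L[ℂ] scSubspace A) y, _) 0]
  exact zero_mem _

/-- The absolutely continuous subspace reduces `A`, and below `m` its spectral measures vanish. -/
lemma acSpectrum_subset : acSpectrum A ⊆ ((↑) : ℝ → ℂ) '' Set.Ici m := by
  intro z hz
  by_contra hzm
  refine hz ?_
  have hclosed : IsClosed (acSubspace A : Set E) := by
    obtain ⟨K, hKc, hK⟩ := exists_orthogonal_eigenspaces A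
    have : acSubspace A = K := by
      ext ψ; rw [hA.mem_acSubspace_iff hm, hK]
    rwa [this]
  have hcomp : CompleteSpace (acSubspace A) := hclosed.completeSpace_coe
  have hred : ∀ z : ℂ, z.im ≠ 0 → ∀ x ∈ acSubspace A, R z x ∈ acSubspace A := by
    intro z hz x hx
    rw [hA.mem_acSubspace_iff hm] at hx ⊢
    intro e y hy
    have hzc : (conj z).im ≠ 0 := by simpa using hz
    have hze : conj z ≠ e := fun h => hzc (by rw [h, Complex.ofReal_im])
    have h1 := hA.inner_left _ (hA.mem_of_im_ne_zero _ hzc) y x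
    rw [Complex.conj_conj] at h1
    rw [← h1, hA.resolvent_eigenvector (hA.mem_of_im_ne_zero _ hzc) hze hy, inner_smul_left,
      hx e y hy, mul_zero]
  by_cases h0 : z.im = 0
  · obtain ⟨x, rfl⟩ : ∃ x : ℝ, z = x := ⟨z.re, by apply Complex.ext <;> simp [h0]⟩
    have hx : x < m := by
      by_contra h
      exact hzm ⟨x, not_lt.1 h, rfl⟩
    obtain ⟨r, hr, hlt, heig, -⟩ := hA.exists_spectralSubspace_le hm hx
    refine hA.mem_opResolventSet_opPart hred hr fun ψ hψ => ?_
    have h1 : specMeasure A ψ (Metric.ball x r \ {x}) = 0 :=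
      hm.below ψ _ (fun y hy => hlt y hy.1) fun y hy => heig y hy.1 hy.2
    have h2 : specMeasure A ψ {x} = 0 :=
      (hA.specMeasure_singleton_eq_zero_iff ψ x).2 ((hA.mem_acSubspace_iff hm).1 hψ x)
    exact measure_mono_null (by rw [Set.sdiff_union_self]; exact Set.subset_union_left)
      (measure_union_null h1 h2)
  · obtain ⟨S, -, h1, h2⟩ := hA.resolvent_opPart (hA.mem_of_im_ne_zero z h0) (hred z h0)
    exact ⟨S, h1, fun x => h2 _ (LinearPMap.mem_graph _ x)⟩

omit hm [CompleteSpace E] in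
/-- The orthogonal complement of the eigenvectors is invariant under `A`. -/
lemma orthogonal_of_mem_graph {p : E × E} (hp : p ∈ A.graph)
    (h : ∀ e : ℝ, ∀ x ∈ opEigenspace A (e : ℂ), inner ℂ x p.1 = 0) :
    ∀ e : ℝ, ∀ x ∈ opEigenspace A (e : ℂ), inner ℂ x p.2 = 0 := by
  intro e x hx
  have hI : Complex.I ∈ ρ := hA.mem_of_im_ne_zero _ (by simp)
  have hI' : conj Complex.I ∈ ρ := hA.mem_of_im_ne_zero _ (by simp)
  have hne : conj Complex.I ≠ (e : ℂ) := fun h => by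
    have := congrArg Complex.im h
    simp at this
  have h1 := h e x hx
  have h2 := hA.inner_left _ hI' x (p.2 - Complex.I • p.1)
  rw [Complex.conj_conj, hA.left_inv _ hI p hp, h1, hA.resolvent_eigenvector hI' hne hx,
    inner_smul_left, inner_sub_right, inner_smul_right, h1, mul_zero, sub_zero,
    mul_eq_zero] at h2
  refine h2.resolve_left ?_
  rw [← ne_eq, map_ne_zero]
  exact inv_ne_zero (sub_ne_zero.2 hne.symm)

omit hm in
/-- Shells put `[m, ∞)` into the spectrum of every part of `A` that contains them. -/
lemma mem_opSpectrum_opPart_of_shells (hS : HasShells A m) {K : Submodule ℂ E}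
    (hK : ∀ ψ, ψ ∈ K ↔ ∀ e : ℝ, ∀ x ∈ opEigenspace A (e : ℂ), inner ℂ x ψ = 0)
    {x : ℝ} (hx : m ≤ x) : (x : ℂ) ∈ opSpectrum (opPart A K) := by
  refine mem_opSpectrum_of_approx fun ε hε => ?_
  obtain ⟨u, v, hu, -, huv, hle, -, hac⟩ := hS x hx ε hε
  have h1 := hA.orthogonal_of_noAtoms (hA.isSpectralMeasure (u 0)) fun x => hac 0 (by simp)
  have h2 := hA.orthogonal_of_mem_graph (huv 0) h1
  refine ⟨(⟨u 0, (hK _).2 h1⟩, ⟨v 0, (hK _).2 h2⟩), mem_opPart_graph.2 (huv 0), ?_, hle 0⟩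
  exact fun h => hu 0 (congrArg Subtype.val h)

omit hA hm [CompleteSpace E] in
lemma mem_opSpectrum_of_shells (hS : HasShells A m) {x : ℝ} (hx : m ≤ x) :
    (x : ℂ) ∈ opSpectrum A := by
  refine mem_opSpectrum_of_approx fun ε hε => ?_
  obtain ⟨u, v, hu, -, huv, hle, -, -⟩ := hS x hx ε hε
  exact ⟨_, huv 0, hu 0, hle 0⟩

theorem essSpectrum_eq (hS : HasShells A m) : essSpectrum A = ((↑) : ℝ → ℂ) '' Set.Ici m := by
  refine Set.Subset.antisymm (hA.essSpectrum_subset hm) ?_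
  rintro _ ⟨x, hx, rfl⟩
  refine ⟨mem_opSpectrum_of_shells hS hx, fun ε hε hfin => ?_⟩
  obtain ⟨u, v, hu, horth, -, -, hB, -⟩ := hS x hx ε hε
  have hmem : ∀ n, u n ∈ spectralSubspace A {t : ℝ | ‖(t : ℂ) - x‖ < ε} := fun n =>
    Submodule.subset_span ⟨_, hA.isSpectralMeasure (u n), hB n⟩
  have hli : LinearIndependent ℂ u := linearIndependent_of_ne_zero_of_inner_eq_zero hu horth
  have hli' : LinearIndependent ℂ
      fun n => (⟨u n, hmem n⟩ : spectralSubspace A {t : ℝ | ‖(t : ℂ) - x‖ < ε}) :=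
    LinearIndependent.of_comp (Submodule.subtype _) hli
  exact not_finite_iff_infinite.2 (inferInstance : Infinite ℕ) hli'.finite

theorem acSpectrum_eq (hS : HasShells A m) : acSpectrum A = ((↑) : ℝ → ℂ) '' Set.Ici m := by
  refine Set.Subset.antisymm (hA.acSpectrum_subset hm) ?_
  rintro _ ⟨x, hx, rfl⟩
  exact hA.mem_opSpectrum_opPart_of_shells hS (fun _ => hA.mem_acSubspace_iff hm) hx

theorem mem_contSpectrum (hS : HasShells A m) {x : ℝ} (hx : m ≤ x) :
    (x : ℂ) ∈ contSpectrum A :=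
  hA.mem_opSpectrum_opPart_of_shells hS (fun _ => hA.mem_contSubspace_iff hm) hx

theorem pointSpectrum_eq_discreteSpectrum (hS : HasShells A m)
    (hlt : ∀ e : ℝ, opEigenspace A (e : ℂ) ≠ ⊥ → e < m) :
    pointSpectrum A = discreteSpectrum A := by
  have hset : ∀ x r : ℝ, {t : ℝ | ‖(t : ℂ) - x‖ < r} = Metric.ball x r := by
    intro x r
    ext t
    rw [Set.mem_ofPred_eq, Metric.mem_ball, Real.dist_eq, ← Complex.ofReal_sub, Complex.norm_real,
      Real.norm_eq_abs]
  ext z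
  constructor
  · intro hz
    obtain ⟨e, rfl, he⟩ := hA.mem_pointSpectrum_iff.1 hz
    refine ⟨pointSpectrum_subset_opSpectrum hz, ?_⟩
    obtain ⟨r, hr, -, -, hle⟩ := hA.exists_spectralSubspace_le hm (hlt e he)
    refine ⟨r, hr, ?_⟩
    rw [hset]
    have := hm.finiteDimensional e
    exact Submodule.finiteDimensional_of_le hle
  · rintro ⟨hz, ε, hε, hfin⟩
    have h0 : z.im = 0 := by
      by_contra h
      exact hz (hA.mem_opResolventSet (hA.mem_of_im_ne_zero z h))
    obtain ⟨x, rfl⟩ : ∃ x : ℝ, z = x := ⟨z.re, by apply Complex.ext <;> simp [h0]⟩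
    have hx : x < m := by
      by_contra h
      have h1 : (x : ℂ) ∈ essSpectrum A := by
        rw [hA.essSpectrum_eq hm hS]
        exact ⟨x, not_lt.1 h, rfl⟩
      exact h1.2 ε hε hfin
    intro hbot
    obtain ⟨r, hr, h2, h3, -⟩ := hA.exists_spectralSubspace_le hm hx
    refine hz (hA.mem_opResolventSet_of_specMeasure hr fun ψ => hm.below ψ _ h2 fun y hy => ?_)
    by_cases hyx : y = x
    · rw [hyx, hbot]
    · exact h3 y hy hyx

theorem essSpectrumOnlyAC (hS : HasShells A m)
    (hlt : ∀ e : ℝ, opEigenspace A (e : ℂ) ≠ ⊥ → e < m) : EssSpectrumOnlyAC A := by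
  refine ⟨(hA.essSpectrum_eq hm hS).trans (hA.acSpectrum_eq hm hS).symm,
    hA.scSpectrum_eq_empty hm, ?_⟩
  rw [hA.essSpectrum_eq hm hS, Set.disjoint_left]
  rintro _ ⟨x, hx, rfl⟩ hp
  exact not_le.2 (hlt x hp) hx

end Above

end IsResolventFamily

end Spectra

/-! ### The free resolvent in Fourier space -/

section Fourier

open FourierTransform

variable {d : ℕ}

/-- The symbol `4π²|k|²` of `-Δ`, for the Fourier transform with kernel `exp(-2πi⟨k, x⟩)`. -/
def symb (k : Pos d) : ℝ := (2 * Real.pi) ^ 2 * ‖k‖ ^ 2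

/-- The Fourier transform of the kernel of `(-Δ - w)⁻¹`. -/
def gHat (w : ℂ) (k : Pos d) : ℂ := ((symb k : ℂ) - w)⁻¹

lemma symb_nonneg (k : Pos d) : 0 ≤ symb k := by unfold symb; positivity

@[fun_prop]
lemma continuous_symb : Continuous (symb : Pos d → ℝ) := by unfold symb; fun_prop

@[fun_prop]
lemma measurable_gHat (w : ℂ) : Measurable (gHat w : Pos d → ℂ) := by
  unfold gHat; fun_prop

lemma conj_gHat (w : ℂ) (k : Pos d) : (starRingEnd ℂ) (gHat w k) = gHat ((starRingEnd ℂ) w) k := by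
  simp [gHat]

lemma symb_sub_ne_zero {w : ℂ} (hw : -w ∈ Complex.slitPlane) (k : Pos d) :
    (symb k : ℂ) - w ≠ 0 := by
  intro h
  rw [sub_eq_zero.1 h.symm.symm |>.symm] at hw
  have := symb_nonneg k
  simp [Complex.mem_slitPlane_iff] at hw
  linarith

/-- The free resolvent has the decay of `(1 + |k|²)⁻¹`, uniformly near a point off the
half-line. -/
lemma exists_norm_gHat_le {w₀ : ℂ} (hw : -w₀ ∈ Complex.slitPlane) :
    ∃ C > 0, ∀ᶠ w in 𝓝 w₀, ∀ k : Pos d, ‖gHat w k‖ ≤ C * (1 + ‖k‖ ^ 2)⁻¹ := by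
  obtain ⟨r, hr, hball⟩ := Metric.isOpen_iff.1 Complex.isOpen_slitPlane _ hw
  refine ⟨(2 + ‖w₀‖ + r) / (r / 2) + 1, by positivity, ?_⟩
  filter_upwards [Metric.ball_mem_nhds w₀ (half_pos hr)] with w hwb k
  -- the half-line has distance at least `r` from `w₀`, hence at least `r / 2` from `w`
  have h0 : ∀ y : ℝ, 0 ≤ y → r ≤ ‖(y : ℂ) - w₀‖ := by
    intro y hy
    by_contra h
    have h1 : (-(y : ℂ)) ∈ Complex.slitPlane := hball (by
      rw [Metric.mem_ball, dist_eq_norm]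
      rw [show -(y : ℂ) - -w₀ = -((y : ℂ) - w₀) by ring, norm_neg]
      exact not_le.1 h)
    simp [Complex.mem_slitPlane_iff] at h1
    linarith
  have hwd : ‖w - w₀‖ < r / 2 := by rwa [← dist_eq_norm]
  have h1 : r / 2 ≤ ‖(symb k : ℂ) - w‖ := by
    have h2 := h0 _ (symb_nonneg k)
    have h3 := norm_add_le ((symb k : ℂ) - w) (w - w₀)
    rw [sub_add_sub_cancel] at h3
    linarith
  have h4 : 1 + ‖k‖ ^ 2 ≤ 1 + symb k := by
    have h5 : (1 : ℝ) ≤ (2 * Real.pi) ^ 2 := by nlinarith [Real.pi_gt_three]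
    unfold symb
    nlinarith [sq_nonneg ‖k‖]
  have h6 : symb k ≤ ‖(symb k : ℂ) - w‖ + ‖w₀‖ + r / 2 := by
    have h7 : ‖(symb k : ℂ)‖ = symb k := by
      rw [Complex.norm_real, Real.norm_of_nonneg (symb_nonneg k)]
    have h8 := norm_add_le ((symb k : ℂ) - w) w
    rw [sub_add_cancel, h7] at h8
    have h9 := norm_add_le (w - w₀) w₀
    rw [sub_add_cancel] at h9
    linarith
  set y := ‖(symb k : ℂ) - w‖ with hy
  have hy0 : 0 < y := lt_of_lt_of_le (half_pos hr) h1
  rw [gHat, norm_inv, ← hy, ← div_eq_mul_inv, inv_eq_one_div, div_le_div_iff₀ hy0 (by positivity),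
    one_mul, add_mul, one_mul]
  have h10 : (2 + ‖w₀‖ + r) ≤ (2 + ‖w₀‖ + r) / (r / 2) * y := by
    rw [div_mul_eq_mul_div, le_div_iff₀ (half_pos hr)]
    gcongr
  linarith [norm_nonneg w₀]

lemma norm_gHat_le {w : ℂ} (hw : -w ∈ Complex.slitPlane) :
    ∃ C > 0, ∀ k : Pos d, ‖gHat w k‖ ≤ C * (1 + ‖k‖ ^ 2)⁻¹ := by
  obtain ⟨C, hC, h⟩ := exists_norm_gHat_le (d := d) hw
  exact ⟨C, hC, h.self_of_nhds⟩

lemma integrable_japanese_sq (hd : d < 4) :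
    Integrable (fun k : Pos d => ((1 + ‖k‖ ^ 2)⁻¹) ^ 2) := by
  have h := integrable_rpow_neg_one_add_norm_sq (E := Pos d) (μ := volume) (r := 4)
    (by rw [finrank_euclideanSpace_fin]; exact_mod_cast hd)
  refine h.congr (Eventually.of_forall fun k => ?_)
  simp only
  rw [show (-(4 : ℝ) / 2) = -(2 : ℕ) by norm_num, Real.rpow_neg (by positivity),
    Real.rpow_natCast, inv_pow]

lemma memLp_japanese (hd : d < 4) : MemLp (fun k : Pos d => (1 + ‖k‖ ^ 2)⁻¹) 2 := by
  refine (memLp_two_iff_integrable_sq ?_).2 (integrable_japanese_sq hd)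
  exact (by fun_prop : Measurable fun k : Pos d => (1 + ‖k‖ ^ 2)⁻¹).aestronglyMeasurable

lemma memLp_gHat (hd : d < 4) {w : ℂ} (hw : -w ∈ Complex.slitPlane) :
    MemLp (gHat w : Pos d → ℂ) 2 := by
  obtain ⟨C, hC, h⟩ := norm_gHat_le (d := d) hw
  refine MemLp.of_le_mul (memLp_japanese hd) (measurable_gHat w).aestronglyMeasurable
    (c := C) (Eventually.of_forall fun k => ?_)
  rw [Real.norm_of_nonneg (by positivity)]
  exact h k

lemma memLp_top_gHat {w : ℂ} (hw : -w ∈ Complex.slitPlane) :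
    MemLp (gHat w : Pos d → ℂ) ⊤ := by
  obtain ⟨C, hC, h⟩ := norm_gHat_le (d := d) hw
  refine memLp_top_of_bound (measurable_gHat w).aestronglyMeasurable C
    (Eventually.of_forall fun k => (h k).trans ?_)
  exact mul_le_of_le_one_right hC.le (inv_le_one_of_one_le₀ (by nlinarith [sq_nonneg ‖k‖]))

lemma integrable_gHat_mul (hd : d < 4) {w : ℂ} (hw : -w ∈ Complex.slitPlane) (f : L2 d) :
    Integrable (fun k => gHat w k * f k) :=
  (memLp_gHat hd hw).integrable_mul (Lp.memLp f)

/-- Test functions determine a locally integrable function. -/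
lemma ae_eq_of_schwartz {f g : Pos d → ℂ} (hf : LocallyIntegrable f) (hg : LocallyIntegrable g)
    (h : ∀ φ : 𝓢(Pos d, ℂ), ∫ x, φ x * f x = ∫ x, φ x * g x) : f =ᵐ[volume] g := by
  refine ae_eq_of_integral_contDiff_smul_eq hf hg fun φ hφ hφc => ?_
  have hg₁ : HasCompactSupport (Complex.ofRealCLM ∘ φ) := hφc.comp_left rfl
  have hg₂ : ContDiff ℝ (⊤ : ℕ∞) (Complex.ofRealCLM ∘ φ) := by fun_prop
  simpa using h (hg₁.toSchwartzMap hg₂)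

lemma locallyIntegrable_L2 (f : L2 d) : LocallyIntegrable f :=
  (Lp.memLp f).locallyIntegrable (by norm_num)

lemma integral_schwartz_mul_fourier (φ : 𝓢(Pos d, ℂ)) (u : L2 d) :
    ∫ k, φ k * (𝓕 u : L2 d) k = ∫ x, (𝓕 φ) x * u x := by
  have h := congrArg (fun T : 𝓢'(Pos d, ℂ) => T φ) (Lp.fourier_toTemperedDistribution_eq u)
  simp only [TemperedDistribution.fourier_apply, Lp.toTemperedDistribution_apply,
    smul_eq_mul] at h
  exact h.symm

lemma integral_schwartz_mul_L2 (φ : 𝓢(Pos d, ℂ)) (u : L2 d) :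
    ∫ x, φ x * u x = ∫ k, (𝓕⁻ φ) k * (𝓕 u : L2 d) k := by
  rw [integral_schwartz_mul_fourier, FourierTransform.fourier_fourierInv_eq]

lemma integral_schwartz_mul_fourierInv (φ : 𝓢(Pos d, ℂ)) {F : Pos d → ℂ} (hF : Integrable F) :
    ∫ x, φ x * 𝓕⁻ F x = ∫ k, (𝓕⁻ φ) k * F k := by
  rw [Real.fourierInv_eq_fourier_comp_neg]
  have hF' : Integrable (fun k => F (-k)) := hF.comp_neg
  have h := VectorFourier.integral_fourierIntegral_smul_eq_flip (L := innerₗ (Pos d))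
    (μ := volume) (ν := volume) Real.continuous_fourierChar continuous_inner φ.integrable hF'
  rw [flip_innerₗ] at h
  simp only [smul_eq_mul] at h
  refine h.symm.trans ?_
  rw [← integral_neg_eq_self]
  refine integral_congr_ae (Eventually.of_forall fun k => ?_)
  simp only [neg_neg, SchwartzMap.fourierInv_coe, Real.fourierInv_eq_fourier_neg]
  rfl

/-- An integrable Fourier transform provides the continuous representative. -/
lemma ae_eq_fourierInv (u : L2 d) (hu : Integrable (𝓕 u : L2 d)) :
    u =ᵐ[volume] 𝓕⁻ (⇑(𝓕 u : L2 d)) := by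
  have hc : Continuous (𝓕⁻ (⇑(𝓕 u : L2 d))) := by
    rw [Real.fourierInv_eq_fourier_comp_neg]
    exact VectorFourier.fourierIntegral_continuous Real.continuous_fourierChar continuous_inner
      hu.comp_neg
  refine ae_eq_of_schwartz (locallyIntegrable_L2 u) hc.locallyIntegrable fun φ => ?_
  rw [integral_schwartz_mul_fourierInv φ hu, integral_schwartz_mul_L2]

lemma continuous_fourierInv {F : Pos d → ℂ} (hF : Integrable F) : Continuous (𝓕⁻ F) := by
  rw [Real.fourierInv_eq_fourier_comp_neg]
  exact VectorFourier.fourierIntegral_continuous Real.continuous_fourierChar continuous_inner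
    hF.comp_neg

lemma fourierInv_zero (F : Pos d → ℂ) : 𝓕⁻ F 0 = ∫ k, F k := by
  simp [Real.fourierInv_eq]

/-- A function which pairs with test functions like the inverse Fourier transform of `F`. -/
lemma ae_eq_fourierInv_L2 {G : Pos d → ℂ} (hG : LocallyIntegrable G) (F : L2 d)
    (h : ∀ φ : 𝓢(Pos d, ℂ), ∫ x, φ x * G x = ∫ k, (𝓕⁻ φ) k * F k) :
    G =ᵐ[volume] (𝓕⁻ F : L2 d) := by
  refine ae_eq_of_schwartz hG (locallyIntegrable_L2 _) fun φ => ?_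
  rw [h, integral_schwartz_mul_L2 φ (𝓕⁻ F), FourierTransform.fourier_fourierInv_eq F]

/-- An equation between tempered distributions, multiplication by `4π²|k|² + c`, read pointwise. -/
lemma smulLeft_symb_iff (f g : L2 d) (c : ℂ) :
    ((f : 𝓢'(Pos d, ℂ)) = ((2 * Real.pi) ^ 2 : ℝ) • TemperedDistribution.smulLeftCLM ℂ
      (fun x : Pos d => Complex.ofReal (‖x‖ ^ 2)) (g : 𝓢'(Pos d, ℂ)) + c • (g : 𝓢'(Pos d, ℂ))) ↔
    f =ᵐ[volume] fun k => ((symb k : ℂ) + c) * g k := by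
  have htg : (fun x : Pos d => Complex.ofReal (‖x‖ ^ 2)).HasTemperateGrowth := by fun_prop
  have hi : ∀ φ : 𝓢(Pos d, ℂ), Integrable fun x => φ x * g x := fun φ =>
    (φ.memLp 2).integrable_mul (Lp.memLp g)
  have hi2 : ∀ φ : 𝓢(Pos d, ℂ), Integrable fun x => ((‖x‖ ^ 2 : ℝ) : ℂ) * φ x * g x := fun φ => by
    have := hi (SchwartzMap.smulLeftCLM ℂ (fun x : Pos d => Complex.ofReal (‖x‖ ^ 2)) φ)
    simpa only [SchwartzMap.smulLeftCLM_apply_apply htg, smul_eq_mul] using this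
  have hR : ∀ φ : 𝓢(Pos d, ℂ), (((2 * Real.pi) ^ 2 : ℝ) • TemperedDistribution.smulLeftCLM ℂ
      (fun x : Pos d => Complex.ofReal (‖x‖ ^ 2)) (g : 𝓢'(Pos d, ℂ))
        + c • (g : 𝓢'(Pos d, ℂ))) φ = ∫ x, φ x * (((symb x : ℂ) + c) * g x) := by
    intro φ
    change ((2 * Real.pi) ^ 2 : ℝ) • (g : 𝓢'(Pos d, ℂ)) (SchwartzMap.smulLeftCLM ℂ
      (fun x : Pos d => Complex.ofReal (‖x‖ ^ 2)) φ) + c • (g : 𝓢'(Pos d, ℂ)) φ = _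
    simp only [Lp.toTemperedDistribution_apply, SchwartzMap.smulLeftCLM_apply_apply htg,
      smul_eq_mul]
    rw [← integral_const_mul c, ← integral_smul]
    refine (integral_add ((hi2 φ).smul ((2 * Real.pi) ^ 2)) ((hi φ).const_mul c)).symm.trans
      (integral_congr_ae (Eventually.of_forall fun x => ?_))
    simp only [Pi.smul_apply, Complex.real_smul, symb]
    push_cast
    ring
  constructor
  · intro h
    have hloc : LocallyIntegrable fun k => ((symb k : ℂ) + c) * g k := by
      have : Continuous fun k : Pos d => ((symb k : ℂ) + c) := by fun_prop
      exact (locallyIntegrable_L2 g).continuous_smul this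
    refine ae_eq_of_schwartz (locallyIntegrable_L2 f) hloc fun φ => ?_
    rw [← hR, ← h, Lp.toTemperedDistribution_apply]
    rfl
  · intro h
    ext φ
    rw [hR, Lp.toTemperedDistribution_apply]
    refine integral_congr_ae ?_
    filter_upwards [h] with x hx
    rw [hx, smul_eq_mul]

/-- The operator `-Δ + c` on `H²` in Fourier space. -/
lemma sobolev_laplacian_iff (u v : L2 d) (c : ℂ) :
    (TemperedDistribution.MemSobolev 2 2 (u : 𝓢'(Pos d, ℂ)) ∧
      (v : 𝓢'(Pos d, ℂ)) = -Δ (u : 𝓢'(Pos d, ℂ)) + c • (u : 𝓢'(Pos d, ℂ))) ↔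
    (𝓕 v : L2 d) =ᵐ[volume] fun k => ((symb k : ℂ) + c) * (𝓕 u : L2 d) k := by
  have hF : 𝓕 (-Δ (u : 𝓢'(Pos d, ℂ)) + c • (u : 𝓢'(Pos d, ℂ)))
      = ((2 * Real.pi) ^ 2 : ℝ) • TemperedDistribution.smulLeftCLM ℂ
      (fun x : Pos d => Complex.ofReal (‖x‖ ^ 2)) ((𝓕 u : L2 d) : 𝓢'(Pos d, ℂ))
        + c • ((𝓕 u : L2 d) : 𝓢'(Pos d, ℂ)) := by
    rw [FourierTransform.fourier_add, FourierTransform.fourier_smul,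
      Lp.fourier_toTemperedDistribution_eq, TemperedDistribution.laplacian_eq_fourierMultiplierCLM,
      TemperedDistribution.fourierMultiplierCLM_apply, Lp.fourier_toTemperedDistribution_eq,
      neg_smul, neg_neg, ← Complex.coe_smul, FourierTransform.fourier_smul,
      FourierTransform.fourier_fourierInv_eq, Complex.coe_smul]
  have hiff : (v : 𝓢'(Pos d, ℂ)) = -Δ (u : 𝓢'(Pos d, ℂ)) + c • (u : 𝓢'(Pos d, ℂ)) ↔
      (𝓕 v : L2 d) =ᵐ[volume] fun k => ((symb k : ℂ) + c) * (𝓕 u : L2 d) k := by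
    rw [← smulLeft_symb_iff, ← hF, ← Lp.fourier_toTemperedDistribution_eq]
    constructor
    · intro h; rw [h]
    · intro h
      have := congrArg (fun T : 𝓢'(Pos d, ℂ) => 𝓕⁻ T) h
      simpa only [FourierTransform.fourierInv_fourier_eq] using this
  rw [hiff, and_iff_right_iff_imp]
  intro h
  rw [TemperedDistribution.memSobolev_iff_exists_smulLeftCLM_fourier]
  set a : ℂ := ((((2 * Real.pi) ^ 2)⁻¹ : ℝ) : ℂ) with ha
  -- `(1 + |k|²) û = a v̂ + (1 - a c) û` with `a = (2π)⁻²`, so membership in `H²` comes for free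
  refine ⟨a • (𝓕 v : L2 d) + (1 - a * c) • (𝓕 u : L2 d), ?_⟩
  rw [Lp.fourier_toTemperedDistribution_eq]
  have htg : (fun x : Pos d => Complex.ofReal ((1 + ‖x‖ ^ 2) ^ ((2 : ℝ) / 2))).HasTemperateGrowth :=
    by fun_prop
  ext φ
  rw [TemperedDistribution.smulLeftCLM_apply_apply, Lp.toTemperedDistribution_apply,
    Lp.toTemperedDistribution_apply]
  refine integral_congr_ae ?_
  filter_upwards [h, Lp.coeFn_add (a • (𝓕 v : L2 d)) ((1 - a * c) • (𝓕 u : L2 d)),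
    Lp.coeFn_smul a (𝓕 v : L2 d), Lp.coeFn_smul (1 - a * c) (𝓕 u : L2 d)] with x h1 h2 h3 h4
  rw [SchwartzMap.smulLeftCLM_apply_apply htg, h2, Pi.add_apply, h3, h4, Pi.smul_apply,
    Pi.smul_apply, h1]
  simp only [smul_eq_mul, symb, div_self (two_ne_zero' ℝ), Real.rpow_one, ha]
  have : (2 * Real.pi : ℂ) ≠ 0 := by
    simp [Real.pi_ne_zero]
  push_cast
  field_simp
  ring

end Fourier

/-! ### Integrals depending holomorphically on a parameter -/

section Holomorphic

/-- An integral of functions holomorphic in a parameter, locally dominated, is holomorphic: the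
derivatives are dominated as well, by Cauchy's estimate. -/
theorem differentiableOn_integral_of_dominated {X : Type*} [MeasurableSpace X] {μ : Measure X}
    {U : Set ℂ} {F : ℂ → X → ℂ} (hU : IsOpen U)
    (hmeas : ∀ z ∈ U, AEStronglyMeasurable (F z) μ)
    (hdiff : ∀ᵐ x ∂μ, DifferentiableOn ℂ (fun z => F z x) U)
    (hdom : ∀ z₀ ∈ U, ∃ b : X → ℝ, Integrable b μ ∧ ∃ ε > 0,
      ∀ᵐ x ∂μ, ∀ z ∈ Metric.ball z₀ ε, ‖F z x‖ ≤ b x) :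
    DifferentiableOn ℂ (fun z => ∫ x, F z x ∂μ) U := by
  intro z₀ hz₀
  obtain ⟨b, hb, ε, hε, hbε⟩ := hdom z₀ hz₀
  obtain ⟨r, hr, hrU⟩ := Metric.isOpen_iff.1 hU z₀ hz₀
  set δ := min ε r / 2 with hδ
  have hδ0 : 0 < δ := by positivity
  have hδε : 2 * δ ≤ ε := by rw [hδ]; linarith [min_le_left ε r]
  have hδr : 2 * δ ≤ r := by rw [hδ]; linarith [min_le_right ε r]
  have hball : ∀ z ∈ Metric.ball z₀ δ, ∀ y ∈ Metric.closedBall z δ, y ∈ Metric.ball z₀ (2 * δ) := by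
    intro z hz y hy
    rw [Metric.mem_ball] at hz ⊢
    rw [Metric.mem_closedBall] at hy
    linarith [dist_triangle y z z₀]
  have hder : ∀ᵐ x ∂μ, ∀ z ∈ Metric.ball z₀ δ,
      HasDerivAt (fun z => F z x) (deriv (fun z => F z x) z) z := by
    filter_upwards [hdiff] with x hx z hz
    exact (hx.differentiableAt (hU.mem_nhds (hrU
      (Metric.ball_subset_ball (by linarith) hz)))).hasDerivAt
  have hz₀δ : z₀ ∈ Metric.ball z₀ δ := Metric.mem_ball_self hδ0
  have hmeas' : ∀ᶠ z in 𝓝 z₀, AEStronglyMeasurable (F z) μ :=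
    (hU.eventually_mem hz₀).mono hmeas
  refine ((hasDerivAt_integral_of_dominated_loc_of_deriv_le (F := F) (s := Metric.ball z₀ δ)
    (F' := fun z x => deriv (fun z => F z x) z) (bound := fun x => b x / δ)
    (Metric.ball_mem_nhds z₀ hδ0) hmeas' ?_ ?_ ?_ (hb.div_const δ)
    hder).2.differentiableAt).differentiableWithinAt
  · exact hb.mono' (hmeas z₀ hz₀) (hbε.mono fun x hx => hx z₀ (Metric.mem_ball_self hε))
  -- the derivative is a limit of difference quotients, hence measurable
  · have hu : Tendsto (fun n : ℕ => z₀ + ((δ / 2 / (n + 1) : ℝ) : ℂ)) atTop (𝓝[≠] z₀) := by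
      refine tendsto_nhdsWithin_iff.2 ⟨?_, Eventually.of_forall fun n => ?_⟩
      · have h1 : Tendsto (fun n : ℕ => δ / 2 / ((n : ℝ) + 1)) atTop (𝓝 0) :=
          tendsto_const_div_atTop_nhds_zero_nat (δ / 2) |>.comp (tendsto_add_atTop_nat 1) |>.congr
            fun n => by simp
        have h2 := (Complex.continuous_ofReal.tendsto 0).comp h1
        simpa using h2.const_add z₀
      · have : (0 : ℝ) < δ / 2 / (n + 1) := by positivity
        simpa using (Complex.ofReal_ne_zero.2 this.ne')
    refine aestronglyMeasurable_of_tendsto_ae (u := atTop)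
      (f := fun (n : ℕ) x => slope (fun z => F z x) z₀ (z₀ + ((δ / 2 / (n + 1) : ℝ) : ℂ))) ?_ ?_
    · intro n
      simp only [slope_def_module, smul_eq_mul]
      refine ((hmeas _ (hrU ?_)).sub (hmeas _ hz₀)).const_mul
        ((z₀ + ((δ / 2 / (n + 1) : ℝ) : ℂ) - z₀)⁻¹)
      have h0 : (0 : ℝ) < δ / 2 / (n + 1) := by positivity
      have h1 : δ / 2 / ((n : ℝ) + 1) ≤ δ / 2 := div_le_self (by positivity) (by linarith [n.cast_nonneg (α := ℝ)])
      rw [Metric.mem_ball, dist_eq_norm, add_sub_cancel_left, Complex.norm_real,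
        Real.norm_of_nonneg h0.le]
      linarith
    · filter_upwards [hder] with x hx
      exact ((hasDerivAt_iff_tendsto_slope.1 (hx z₀ hz₀δ))).comp hu
  · filter_upwards [hdiff, hbε] with x hx hxb z hz
    refine Complex.norm_deriv_le_of_forall_mem_sphere_norm_le hδ0 ?_ fun y hy => ?_
    · refine DifferentiableOn.diffContOnCl (hx.mono ?_)
      refine (Metric.closure_ball_subset_closedBall).trans fun y hy => hrU ?_
      exact Metric.ball_subset_ball hδr (hball z hz y hy)
    · exact hxb y (Metric.ball_subset_ball hδε (hball z hz y (Metric.sphere_subset_closedBall hy)))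

end Holomorphic

/-! ### Subordination: the free Green functions as integrals of the heat kernel -/

section HeatKernel

/-- The heat kernel in dimension `d` at time `t` and distance `r`. -/
def heatK (d : ℕ) (t r : ℝ) : ℝ := (4 * Real.pi * t) ^ (-(d : ℝ) / 2) * Real.exp (-r ^ 2 / (4 * t))

/-- The kernel of `(-Δ + κ²)⁻¹`, `Re κ > 0`, as a function of `r = |x|`; in dimension two it is
`K₀(κ r) / (2π)`. The value in other dimensions is irrelevant and set to zero. -/
def greenK (d : ℕ) (κ : ℂ) (r : ℝ) : ℂ :=
  match d with
  | 1 => Complex.exp (-κ * r) / (2 * κ)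
  | 2 => (4 * Real.pi : ℂ)⁻¹ * ∫ t : ℝ, Complex.exp (-κ * r * (Real.cosh t : ℂ))
  | 3 => Complex.exp (-κ * r) / (4 * Real.pi * r)
  | _ => 0

lemma image_exp_smul {c : ℝ} (hc : 0 < c) : (fun s => c * Real.exp s) '' Set.univ = Set.Ioi 0 := by
  ext t
  simp only [Set.mem_image, Set.mem_univ, true_and, Set.mem_Ioi]
  constructor
  · rintro ⟨s, rfl⟩; positivity
  · intro ht
    exact ⟨Real.log (t / c), by rw [Real.exp_log (by positivity)]; field_simp⟩

lemma image_sinh_half : (fun s => Real.sinh (s / 2)) '' Set.univ = Set.univ := by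
  rw [Set.image_univ, Set.range_eq_univ]
  intro t
  exact ⟨2 * Real.arsinh t, by simp [Real.sinh_arsinh]⟩

lemma integral_exp_smul {c : ℝ} (hc : 0 < c) (g : ℝ → ℝ) :
    ∫ t in Set.Ioi 0, g t = ∫ s, c * Real.exp s * g (c * Real.exp s) := by
  have h := integral_image_eq_integral_abs_deriv_smul (s := Set.univ)
    (f := fun s => c * Real.exp s) (f' := fun s => c * Real.exp s) MeasurableSet.univ
    (fun x _ => ((Real.hasDerivAt_exp x).const_mul c).hasDerivWithinAt)
    (fun x _ y _ hxy => Real.exp_injective (mul_left_cancel₀ hc.ne' hxy)) g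
  rw [image_exp_smul hc] at h
  rw [h, setIntegral_univ]
  refine integral_congr_ae (Eventually.of_forall fun s => ?_)
  simp only [smul_eq_mul]
  rw [abs_of_pos (by positivity)]

/-- A Gaussian integral in the variable `u = sinh (s / 2)`, as `cosh s = 1 + 2 u²`. -/
lemma integral_cosh_half {a : ℝ} (ha : 0 < a) :
    Integrable (fun s => Real.cosh (s / 2) * Real.exp (-a * Real.cosh s)) ∧
    ∫ s, Real.cosh (s / 2) * Real.exp (-a * Real.cosh s)
      = √(2 * Real.pi / a) * Real.exp (-a) := by
  have hd : ∀ x ∈ Set.univ, HasDerivWithinAt (fun s => Real.sinh (s / 2))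
      (Real.cosh (x / 2) / 2) Set.univ x := fun x _ => by
    have := ((Real.hasDerivAt_sinh (x / 2)).comp x ((hasDerivAt_id x).div_const 2))
    refine HasDerivAt.hasDerivWithinAt ?_
    simpa [div_eq_mul_inv, Function.comp_def] using this
  have hinj : Set.InjOn (fun s : ℝ => Real.sinh (s / 2)) Set.univ := fun x _ y _ hxy => by
    have := Real.sinh_injective hxy
    linarith
  have hkey : ∀ s : ℝ, Real.cosh (s / 2) * Real.exp (-a * Real.cosh s)
      = 2 * Real.exp (-a) * (|Real.cosh (s / 2) / 2| • Real.exp (-(2 * a) * Real.sinh (s / 2) ^ 2)) := by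
    intro s
    have h1 : Real.cosh s = 1 + 2 * Real.sinh (s / 2) ^ 2 := by
      have h2 := Real.cosh_two_mul (s / 2)
      rw [show 2 * (s / 2) = s by ring] at h2
      rw [h2, Real.cosh_sq]; ring
    rw [abs_of_pos (by have := Real.cosh_pos (s / 2); positivity), h1, smul_eq_mul,
      show -a * (1 + 2 * Real.sinh (s / 2) ^ 2) = -a + -(2 * a) * Real.sinh (s / 2) ^ 2 by ring,
      Real.exp_add]
    ring
  have hg : Integrable fun u : ℝ => Real.exp (-(2 * a) * u ^ 2) :=
    integrable_exp_neg_mul_sq (by positivity)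
  have hi := (integrableOn_image_iff_integrableOn_abs_deriv_smul MeasurableSet.univ hd hinj
    (fun u => Real.exp (-(2 * a) * u ^ 2))).1 (by rw [image_sinh_half]; exact hg.integrableOn)
  have he := integral_image_eq_integral_abs_deriv_smul MeasurableSet.univ hd hinj
    (fun u => Real.exp (-(2 * a) * u ^ 2))
  rw [image_sinh_half, setIntegral_univ, setIntegral_univ, integral_gaussian] at he
  rw [integrableOn_univ] at hi
  simp only [hkey]
  refine ⟨hi.const_mul _, ?_⟩
  rw [integral_const_mul, ← he]
  have : Real.pi / (2 * a) = 2 * Real.pi / a / 2 ^ 2 := by field_simp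
  rw [this, Real.sqrt_div' _ (by positivity), Real.sqrt_sq (by norm_num)]
  ring

/-- By symmetry in `s`, `exp (± s / 2)` may be replaced by `cosh (s / 2)`. -/
lemma integral_exp_half {a : ℝ} (ha : 0 < a) {ε : ℝ} (hε : ε = 1 ∨ ε = -1) :
    ∫ s, Real.exp (ε * (s / 2)) * Real.exp (-a * Real.cosh s)
      = √(2 * Real.pi / a) * Real.exp (-a) := by
  obtain ⟨hi, he⟩ := integral_cosh_half ha
  have hint : ∀ η : ℝ, η = 1 ∨ η = -1 →
      Integrable fun s => Real.exp (η * (s / 2)) * Real.exp (-a * Real.cosh s) := by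
    intro η hη
    refine (hi.const_mul 2).mono' (by fun_prop) (Eventually.of_forall fun s => ?_)
    rw [Real.norm_of_nonneg (by positivity), ← mul_assoc]
    gcongr
    rw [Real.cosh_eq]
    rcases hη with rfl | rfl <;> simp <;> linarith [Real.exp_pos (s / 2), Real.exp_pos (-(s / 2))]
  have h1 : ∫ s, Real.exp (-ε * (s / 2)) * Real.exp (-a * Real.cosh s)
      = ∫ s, Real.exp (ε * (s / 2)) * Real.exp (-a * Real.cosh s) := by
    rw [← integral_neg_eq_self (fun s => Real.exp (-ε * (s / 2)) * Real.exp (-a * Real.cosh s))]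
    refine integral_congr_ae (Eventually.of_forall fun s => ?_)
    simp only [Real.cosh_neg]
    congr 2; ring
  have h2 := integral_add (hint ε hε) (hint (-ε) (by rcases hε with rfl | rfl <;> simp))
  rw [h1] at h2
  have h3 : ∫ s, (Real.exp (ε * (s / 2)) * Real.exp (-a * Real.cosh s)
      + Real.exp (-ε * (s / 2)) * Real.exp (-a * Real.cosh s))
      = 2 * ∫ s, Real.cosh (s / 2) * Real.exp (-a * Real.cosh s) := by
    rw [← integral_const_mul]
    refine integral_congr_ae (Eventually.of_forall fun s => ?_)
    simp only [Real.cosh_eq (s / 2)]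
    rcases hε with rfl | rfl <;> simp <;> ring
  rw [h3, he] at h2
  linarith

/-- The Laplace transform of the heat kernel is the Green function. -/
theorem greenK_eq_integral_heatK {d : ℕ} (hd : d = 1 ∨ d = 2 ∨ d = 3) {κ r : ℝ} (hκ : 0 < κ)
    (hr : 0 < r) :
    greenK d κ r = ((∫ t in Set.Ioi 0, Real.exp (-κ ^ 2 * t) * heatK d t r : ℝ) : ℂ) := by
  have hπ := Real.pi_pos
  -- the substitution `t = (r / 2κ) e^s` makes the exponent `-κ² t - r² / 4t` equal to `-κ r cosh s`
  have hsub : ∫ t in Set.Ioi 0, Real.exp (-κ ^ 2 * t) * heatK d t r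
      = (r / (2 * κ)) * (2 * Real.pi * r / κ) ^ (-(d : ℝ) / 2) *
        ∫ s, Real.exp ((1 - (d : ℝ) / 2) * s) * Real.exp (-(κ * r) * Real.cosh s) := by
    rw [integral_exp_smul (c := r / (2 * κ)) (by positivity), ← integral_const_mul]
    refine integral_congr_ae (Eventually.of_forall fun s => ?_)
    simp only [heatK]
    have h1 : (4 * Real.pi * (r / (2 * κ) * Real.exp s)) ^ (-(d : ℝ) / 2)
        = (2 * Real.pi * r / κ) ^ (-(d : ℝ) / 2) * Real.exp (-(d : ℝ) / 2 * s) := by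
      rw [show 4 * Real.pi * (r / (2 * κ) * Real.exp s) = (2 * Real.pi * r / κ) * Real.exp s by
        field_simp; ring, Real.mul_rpow (by positivity) (by positivity), ← Real.exp_mul]
      ring_nf
    have h2 : Real.exp s * (Real.exp (-κ ^ 2 * (r / (2 * κ) * Real.exp s)) *
        (Real.exp (-(d : ℝ) / 2 * s) * Real.exp (-r ^ 2 / (4 * (r / (2 * κ) * Real.exp s)))))
        = Real.exp ((1 - (d : ℝ) / 2) * s) * Real.exp (-(κ * r) * Real.cosh s) := by
      simp only [← Real.exp_add]
      congr 1
      rw [Real.cosh_eq, Real.exp_neg]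
      have := Real.exp_ne_zero s
      field_simp
      ring
    rw [h1, ← h2]
    ring
  rw [hsub]
  have ha : 0 < κ * r := by positivity
  have hroot : ∀ x : ℝ, 0 < x → √x ^ 2 = x := fun x hx => Real.sq_sqrt hx.le
  rcases hd with rfl | rfl | rfl
  · have h1 := integral_exp_half ha (Or.inl rfl)
    have h2 : ∫ s, Real.exp ((1 - ((1 : ℕ) : ℝ) / 2) * s) * Real.exp (-(κ * r) * Real.cosh s)
        = √(2 * Real.pi / (κ * r)) * Real.exp (-(κ * r)) := by
      rw [← h1]; congr 1; ext s; congr 2; push_cast; ring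
    rw [h2]
    have h3 : (2 * Real.pi * r / κ) ^ (-((1 : ℕ) : ℝ) / 2) = (√(2 * Real.pi * r / κ))⁻¹ := by
      rw [show (-((1 : ℕ) : ℝ) / 2) = -(1 / 2) by norm_num, Real.rpow_neg (by positivity),
        Real.sqrt_eq_rpow]
    have h4 : √(2 * Real.pi / (κ * r)) = √(2 * Real.pi * r / κ) / r := by
      rw [show 2 * Real.pi / (κ * r) = 2 * Real.pi * r / κ / r ^ 2 by field_simp,
        Real.sqrt_div' _ (by positivity), Real.sqrt_sq hr.le]
    have h5 : √(2 * Real.pi * r / κ) ≠ 0 := (Real.sqrt_pos.2 (by positivity)).ne'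
    rw [h3, h4, show r / (2 * κ) * (√(2 * Real.pi * r / κ))⁻¹ *
      (√(2 * Real.pi * r / κ) / r * Real.exp (-(κ * r))) = Real.exp (-(κ * r)) / (2 * κ) by
        field_simp]
    simp [greenK]
  · have h2 : ∫ s, Real.exp ((1 - ((2 : ℕ) : ℝ) / 2) * s) * Real.exp (-(κ * r) * Real.cosh s)
        = ∫ s, Real.exp (-(κ * r) * Real.cosh s) := by
      congr 1; ext s; simp
    rw [h2, show (-((2 : ℕ) : ℝ) / 2) = -1 by norm_num, Real.rpow_neg_one]
    have h3 : r / (2 * κ) * (2 * Real.pi * r / κ)⁻¹ = (4 * Real.pi)⁻¹ := by field_simp; norm_num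
    rw [h3]
    simp only [greenK]
    push_cast
    rw [← integral_complex_ofReal]
    congr 2; ext s; push_cast; congr 1; ring
  · have h1 := integral_exp_half ha (Or.inr rfl)
    have h2 : ∫ s, Real.exp ((1 - ((3 : ℕ) : ℝ) / 2) * s) * Real.exp (-(κ * r) * Real.cosh s)
        = √(2 * Real.pi / (κ * r)) * Real.exp (-(κ * r)) := by
      rw [← h1]; congr 1; ext s; congr 2; push_cast; ring
    rw [h2]
    have h3 : (2 * Real.pi * r / κ) ^ (-((3 : ℕ) : ℝ) / 2)
        = (√(2 * Real.pi * r / κ))⁻¹ * (2 * Real.pi * r / κ)⁻¹ := by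
      rw [show (-((3 : ℕ) : ℝ) / 2) = -(1 / 2) + -1 by norm_num, Real.rpow_add (by positivity),
        Real.rpow_neg (by positivity), Real.sqrt_eq_rpow, Real.rpow_neg_one]
    have h4 : √(2 * Real.pi / (κ * r)) = √(2 * Real.pi * r / κ) / r := by
      rw [show 2 * Real.pi / (κ * r) = 2 * Real.pi * r / κ / r ^ 2 by field_simp,
        Real.sqrt_div' _ (by positivity), Real.sqrt_sq hr.le]
    have h5 : √(2 * Real.pi * r / κ) ≠ 0 := (Real.sqrt_pos.2 (by positivity)).ne'
    rw [h3, h4, show r / (2 * κ) * ((√(2 * Real.pi * r / κ))⁻¹ * (2 * Real.pi * r / κ)⁻¹) *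
      (√(2 * Real.pi * r / κ) / r * Real.exp (-(κ * r))) = Real.exp (-(κ * r)) / (4 * Real.pi * r) by
        field_simp; norm_num]
    simp [greenK]

end HeatKernel

/-! ### The Fourier transform of the Green functions -/

section GreenFourier

open FourierTransform

variable {d : ℕ}

lemma ae_ne_zero (hd : 0 < d) : ∀ᵐ x : Pos d, x ≠ 0 := by
  have : NeZero d := ⟨hd.ne'⟩
  have : Nontrivial (Pos d) := by
    apply Module.nontrivial_of_finrank_pos (R := ℝ)
    rwa [finrank_euclideanSpace_fin]
  exact compl_mem_ae_iff.2 (measure_singleton 0)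

lemma measurable_heatK (d : ℕ) : Measurable (fun p : ℝ × ℝ => heatK d p.1 p.2) := by
  unfold heatK; fun_prop

lemma heatK_nonneg {t : ℝ} (ht : 0 < t) (r : ℝ) : 0 ≤ heatK d t r := by
  unfold heatK; positivity

lemma integral_heatK {t : ℝ} (ht : 0 < t) :
    Integrable (fun x : Pos d => heatK d t ‖x‖) ∧ ∫ x : Pos d, heatK d t ‖x‖ = 1 := by
  have hb : 0 < (4 * t)⁻¹ := by positivity
  have h1 : ∀ x : Pos d, heatK d t ‖x‖
      = (4 * Real.pi * t) ^ (-(d : ℝ) / 2) * Real.exp (-(4 * t)⁻¹ * ‖x‖ ^ 2) := by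
    intro x; unfold heatK; congr 2; field_simp
  have h2 := GaussianFourier.integral_rexp_neg_mul_sq_norm (V := Pos d) hb
  have h3 : Integrable fun x : Pos d => Real.exp (-(4 * t)⁻¹ * ‖x‖ ^ 2) := by
    refine Integrable.of_integral_ne_zero ?_
    rw [h2]; have := Real.pi_pos; positivity
  simp only [h1]
  refine ⟨h3.const_mul _, ?_⟩
  rw [integral_const_mul, h2, finrank_euclideanSpace_fin,
    show Real.pi / (4 * t)⁻¹ = 4 * Real.pi * t by field_simp,
    ← Real.rpow_add (by have := Real.pi_pos; positivity)]
  rw [show -(d : ℝ) / 2 + d / 2 = 0 by ring, Real.rpow_zero]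

lemma integral_schwartz_mul_heatK (φ : 𝓢(Pos d, ℂ)) {t : ℝ} (ht : 0 < t) :
    ∫ x, φ x * (heatK d t ‖x‖ : ℂ) = ∫ k, (𝓕⁻ φ) k * Complex.exp (-t * symb k) := by
  have hπ := Real.pi_pos
  set b : ℂ := ((4 * Real.pi ^ 2 * t : ℝ) : ℂ) with hb
  have hb0 : 0 < b.re := by rw [hb, Complex.ofReal_re]; positivity
  have hF : Integrable fun k : Pos d => Complex.exp (-b * ‖k‖ ^ 2) := by
    have := GaussianFourier.integrable_cexp_neg_mul_sq_norm_add hb0 0 (0 : Pos d)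
    simpa using this
  have hFk : (fun k : Pos d => Complex.exp (-b * ‖k‖ ^ 2))
      = fun k => Complex.exp (-t * symb k) := by
    ext k; rw [hb, symb]; congr 1; push_cast; ring
  have hinv : 𝓕⁻ (fun k : Pos d => Complex.exp (-b * ‖k‖ ^ 2)) = fun x => (heatK d t ‖x‖ : ℂ) := by
    ext x
    rw [Real.fourierInv_eq_fourier_comp_neg]
    simp only [norm_neg]
    rw [fourier_gaussian_innerProductSpace hb0, finrank_euclideanSpace_fin]
    unfold heatK
    rw [Complex.ofReal_mul]
    congr 1
    · rw [hb, ← Complex.ofReal_div, show Real.pi / (4 * Real.pi ^ 2 * t) = (4 * Real.pi * t)⁻¹ by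
        field_simp, show ((d : ℂ) / 2) = (((d : ℝ) / 2 : ℝ) : ℂ) by push_cast; rfl,
        ← Complex.ofReal_cpow (by positivity), Real.inv_rpow (by positivity),
        ← Real.rpow_neg (by positivity)]
      congr 2; ring
    · rw [Complex.ofReal_exp, hb]
      congr 1
      push_cast
      have : (t : ℂ) ≠ 0 := by exact_mod_cast ht.ne'
      have : (Real.pi : ℂ) ≠ 0 := by exact_mod_cast hπ.ne'
      field_simp
  have h := integral_schwartz_mul_fourierInv φ hF
  rw [hinv] at h
  refine h.trans ?_
  simp only [funext_iff] at hFk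
  simp only [hFk]

lemma exists_norm_schwartz_le (φ : 𝓢(Pos d, ℂ)) : ∃ C, ∀ x, ‖φ x‖ ≤ C := by
  obtain ⟨C, hC⟩ := φ.decay 0 0
  exact ⟨C, fun x => by simpa using hC.2 x⟩

/-- The joint integrability that Fubini's theorem needs for the Laplace transform of the heat
kernel, paired with a bounded function. -/
lemma integrable_subordination {κ : ℝ} (hκ : 0 < κ) {f : Pos d → ℂ} (hf : Continuous f)
    (hfb : ∃ C, ∀ x, ‖f x‖ ≤ C) :
    Integrable (fun p : ℝ × Pos d =>
      f p.2 * ((Real.exp (-κ ^ 2 * p.1) * heatK d p.1 ‖p.2‖ : ℝ) : ℂ))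
      ((volume.restrict (Set.Ioi 0)).prod volume) := by
  obtain ⟨C, hC⟩ := hfb
  have hexp : Integrable (fun t : ℝ => Real.exp (-κ ^ 2 * t)) (volume.restrict (Set.Ioi 0)) :=
    exp_neg_integrableOn_Ioi 0 (by positivity)
  have hm : Measurable fun p : ℝ × Pos d => ((Real.exp (-κ ^ 2 * p.1) * heatK d p.1 ‖p.2‖ : ℝ)) := by
    have := (measurable_heatK d).comp
      (by fun_prop : Measurable fun p : ℝ × Pos d => (p.1, ‖p.2‖))
    exact (by fun_prop : Measurable fun p : ℝ × Pos d => Real.exp (-κ ^ 2 * p.1)).mul this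
  have hpos : ∀ᵐ t ∂(volume.restrict (Set.Ioi (0 : ℝ))), 0 < t :=
    ae_restrict_mem measurableSet_Ioi
  have hH : Integrable (fun p : ℝ × Pos d => ((Real.exp (-κ ^ 2 * p.1) * heatK d p.1 ‖p.2‖ : ℝ)))
      ((volume.restrict (Set.Ioi 0)).prod volume) := by
    refine (integrable_prod_iff hm.aestronglyMeasurable).2 ⟨?_, ?_⟩
    · filter_upwards [hpos] with t ht
      exact (integral_heatK ht).1.const_mul _
    · refine hexp.congr ?_
      filter_upwards [hpos] with t ht
      have : ∀ x : Pos d, ‖Real.exp (-κ ^ 2 * t) * heatK d t ‖x‖‖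
          = Real.exp (-κ ^ 2 * t) * heatK d t ‖x‖ := fun x =>
        Real.norm_of_nonneg (mul_nonneg (Real.exp_pos _).le (heatK_nonneg ht _))
      simp only [this]
      rw [integral_const_mul, (integral_heatK ht).2, mul_one]
  refine hH.ofReal.bdd_mul (c := C) (by fun_prop) (Eventually.of_forall fun p => hC p.2)

lemma greenK_ofReal_ae (hd : d = 1 ∨ d = 2 ∨ d = 3) {κ : ℝ} (hκ : 0 < κ) :
    ∀ᵐ x : Pos d, greenK d κ ‖x‖
      = ((∫ t in Set.Ioi 0, Real.exp (-κ ^ 2 * t) * heatK d t ‖x‖ : ℝ) : ℂ) := by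
  filter_upwards [ae_ne_zero (d := d) (by omega)] with x hx
  exact greenK_eq_integral_heatK hd hκ (norm_pos_iff.2 hx)

lemma integrable_greenK_ofReal (hd : d = 1 ∨ d = 2 ∨ d = 3) {κ : ℝ} (hκ : 0 < κ) :
    Integrable fun x : Pos d => greenK d κ ‖x‖ := by
  have h := (integrable_subordination (d := d) hκ (f := fun _ => 1) continuous_const
    ⟨1, by simp⟩).swap.integral_prod_left
  refine h.congr ?_
  filter_upwards [greenK_ofReal_ae hd hκ] with x hx
  rw [hx, ← integral_complex_ofReal]
  simp

/-- For real `κ`, the Laplace transform in `t` of the identity for the heat kernel, as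
`∫₀^∞ exp (-(κ² + 4π²|k|²) t) dt = 1 / (4π²|k|² + κ²)`. -/
lemma integral_schwartz_mul_greenK_ofReal (hd : d = 1 ∨ d = 2 ∨ d = 3) {κ : ℝ} (hκ : 0 < κ)
    (φ : 𝓢(Pos d, ℂ)) :
    ∫ x, φ x * greenK d κ ‖x‖ = ∫ k, (𝓕⁻ φ) k * gHat (-(κ : ℂ) ^ 2) k := by
  have hpos : ∀ᵐ t ∂(volume.restrict (Set.Ioi (0 : ℝ))), 0 < t :=
    ae_restrict_mem measurableSet_Ioi
  have h1 := integrable_subordination hκ φ.continuous (exists_norm_schwartz_le φ)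
  have h2 : ∫ x, φ x * greenK d κ ‖x‖ = ∫ x, (∫ t in Set.Ioi 0,
      φ x * ((Real.exp (-κ ^ 2 * t) * heatK d t ‖x‖ : ℝ) : ℂ)) := by
    refine integral_congr_ae ?_
    filter_upwards [greenK_ofReal_ae hd hκ] with x hx
    rw [hx, ← integral_complex_ofReal, integral_const_mul]
  have h3 : ∫ x, (∫ t in Set.Ioi 0, φ x * ((Real.exp (-κ ^ 2 * t) * heatK d t ‖x‖ : ℝ) : ℂ))
      = ∫ t in Set.Ioi 0, (∫ x, φ x * ((Real.exp (-κ ^ 2 * t) * heatK d t ‖x‖ : ℝ) : ℂ)) :=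
    (integral_integral_swap (f := fun t x =>
      φ x * ((Real.exp (-κ ^ 2 * t) * heatK d t ‖x‖ : ℝ) : ℂ)) h1).symm
  have h4 : ∫ t in Set.Ioi 0, (∫ x, φ x * ((Real.exp (-κ ^ 2 * t) * heatK d t ‖x‖ : ℝ) : ℂ))
      = ∫ t in Set.Ioi (0 : ℝ), (∫ k, (𝓕⁻ φ) k * Complex.exp (-(κ ^ 2 + symb k : ℝ) * t)) := by
    refine integral_congr_ae ?_
    filter_upwards [hpos] with t ht
    have e1 : ∀ x : Pos d, φ x * ((Real.exp (-κ ^ 2 * t) * heatK d t ‖x‖ : ℝ) : ℂ)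
        = ((Real.exp (-κ ^ 2 * t) : ℝ) : ℂ) * (φ x * (heatK d t ‖x‖ : ℂ)) := by
      intro x; push_cast; ring
    simp only [e1]
    rw [integral_const_mul, integral_schwartz_mul_heatK φ ht, ← integral_const_mul]
    refine integral_congr_ae (Eventually.of_forall fun k => ?_)
    simp only
    rw [show (-(κ ^ 2 + symb k : ℝ) * t : ℂ) = (-κ ^ 2 * t : ℝ) + -t * symb k by push_cast; ring,
      Complex.exp_add, ← Complex.ofReal_exp]
    ring
  have hexp : Integrable (fun t : ℝ => Real.exp (-κ ^ 2 * t)) (volume.restrict (Set.Ioi 0)) :=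
    exp_neg_integrableOn_Ioi 0 (by positivity)
  have h5 : Integrable (Function.uncurry fun (t : ℝ) (k : Pos d) =>
      (𝓕⁻ φ) k * Complex.exp (-(κ ^ 2 + symb k : ℝ) * t))
      ((volume.restrict (Set.Ioi 0)).prod volume) := by
    have := hexp.mul_prod ((𝓕⁻ φ).integrable (μ := volume)).norm
    refine this.mono' ?_ ?_
    · have : Measurable fun p : ℝ × Pos d => (𝓕⁻ φ) p.2 := (𝓕⁻ φ).continuous.measurable.comp measurable_snd
      refine Measurable.aestronglyMeasurable (Measurable.mul this ?_)
      have := continuous_symb (d := d)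
      fun_prop
    · have hp : ∀ᵐ p ∂((volume.restrict (Set.Ioi (0 : ℝ))).prod (volume : Measure (Pos d))), 0 < p.1 :=
        Measure.quasiMeasurePreserving_fst.ae hpos
      filter_upwards [hp] with p hp
      simp only [Function.uncurry]
      rw [norm_mul, mul_comm, Complex.norm_exp]
      gcongr
      simp only [← Complex.ofReal_neg, ← Complex.ofReal_mul, Complex.ofReal_re]
      nlinarith [symb_nonneg p.2]
  rw [h2, h3, h4, integral_integral_swap h5]
  refine integral_congr_ae (Eventually.of_forall fun k => ?_)
  simp only
  rw [integral_const_mul]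
  congr 1
  have hc : 0 < κ ^ 2 + symb k := by have := symb_nonneg k; positivity
  have := integral_exp_mul_complex_Ioi (a := -((κ ^ 2 + symb k : ℝ) : ℂ))
    (by rw [Complex.neg_re, Complex.ofReal_re]; linarith) 0
  rw [this, gHat]
  simp only [Complex.ofReal_zero, mul_zero, Complex.exp_zero]
  rw [neg_div_neg_eq, one_div]
  congr 1
  push_cast; ring

end GreenFourier

/-! ### Analytic continuation in the spectral parameter -/

section GreenComplex

open FourierTransform

variable {d : ℕ}

/-- The half-plane of admissible `κ = √(-w)`. -/
def rightHalfPlane : Set ℂ := {κ | 0 < κ.re}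

lemma isOpen_rightHalfPlane : IsOpen rightHalfPlane :=
  isOpen_lt continuous_const Complex.continuous_re

lemma isPreconnected_rightHalfPlane : IsPreconnected rightHalfPlane :=
  (convex_halfSpace_re_gt 0).isPreconnected

lemma ne_zero_of_mem_rightHalfPlane {κ : ℂ} (h : κ ∈ rightHalfPlane) : κ ≠ 0 := by
  rintro rfl; simp [rightHalfPlane] at h

lemma sq_mem_slitPlane {κ : ℂ} (hκ : κ ∈ rightHalfPlane) : -(-κ ^ 2) ∈ Complex.slitPlane := by
  rw [neg_neg, Complex.mem_slitPlane_iff]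
  by_contra! h
  obtain ⟨h1, h2⟩ := h
  simp only [rightHalfPlane, Set.mem_ofPred_eq] at hκ
  simp only [pow_two, Complex.mul_re, Complex.mul_im] at h1 h2
  have h3 : κ.im = 0 := by
    have : κ.re * κ.im = 0 := by linarith
    rcases mul_eq_zero.1 this with h | h <;> [linarith; exact h]
  rw [h3] at h1
  nlinarith

/-- `√(-w)`, the branch with positive real part. -/
def kap (w : ℂ) : ℂ := (-w) ^ (1 / 2 : ℂ)

lemma kap_sq (w : ℂ) : kap w ^ 2 = -w := by
  unfold kap
  rw [← Complex.cpow_mul_nat]; norm_num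

lemma kap_mem {w : ℂ} (hw : -w ∈ Complex.slitPlane) : kap w ∈ rightHalfPlane := by
  have h0 : -w ≠ 0 := Complex.slitPlane_ne_zero hw
  simp only [rightHalfPlane, Set.mem_ofPred_eq]
  unfold kap
  rw [Complex.cpow_def_of_ne_zero h0, Complex.exp_re]
  have h1 := (Complex.mem_slitPlane_iff_arg.1 hw).1
  have h2 := Complex.neg_pi_lt_arg (-w)
  have h3 := lt_of_le_of_ne (Complex.arg_le_pi (-w)) h1
  refine mul_pos (Real.exp_pos _) (Real.cos_pos_of_mem_Ioo ⟨?_, ?_⟩)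
  · simp [Complex.log_im]; linarith
  · simp [Complex.log_im]; linarith

lemma kap_eq {κ : ℂ} (hκ : κ ∈ rightHalfPlane) : kap (-κ ^ 2) = κ := by
  have h1 := kap_mem (sq_mem_slitPlane hκ)
  have h2 := kap_sq (-κ ^ 2)
  rw [neg_neg] at h2
  rcases sq_eq_sq_iff_eq_or_eq_neg.1 h2 with h | h
  · exact h
  · rw [h] at h1
    simp only [rightHalfPlane, Set.mem_ofPred_eq, Complex.neg_re] at h1 hκ
    linarith

lemma kap_ofReal {s : ℝ} (hs : 0 < s) : kap (-(s : ℂ) ^ 2) = s :=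
  kap_eq (by simpa [rightHalfPlane] using hs)

lemma conj_kap {w : ℂ} (hw : -w ∈ Complex.slitPlane) :
    (starRingEnd ℂ) (kap w) = kap ((starRingEnd ℂ) w) := by
  have h : (starRingEnd ℂ) (kap w) ∈ rightHalfPlane := by
    simpa [rightHalfPlane] using kap_mem hw
  rw [← kap_eq h, ← map_pow, kap_sq, map_neg, neg_neg]

lemma differentiableAt_kap {w : ℂ} (hw : -w ∈ Complex.slitPlane) : DifferentiableAt ℂ kap w :=
  (differentiableAt_id.neg).cpow_const hw

lemma green_eq (d : ℕ) {w : ℂ} (hw : -w ∈ Complex.slitPlane) (r : ℝ) :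
    green d w r = greenK d (kap w) r := by
  have h0 := ne_zero_of_mem_rightHalfPlane (kap_mem hw)
  have hI : ∀ s : ℂ, Complex.I * (Complex.I * kap w * s) = -kap w * s := fun s => by
    linear_combination (kap w * s) * Complex.I_mul_I
  have hI' : ∀ s : ℂ, Complex.I * (Complex.I * kap w) * s = -kap w * s := fun s => by
    linear_combination (kap w * s) * Complex.I_mul_I
  have hu : upperSqrt w = Complex.I * kap w := rfl
  match d with
  | 1 =>
    have := Complex.I_ne_zero
    simp only [green, greenK]
    rw [hu, hI', div_eq_div_iff (by simp [h0]) (by simp [h0])]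
    ring
  | 2 =>
    simp only [green, greenK]
    rw [hu, hankelH1]
    simp only [hI]
    have h1 := Complex.I_ne_zero
    have : (Real.pi : ℂ) ≠ 0 := by exact_mod_cast Real.pi_ne_zero
    field_simp
  | 3 => simp only [green, greenK, hu, hI']
  | 0 => rfl
  | n + 4 => rfl

lemma integrable_exp_neg_cosh {a : ℝ} (ha : 0 < a) :
    Integrable fun t => Real.exp (-a * Real.cosh t) := by
  refine (integral_cosh_half ha).1.mono' (by fun_prop) (Eventually.of_forall fun s => ?_)
  rw [Real.norm_of_nonneg (by positivity)]
  exact le_mul_of_one_le_left (Real.exp_pos _).le (Real.one_le_cosh _)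

lemma norm_exp_neg_mul_le {κ : ℂ} {a r : ℝ} (h : a ≤ κ.re) (hr : 0 ≤ r) :
    ‖Complex.exp (-κ * r)‖ ≤ Real.exp (-a * r) := by
  rw [Complex.norm_exp]
  gcongr
  rw [Complex.mul_re, Complex.ofReal_re, Complex.ofReal_im, Complex.neg_re]
  nlinarith

/-- The Green functions decrease in `Re κ`; this provides the majorants for analytic continuation. -/
lemma norm_greenK_le {κ : ℂ} {a r : ℝ} (ha : 0 < a) (h : a ≤ κ.re) (hr : 0 < r) :
    ‖greenK d κ r‖ ≤ ‖greenK d a r‖ := by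
  have hn : ∀ s : ℝ, ‖Complex.exp (-(a : ℂ) * s)‖ = Real.exp (-a * s) := fun s => by
    rw [Complex.norm_exp]; simp
  unfold greenK
  split
  · rw [norm_div, norm_div, hn]
    have h1 : a ≤ ‖κ‖ := h.trans ((le_abs_self _).trans (Complex.abs_re_le_norm κ))
    have h2 := norm_exp_neg_mul_le h hr.le
    simp only [norm_mul, Complex.norm_real, Real.norm_of_nonneg ha.le]
    gcongr
    norm_num
    exact ha
  · rw [norm_mul, norm_mul]
    gcongr
    have e1 : ∀ t : ℝ, -(a : ℂ) * r * (Real.cosh t : ℂ) = ((-(a * r) * Real.cosh t : ℝ) : ℂ) :=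
      fun t => by push_cast; ring
    have e2 : ∀ t : ℝ, -κ * r * (Real.cosh t : ℂ) = -κ * ((r * Real.cosh t : ℝ) : ℂ) :=
      fun t => by push_cast; ring
    simp only [e1, e2, ← Complex.ofReal_exp]
    rw [integral_complex_ofReal, Complex.norm_real, Real.norm_of_nonneg
      (integral_nonneg fun t => (Real.exp_pos _).le)]
    refine norm_integral_le_of_norm_le (integrable_exp_neg_cosh (by positivity))
      (Eventually.of_forall fun t => ?_)
    refine (norm_exp_neg_mul_le h (by have := Real.cosh_pos t; positivity)).trans (le_of_eq ?_)
    ring_nf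
  · rw [norm_div, norm_div, hn]
    have h2 := norm_exp_neg_mul_le h hr.le
    gcongr
  · simp

lemma measurable_greenK (d : ℕ) (κ : ℂ) : Measurable fun r : ℝ => greenK d κ r := by
  unfold greenK
  split
  · fun_prop
  · refine Measurable.const_mul ?_ _
    have : StronglyMeasurable (Function.uncurry fun (r t : ℝ) =>
        Complex.exp (-κ * r * (Real.cosh t : ℂ))) := by
      refine Continuous.stronglyMeasurable ?_
      unfold Function.uncurry
      fun_prop
    exact this.integral_prod_right.measurable
  · fun_prop
  · fun_prop

lemma differentiableOn_greenK (d : ℕ) {r : ℝ} (hr : 0 < r) :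
    DifferentiableOn ℂ (fun κ => greenK d κ r) rightHalfPlane := by
  unfold greenK
  split
  · intro κ hκ
    have := ne_zero_of_mem_rightHalfPlane hκ
    exact DifferentiableAt.differentiableWithinAt
      (by fun_prop (disch := simpa using this))
  · refine DifferentiableOn.const_mul ?_ _
    refine differentiableOn_integral_of_dominated isOpen_rightHalfPlane ?_ ?_ ?_
    · intro κ _
      exact Continuous.aestronglyMeasurable (by fun_prop)
    · exact Eventually.of_forall fun t => by fun_prop
    · intro κ₀ hκ₀
      simp only [rightHalfPlane, Set.mem_ofPred_eq] at hκ₀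
      refine ⟨_, integrable_exp_neg_cosh (a := κ₀.re / 2 * r) (by positivity), κ₀.re / 2,
        by positivity, Eventually.of_forall fun t κ hκ => ?_⟩
      have h1 : κ₀.re / 2 ≤ κ.re := by
        have h2 := (Complex.abs_re_le_norm (κ - κ₀)).trans_lt (mem_ball_iff_norm.1 hκ)
        rw [Complex.sub_re, abs_lt] at h2
        linarith
      have e2 : -κ * r * (Real.cosh t : ℂ) = -κ * ((r * Real.cosh t : ℝ) : ℂ) := by
        push_cast; ring
      rw [e2]
      refine (norm_exp_neg_mul_le h1 (by have := Real.cosh_pos t; positivity)).trans (le_of_eq ?_)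
      ring_nf
  · fun_prop
  · fun_prop

lemma integrable_greenK (hd : d = 1 ∨ d = 2 ∨ d = 3) {κ : ℂ} (hκ : κ ∈ rightHalfPlane) :
    Integrable fun x : Pos d => greenK d κ ‖x‖ := by
  refine (integrable_greenK_ofReal hd hκ).mono
    ((measurable_greenK d κ).comp measurable_norm).aestronglyMeasurable ?_
  filter_upwards [ae_ne_zero (d := d) (by omega)] with x hx
  exact norm_greenK_le hκ le_rfl (norm_pos_iff.2 hx)

lemma frequently_ofReal_pos : ∃ᶠ z : ℂ in 𝓝[≠] 1, ∃ s : ℝ, 0 < s ∧ z = s := by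
  have hu : Tendsto (fun s : ℝ => (s : ℂ)) (𝓝[≠] 1) (𝓝[≠] 1) := by
    refine tendsto_nhdsWithin_iff.2 ⟨?_, ?_⟩
    · exact ((Complex.continuous_ofReal.tendsto 1).mono_left nhdsWithin_le_nhds).trans (by simp)
    · filter_upwards [self_mem_nhdsWithin] with s hs
      simpa using hs
  refine hu.frequently (Eventually.frequently ?_)
  filter_upwards [nhdsWithin_le_nhds (lt_mem_nhds (zero_lt_one' ℝ))] with s hs
  exact ⟨s, hs, rfl⟩

/-- Two holomorphic functions on the right half-plane which agree for `κ > 0` agree. -/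
lemma eqOn_rightHalfPlane {f g : ℂ → ℂ} (hf : DifferentiableOn ℂ f rightHalfPlane)
    (hg : DifferentiableOn ℂ g rightHalfPlane) (h : ∀ s : ℝ, 0 < s → f s = g s) :
    Set.EqOn f g rightHalfPlane := by
  refine AnalyticOnNhd.eqOn_of_preconnected_of_frequently_eq
    (hf.analyticOnNhd isOpen_rightHalfPlane) (hg.analyticOnNhd isOpen_rightHalfPlane)
    isPreconnected_rightHalfPlane (z₀ := 1) (by simp [rightHalfPlane]) ?_
  refine frequently_ofReal_pos.mono ?_
  rintro z ⟨s, hs, rfl⟩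
  exact h s hs

/-- Integrals against the free resolvent are holomorphic in `κ = √(-w)`. -/
lemma differentiableOn_integral_gHat {f : Pos d → ℂ} (hf : AEStronglyMeasurable f)
    (hfi : Integrable fun k => (1 + ‖k‖ ^ 2)⁻¹ * ‖f k‖) :
    DifferentiableOn ℂ (fun κ => ∫ k, f k * gHat (-κ ^ 2) k) rightHalfPlane := by
  refine differentiableOn_integral_of_dominated isOpen_rightHalfPlane ?_ ?_ ?_
  · intro κ _
    exact hf.mul (measurable_gHat _).aestronglyMeasurable
  · refine Eventually.of_forall fun k κ hκ => DifferentiableAt.differentiableWithinAt ?_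
    have := symb_sub_ne_zero (sq_mem_slitPlane hκ) k
    unfold gHat
    fun_prop (disch := assumption)
  · intro κ₀ hκ₀
    obtain ⟨C, hC, h⟩ := exists_norm_gHat_le (d := d) (sq_mem_slitPlane hκ₀)
    have hc : ContinuousAt (fun κ : ℂ => -κ ^ 2) κ₀ := by fun_prop
    obtain ⟨ε, hε, hball⟩ := Metric.eventually_nhds_iff_ball.1 (hc.eventually h)
    refine ⟨_, hfi.const_mul C, ε, hε, Eventually.of_forall fun k κ hκ => ?_⟩
    rw [norm_mul, mul_comm, ← mul_assoc]
    gcongr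
    exact hball κ hκ k

theorem integral_schwartz_mul_greenK (hd : d = 1 ∨ d = 2 ∨ d = 3) (φ : 𝓢(Pos d, ℂ)) {κ : ℂ}
    (hκ : κ ∈ rightHalfPlane) :
    ∫ x, φ x * greenK d κ ‖x‖ = ∫ k, (𝓕⁻ φ) k * gHat (-κ ^ 2) k := by
  refine eqOn_rightHalfPlane (f := fun κ => ∫ x, φ x * greenK d κ ‖x‖)
    (g := fun κ => ∫ k, (𝓕⁻ φ) k * gHat (-κ ^ 2) k) ?_ ?_
    (fun s hs => integral_schwartz_mul_greenK_ofReal hd hs φ) hκ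
  · have hne := ae_ne_zero (d := d) (by omega)
    refine differentiableOn_integral_of_dominated isOpen_rightHalfPlane ?_ ?_ ?_
    · intro κ _
      exact φ.continuous.aestronglyMeasurable.mul
        ((measurable_greenK d κ).comp measurable_norm).aestronglyMeasurable
    · filter_upwards [hne] with x hx
      exact (differentiableOn_greenK d (norm_pos_iff.2 hx)).const_mul _
    · intro κ₀ hκ₀
      obtain ⟨C, hC⟩ := exists_norm_schwartz_le φ
      simp only [rightHalfPlane, Set.mem_ofPred_eq] at hκ₀
      refine ⟨_, (integrable_greenK_ofReal hd (κ := κ₀.re / 2) (by positivity)).norm.const_mul C,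
        κ₀.re / 2, by positivity, ?_⟩
      filter_upwards [hne] with x hx κ hκ
      have h1 : κ₀.re / 2 ≤ κ.re := by
        have h2 := (Complex.abs_re_le_norm (κ - κ₀)).trans_lt (mem_ball_iff_norm.1 hκ)
        rw [Complex.sub_re, abs_lt] at h2
        linarith
      rw [norm_mul]
      exact mul_le_mul (hC x) (norm_greenK_le (by positivity) h1 (norm_pos_iff.2 hx))
        (norm_nonneg _) ((norm_nonneg _).trans (hC x))
  · refine differentiableOn_integral_gHat (𝓕⁻ φ).continuous.aestronglyMeasurable ?_
    refine ((𝓕⁻ φ).integrable (μ := volume)).norm.mono' (by fun_prop)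
      (Eventually.of_forall fun k => ?_)
    rw [norm_mul, norm_norm, Real.norm_of_nonneg (by positivity)]
    exact mul_le_of_le_one_left (norm_nonneg _) (inv_le_one_of_one_le₀ (by nlinarith [sq_nonneg ‖k‖]))

/-- The free resolvent kernel `ĝ_w = 1 / (4π²|k|² - w)` in Fourier space, as a vector of `L²`
(zero if it is not square integrable). -/
def gL (d : ℕ) (w : ℂ) : L2 d :=
  open Classical in if h : MemLp (gHat w : Pos d → ℂ) 2 then h.toLp else 0

lemma coeFn_gL (hd : d < 4) {w : ℂ} (hw : -w ∈ Complex.slitPlane) :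
    gL d w =ᵐ[volume] gHat w := by
  unfold gL
  rw [dif_pos (memLp_gHat hd hw)]
  exact MemLp.coeFn_toLp _

/-- The Green function is the inverse Fourier transform of `ĝ_w`. -/
theorem green_ae_eq (hd : d = 1 ∨ d = 2 ∨ d = 3) {w : ℂ} (hw : -w ∈ Complex.slitPlane) :
    (fun x : Pos d => green d w ‖x‖) =ᵐ[volume] (𝓕⁻ (gL d w) : L2 d) := by
  have hκ := kap_mem hw
  simp only [green_eq d hw]
  refine ae_eq_fourierInv_L2 (integrable_greenK hd hκ).locallyIntegrable _ fun φ => ?_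
  rw [integral_schwartz_mul_greenK hd φ hκ, kap_sq, neg_neg]
  refine integral_congr_ae ?_
  filter_upwards [coeFn_gL (by omega) hw] with k hk
  rw [hk]

end GreenComplex

/-! ### The regular values of the Green functions at the origin -/

section RegularValues

open FourierTransform

variable {d : ℕ}

/-- `∫₀^∞ log t e^{-t} dt = -γ`, as both sides are the derivative of the Gamma function at `1`. -/
lemma integral_log_mul_exp_neg :
    IntegrableOn (fun t => Real.log t * Real.exp (-t)) (Set.Ioi 0) ∧
    ∫ t in Set.Ioi 0, Real.log t * Real.exp (-t) = -Real.eulerMascheroniConstant := by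
  have h1 := Complex.hasDerivAt_GammaIntegral (s := 1) (by simp)
  have h2 : HasDerivAt Complex.GammaIntegral (-(Real.eulerMascheroniConstant : ℂ)) 1 := by
    refine Complex.hasDerivAt_Gamma_one.congr_of_eventuallyEq ?_
    filter_upwards [(isOpen_lt continuous_const Complex.continuous_re).mem_nhds
      (show (0 : ℝ) < (1 : ℂ).re by simp)] with s hs
    exact (Complex.Gamma_eq_integral hs).symm
  have h3 := h1.unique h2
  have h4 : ∫ t in Set.Ioi 0, Real.log t * Real.exp (-t) = -Real.eulerMascheroniConstant := by
    apply Complex.ofReal_injective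
    rw [← integral_complex_ofReal, Complex.ofReal_neg, ← h3]
    simp
  -- a non-integrable function would have the integral `0`, but `γ ≠ 0`
  refine ⟨Integrable.of_integral_ne_zero ?_, h4⟩
  rw [h4]
  have := Real.one_half_lt_eulerMascheroniConstant
  linarith [this]

/-- Integration by parts in the exponential integral `∫_b^∞ e^{-s} / s ds`, written in the variable
`s = b e^t`. -/
lemma integral_exp_neg_mul_exp {b : ℝ} (hb : 0 < b) :
    IntegrableOn (fun t => Real.exp (-b * Real.exp t)) (Set.Ioi 0) ∧
    ∫ t in Set.Ioi 0, Real.exp (-b * Real.exp t)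
      = (∫ s in Set.Ioi b, Real.log s * Real.exp (-s)) - Real.log b * Real.exp (-b) := by
  have himg : (fun t => b * Real.exp t) '' Set.Ioi 0 = Set.Ioi b := by
    ext s
    simp only [Set.mem_image, Set.mem_Ioi]
    constructor
    · rintro ⟨t, ht, rfl⟩
      exact lt_mul_of_one_lt_right hb (Real.one_lt_exp_iff.2 ht)
    · intro hs
      have h0 : 0 < s := hb.trans hs
      exact ⟨Real.log (s / b), Real.log_pos ((one_lt_div hb).2 hs), by
        rw [Real.exp_log (by positivity)]; field_simp⟩
  have hd : ∀ x ∈ Set.Ioi (0 : ℝ), HasDerivWithinAt (fun t => b * Real.exp t) (b * Real.exp x)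
      (Set.Ioi 0) x := fun x _ => ((Real.hasDerivAt_exp x).const_mul b).hasDerivWithinAt
  have hinj : Set.InjOn (fun t => b * Real.exp t) (Set.Ioi 0) := fun x _ y _ hxy =>
    Real.exp_injective (mul_left_cancel₀ hb.ne' hxy)
  have hkey : ∀ t : ℝ, |b * Real.exp t| • ((b * Real.exp t)⁻¹ * Real.exp (-(b * Real.exp t)))
      = Real.exp (-b * Real.exp t) := by
    intro t
    have : 0 < b * Real.exp t := by positivity
    rw [abs_of_pos this, smul_eq_mul, mul_inv_cancel_left₀ this.ne', neg_mul]
  have hexp : IntegrableOn (fun s : ℝ => Real.exp (-s)) (Set.Ioi b) := integrableOn_exp_neg_Ioi b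
  have hi1 : IntegrableOn (fun s : ℝ => s⁻¹ * Real.exp (-s)) (Set.Ioi b) := by
    refine Integrable.mono' (hexp.const_mul b⁻¹) (by fun_prop) ?_
    filter_upwards [ae_restrict_mem measurableSet_Ioi] with s hs
    have hs' : b < s := hs
    have h0 : 0 < s := hb.trans hs
    rw [Real.norm_of_nonneg (by positivity)]
    gcongr
  have hi2 : IntegrableOn (fun s : ℝ => Real.log s * Real.exp (-s)) (Set.Ioi b) :=
    integral_log_mul_exp_neg.1.mono_set (Set.Ioi_subset_Ioi hb.le)
  have hI := integrableOn_image_iff_integrableOn_abs_deriv_smul measurableSet_Ioi hd hinj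
    (fun s => s⁻¹ * Real.exp (-s))
  have hE := integral_image_eq_integral_abs_deriv_smul measurableSet_Ioi hd hinj
    (fun s => s⁻¹ * Real.exp (-s))
  simp only [himg, hkey] at hI hE
  refine ⟨hI.1 hi1, ?_⟩
  rw [← hE]
  have hlim : Tendsto (fun s => Real.log s * Real.exp (-s)) atTop (𝓝 0) := by
    have h1 := Real.tendsto_pow_mul_exp_neg_atTop_nhds_zero 1
    refine tendsto_of_tendsto_of_tendsto_of_le_of_le' tendsto_const_nhds h1 ?_ ?_
    · filter_upwards [eventually_ge_atTop 1] with s hs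
      have := Real.log_nonneg hs
      positivity
    · filter_upwards [eventually_ge_atTop 1] with s hs
      rw [pow_one]
      gcongr
      exact Real.log_le_self (by linarith)
  have hder : ∀ x ∈ Set.Ioi b, HasDerivAt (fun s => Real.log s * Real.exp (-s))
      (x⁻¹ * Real.exp (-x) - Real.log x * Real.exp (-x)) x := by
    intro x hx
    have h0 : x ≠ 0 := (hb.trans hx).ne'
    have h1 := (Real.hasDerivAt_log h0).mul ((Real.hasDerivAt_exp (-x)).comp x (hasDerivAt_neg x))
    refine h1.congr_deriv ?_
    simp only [Function.comp]; ring
  have hcont : ContinuousWithinAt (fun s => Real.log s * Real.exp (-s)) (Set.Ici b) b := by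
    refine ContinuousAt.continuousWithinAt ?_
    have := Real.continuousAt_log hb.ne'
    fun_prop
  have h := integral_Ioi_of_hasDerivAt_of_tendsto hcont hder (hi1.sub hi2) hlim
  have h' : (∫ s in Set.Ioi b, s⁻¹ * Real.exp (-s)) - ∫ s in Set.Ioi b, Real.log s * Real.exp (-s)
      = 0 - Real.log b * Real.exp (-b) := (integral_sub hi1 hi2).symm.trans h
  linarith

/-- The logarithmic behaviour of the Bessel function `2 K₀(a) = ∫ exp (-a cosh t) dt` at the
origin. -/
lemma tendsto_integral_exp_neg_cosh :
    Tendsto (fun a : ℝ => (∫ t, Real.exp (-a * Real.cosh t)) + 2 * Real.log (a / 2)) (𝓝[>] 0)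
      (𝓝 (-(2 * Real.eulerMascheroniConstant))) := by
  -- replacing `a cosh t` by `(a / 2) e^t` changes the integral over `t > 0` by at most `a / 2`
  have hdiff : ∀ a : ℝ, 0 < a → |(∫ t in Set.Ioi 0, Real.exp (-a * Real.cosh t)) -
      ∫ t in Set.Ioi 0, Real.exp (-(a / 2) * Real.exp t)| ≤ a / 2 := by
    intro a ha
    have h1 := (integral_exp_neg_mul_exp (b := a / 2) (by positivity)).1
    have h2 : IntegrableOn (fun t => Real.exp (-a * Real.cosh t)) (Set.Ioi 0) :=
      (integrable_exp_neg_cosh ha).integrableOn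
    rw [← integral_sub h2 h1, ← Real.norm_eq_abs]
    have h3 : IntegrableOn (fun t : ℝ => a / 2 * Real.exp (-t)) (Set.Ioi 0) :=
      (integrableOn_exp_neg_Ioi 0).const_mul _
    refine (norm_integral_le_of_norm_le h3 ?_).trans (le_of_eq ?_)
    · filter_upwards with t
      have e1 : Real.exp (-a * Real.cosh t)
          = Real.exp (-(a / 2) * Real.exp t) * Real.exp (-(a / 2 * Real.exp (-t))) := by
        rw [← Real.exp_add, Real.cosh_eq]; congr 1; ring
      have e2 : Real.exp (-(a / 2) * Real.exp t) ≤ 1 :=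
        Real.exp_le_one_iff.2 (by have := Real.exp_pos t; nlinarith)
      have e3 : 1 - a / 2 * Real.exp (-t) ≤ Real.exp (-(a / 2 * Real.exp (-t))) := by
        linarith [Real.add_one_le_exp (-(a / 2 * Real.exp (-t)))]
      have e4 : Real.exp (-(a / 2 * Real.exp (-t))) ≤ 1 := Real.exp_le_one_iff.2 (by
        have := Real.exp_pos (-t); nlinarith)
      have e5 := Real.exp_pos (-(a / 2) * Real.exp t)
      rw [e1, Real.norm_eq_abs, abs_le]
      have e6 : 0 ≤ a / 2 * Real.exp (-t) := by positivity
      constructor <;> nlinarith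
    · rw [integral_const_mul, integral_exp_neg_Ioi_zero, mul_one]
  have hrep : ∀ a : ℝ, 0 < a → (∫ t, Real.exp (-a * Real.cosh t)) + 2 * Real.log (a / 2)
      = 2 * ((∫ t in Set.Ioi 0, Real.exp (-a * Real.cosh t)) -
          ∫ t in Set.Ioi 0, Real.exp (-(a / 2) * Real.exp t))
        + 2 * (∫ s in Set.Ioi (a / 2), Real.log s * Real.exp (-s))
        + 2 * (Real.log (a / 2) * (1 - Real.exp (-(a / 2)))) := by
    intro a ha
    have h1 : ∫ t, Real.exp (-a * Real.cosh t) = 2 * ∫ t in Set.Ioi 0, Real.exp (-a * Real.cosh t) := by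
      rw [← integral_comp_abs (f := fun t => Real.exp (-a * Real.cosh t))]
      simp only [Real.cosh_abs]
    rw [h1, (integral_exp_neg_mul_exp (b := a / 2) (by positivity)).2]
    ring
  have hhalf : Tendsto (fun a : ℝ => a / 2) (𝓝[>] 0) (𝓝[>] 0) := by
    refine tendsto_nhdsWithin_iff.2 ⟨?_, ?_⟩
    · have : Tendsto (fun a : ℝ => a / 2) (𝓝 0) (𝓝 (0 / 2)) := tendsto_id.div_const 2
      rw [zero_div] at this
      exact this.mono_left nhdsWithin_le_nhds
    · filter_upwards [self_mem_nhdsWithin] with a ha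
      exact half_pos (Set.mem_Ioi.1 ha)
  have l1 : Tendsto (fun a : ℝ => (∫ t in Set.Ioi 0, Real.exp (-a * Real.cosh t)) -
          ∫ t in Set.Ioi 0, Real.exp (-(a / 2) * Real.exp t)) (𝓝[>] 0) (𝓝 0) := by
    refine squeeze_zero_norm' ?_ (hhalf.mono_right nhdsWithin_le_nhds)
    filter_upwards [self_mem_nhdsWithin] with a ha
    exact hdiff a ha
  have l2 : Tendsto (fun b : ℝ => ∫ s in Set.Ioi b, Real.log s * Real.exp (-s)) (𝓝[>] 0)
      (𝓝 (-Real.eulerMascheroniConstant)) := by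
    rw [← integral_log_mul_exp_neg.2]
    have hc : AECover (volume.restrict (Set.Ioi (0 : ℝ))) (𝓝[>] 0) fun b : ℝ => Set.Ioi b :=
      aecover_Ioi_of_Ioi (tendsto_id.mono_left nhdsWithin_le_nhds)
    refine (hc.integral_tendsto_of_countably_generated integral_log_mul_exp_neg.1).congr' ?_
    filter_upwards [self_mem_nhdsWithin] with b hb
    rw [Measure.restrict_restrict measurableSet_Ioi,
      Set.inter_eq_left.2 (Set.Ioi_subset_Ioi (le_of_lt hb))]
  have l3 : Tendsto (fun b : ℝ => Real.log b * (1 - Real.exp (-b))) (𝓝[>] 0) (𝓝 0) := by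
    have h1 : Tendsto (fun b : ℝ => Real.log b * b) (𝓝[>] 0) (𝓝 0) := by
      simpa only [Real.rpow_one] using tendsto_log_mul_rpow_nhdsGT_zero zero_lt_one
    refine squeeze_zero_norm' ?_ (tendsto_norm_zero.comp h1)
    filter_upwards [self_mem_nhdsWithin] with b hb
    simp only [Function.comp, norm_mul]
    gcongr
    have hb' : 0 < b := hb
    rw [Real.norm_of_nonneg (by linarith [Real.exp_le_one_iff.2 (by linarith : -b ≤ 0)]),
      Real.norm_of_nonneg hb'.le]
    linarith [Real.add_one_le_exp (-b)]
  have hsum := ((l1.const_mul 2).add ((l2.comp hhalf).const_mul 2)).add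
    ((l3.comp hhalf).const_mul 2)
  rw [show -(2 * Real.eulerMascheroniConstant)
    = 2 * 0 + 2 * -Real.eulerMascheroniConstant + 2 * 0 by ring]
  refine hsum.congr' ?_
  filter_upwards [self_mem_nhdsWithin] with a ha
  exact (hrep a ha).symm

/-- The regular value of the Green function at the origin, as a function of `κ = √(-w)`
(zero, like the Green function, outside the dimensions one, two and three). -/
def regK (d : ℕ) (κ : ℂ) : ℂ :=
  match d with
  | 1 => 1 / (2 * κ)
  | 2 => -(Complex.log (κ / 2) + Real.eulerMascheroniConstant) / (2 * Real.pi)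
  | 3 => -κ / (4 * Real.pi)
  | _ => 0

/-- The regular value of `G^w` at the origin. -/
def regVal (d : ℕ) (w : ℂ) : ℂ := regK d (kap w)

lemma half_mem_slitPlane {κ : ℂ} (hκ : κ ∈ rightHalfPlane) : κ / 2 ∈ Complex.slitPlane := by
  refine Complex.mem_slitPlane_iff.2 (Or.inl ?_)
  have : 0 < κ.re := hκ
  rw [show κ / 2 = κ * ((1 / 2 : ℝ) : ℂ) by push_cast; ring, Complex.re_mul_ofReal]
  linarith

lemma differentiableOn_regK (d : ℕ) : DifferentiableOn ℂ (regK d) rightHalfPlane := by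
  unfold regK
  split
  · intro κ hκ
    have := ne_zero_of_mem_rightHalfPlane hκ
    exact DifferentiableAt.differentiableWithinAt (by fun_prop (disch := simpa using this))
  · intro κ hκ
    have := half_mem_slitPlane hκ
    exact DifferentiableAt.differentiableWithinAt (by fun_prop (disch := assumption))
  · fun_prop
  · fun_prop

lemma differentiableAt_regVal {w : ℂ} (hw : -w ∈ Complex.slitPlane) :
    DifferentiableAt ℂ (regVal d) w :=
  ((differentiableOn_regK d).differentiableAt
    (isOpen_rightHalfPlane.mem_nhds (kap_mem hw))).comp w (differentiableAt_kap hw)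

lemma conj_regVal (d : ℕ) {w : ℂ} (hw : -w ∈ Complex.slitPlane) :
    (starRingEnd ℂ) (regVal d w) = regVal d ((starRingEnd ℂ) w) := by
  have h2 := conj_kap hw
  have h3 := (Complex.mem_slitPlane_iff_arg.1 (half_mem_slitPlane (kap_mem hw))).1
  have h4 : (starRingEnd ℂ) (Complex.log (kap w / 2)) = Complex.log (kap ((starRingEnd ℂ) w) / 2) := by
    rw [← h2, ← Complex.log_conj _ h3, map_div₀, map_ofNat]
  unfold regVal regK
  split <;> simp [h2, h4, map_ofNat]

/-- The Green function minus its leading singularity tends to the regular value. -/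
theorem tendsto_greenK_sub (hd : d = 1 ∨ d = 2 ∨ d = 3) {κ : ℝ} (hκ : 0 < κ) :
    Tendsto (fun r : ℝ => greenK d κ r - singularPart d r) (𝓝[>] 0) (𝓝 (regK d κ)) := by
  have hκ0 : (κ : ℂ) ≠ 0 := by exact_mod_cast hκ.ne'
  have hπ : (Real.pi : ℂ) ≠ 0 := by exact_mod_cast Real.pi_ne_zero
  rcases hd with rfl | rfl | rfl
  · simp only [greenK, singularPart, regK, sub_zero]
    have h : ContinuousAt (fun r : ℝ => Complex.exp (-κ * r) / (2 * κ)) 0 := by fun_prop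
    have := h.tendsto
    simp only [Complex.ofReal_zero, mul_zero, Complex.exp_zero] at this
    exact this.mono_left nhdsWithin_le_nhds
  · have hs : Tendsto (fun r : ℝ => κ * r) (𝓝[>] 0) (𝓝[>] 0) := by
      refine tendsto_nhdsWithin_iff.2 ⟨?_, ?_⟩
      · have : Tendsto (fun r : ℝ => κ * r) (𝓝 0) (𝓝 (κ * 0)) := tendsto_id.const_mul κ
        rw [mul_zero] at this
        exact this.mono_left nhdsWithin_le_nhds
      · filter_upwards [self_mem_nhdsWithin] with a ha
        exact mul_pos hκ ha
    have h1 := ((tendsto_integral_exp_neg_cosh.comp hs).sub_const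
      (2 * Real.log (κ / 2))).const_mul (4 * Real.pi)⁻¹
    have h2 := (Complex.continuous_ofReal.tendsto _).comp h1
    have e : ((((4 * Real.pi)⁻¹ * (-(2 * Real.eulerMascheroniConstant) - 2 * Real.log (κ / 2)) : ℝ)) : ℂ)
        = regK 2 κ := by
      simp only [regK]
      rw [show (κ : ℂ) / 2 = ((κ / 2 : ℝ) : ℂ) by push_cast; rfl, ← Complex.ofReal_log (by positivity)]
      push_cast
      field_simp
      ring
    rw [e] at h2
    refine h2.congr' ?_
    filter_upwards [self_mem_nhdsWithin] with r hr
    have hr' : 0 < r := hr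
    have e1 : ∀ t : ℝ, -(κ : ℂ) * r * (Real.cosh t : ℂ) = ((-(κ * r) * Real.cosh t : ℝ) : ℂ) :=
      fun t => by push_cast; ring
    simp only [greenK, singularPart, Function.comp, e1, ← Complex.ofReal_exp]
    rw [integral_complex_ofReal, show κ * r / 2 = κ / 2 * r by ring,
      Real.log_mul (by positivity) (by positivity)]
    push_cast
    field_simp
    ring
  · simp only [greenK, singularPart, regK]
    -- `(e^{-κ r} - 1) / r` is the difference quotient of the exponential at the origin
    have h1 : HasDerivAt (fun r : ℝ => Complex.exp (-κ * r)) (-κ) 0 := by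
      have h2 : HasDerivAt (fun r : ℝ => -(κ : ℂ) * (r : ℂ)) (-κ * 1) 0 :=
        (Complex.ofRealCLM.hasDerivAt (x := 0)).const_mul _
      have := h2.cexp
      simpa using this
    have h3 := (hasDerivAt_iff_tendsto_slope.1 h1).mono_left
      (nhdsWithin_mono (0 : ℝ) (fun x (hx : x ∈ Set.Ioi 0) => ne_of_gt hx))
    refine (h3.div_const (4 * Real.pi : ℂ)).congr' ?_
    filter_upwards [self_mem_nhdsWithin] with r hr
    have hr' : (r : ℂ) ≠ 0 := by exact_mod_cast (ne_of_gt hr)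
    rw [slope_def_module]
    simp
    field_simp

lemma tendsto_norm_punctured : Tendsto (fun x : Pos d => ‖x‖) (𝓝[≠] 0) (𝓝[>] 0) := by
  refine tendsto_nhdsWithin_iff.2 ⟨?_, ?_⟩
  · exact tendsto_norm_zero.mono_left nhdsWithin_le_nhds
  · filter_upwards [self_mem_nhdsWithin] with x hx
    exact norm_pos_iff.2 hx

lemma HasRegularValue.add {ψ ψ' : L2 d} {q q' f f' : ℂ} (h : HasRegularValue d ψ q f)
    (h' : HasRegularValue d ψ' q' f') : HasRegularValue d (ψ + ψ') (q + q') (f + f') := by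
  obtain ⟨g, hg, ht⟩ := h
  obtain ⟨g', hg', ht'⟩ := h'
  refine ⟨g + g', (hg.add hg').trans (Lp.coeFn_add _ _).symm, (ht.add ht').congr fun x => ?_⟩
  simp only [Pi.add_apply]; ring

lemma HasRegularValue.smul {ψ : L2 d} {q f : ℂ} (h : HasRegularValue d ψ q f) (c : ℂ) :
    HasRegularValue d (c • ψ) (c * q) (c * f) := by
  obtain ⟨g, hg, ht⟩ := h
  refine ⟨c • g, (hg.const_smul c).trans (Lp.coeFn_smul _ _).symm, (ht.const_mul c).congr fun x => ?_⟩
  simp only [Pi.smul_apply, smul_eq_mul]; ring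

/-- Two almost everywhere equal functions cannot have different limits at the origin, as punctured
balls have positive measure. -/
lemma HasRegularValue.unique (hd : 0 < d) {ψ : L2 d} {q f f' : ℂ} (h : HasRegularValue d ψ q f)
    (h' : HasRegularValue d ψ q f') : f = f' := by
  obtain ⟨g, hg, ht⟩ := h
  obtain ⟨g', hg', ht'⟩ := h'
  have he : g =ᵐ[volume] g' := hg.trans hg'.symm
  have hfreq : ∃ᶠ x in 𝓝[≠] (0 : Pos d), g x = g' x := by
    intro hcon
    have h0 : {x : Pos d | ¬ ¬ g x = g' x} ∈ ae volume := by simpa using! he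
    have h1 : ∀ᶠ x in 𝓝 (0 : Pos d), x ∈ ({0}ᶜ : Set (Pos d)) → ¬ g x = g' x :=
      eventually_nhdsWithin_iff.1 hcon
    obtain ⟨U, hU, hUo, h0U⟩ := eventually_nhds_iff.1 h1
    have h2 : volume U = 0 := by
      rw [measure_eq_zero_iff_ae_notMem]
      filter_upwards [he, ae_ne_zero hd] with x hx hx0 hxU
      exact hU x hxU hx0 hx
    exact (hUo.measure_pos volume ⟨0, h0U⟩).ne' h2
  have hsub : Tendsto (fun x => g x - g' x) (𝓝[≠] (0 : Pos d)) (𝓝 (f - f')) :=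
    (ht.sub ht').congr fun x => by ring
  by_contra hne
  have := hsub.eventually_ne (sub_ne_zero.2 hne)
  exact hfreq (this.mono fun x hx => sub_ne_zero.1 hx)

lemma hasRegularValue_of_integrable (u : L2 d) (hu : Integrable (𝓕 u : L2 d)) :
    HasRegularValue d u 0 (∫ k, (𝓕 u : L2 d) k) := by
  refine ⟨_, (ae_eq_fourierInv u hu).symm, ?_⟩
  simp only [zero_mul, sub_zero]
  rw [← fourierInv_zero]
  exact ((continuous_fourierInv hu).tendsto 0).mono_left nhdsWithin_le_nhds

lemma integrable_gHat_mul_gHat (hd : d < 4) {w w' : ℂ} (hw : -w ∈ Complex.slitPlane)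
    (hw' : -w' ∈ Complex.slitPlane) : Integrable fun k : Pos d => gHat w k * gHat w' k :=
  (memLp_gHat hd hw).integrable_mul (memLp_gHat hd hw')

lemma gHat_sub {w w' : ℂ} (hw : -w ∈ Complex.slitPlane) (hw' : -w' ∈ Complex.slitPlane)
    (k : Pos d) : gHat w k - gHat w' k = (w - w') * (gHat w k * gHat w' k) := by
  have h1 := symb_sub_ne_zero hw k
  have h2 := symb_sub_ne_zero hw' k
  unfold gHat
  field_simp
  ring

/-- Moving the spectral parameter of the Green function changes its regular value by an absolutely
convergent integral. -/
lemma hasRegularValue_gL_of (hd : d < 4) {w w' f : ℂ} (hw : -w ∈ Complex.slitPlane)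
    (hw' : -w' ∈ Complex.slitPlane) (h : HasRegularValue d (𝓕⁻ (gL d w')) 1 f) :
    HasRegularValue d (𝓕⁻ (gL d w)) 1 (f + (w - w') * ∫ k : Pos d, gHat w' k * gHat w k) := by
  set u : L2 d := 𝓕⁻ (gL d w) - 𝓕⁻ (gL d w') with hu
  have hFu : (𝓕 u : L2 d) =ᵐ[volume] fun k => (w - w') * (gHat w' k * gHat w k) := by
    have h1 : (𝓕 u : L2 d) = gL d w - gL d w' := by
      rw [hu, sub_eq_add_neg, ← neg_one_smul ℂ, FourierTransform.fourier_add,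
        FourierTransform.fourier_smul, FourierTransform.fourier_fourierInv_eq,
        FourierTransform.fourier_fourierInv_eq, neg_one_smul, ← sub_eq_add_neg]
    rw [h1]
    filter_upwards [Lp.coeFn_sub (gL d w) (gL d w'), coeFn_gL hd hw, coeFn_gL hd hw'] with k h1 h2 h3
    rw [h1, Pi.sub_apply, h2, h3, gHat_sub hw hw']
    ring
  have hi := (integrable_gHat_mul_gHat hd hw' hw).const_mul (w - w')
  have h2 := hasRegularValue_of_integrable u (hi.congr hFu.symm)
  rw [integral_congr_ae hFu, integral_const_mul] at h2
  have h3 := h.add h2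
  rw [hu, add_sub_cancel, add_zero] at h3
  exact h3

lemma hasRegularValue_gL_real (hd : d = 1 ∨ d = 2 ∨ d = 3) {κ : ℝ} (hκ : 0 < κ) :
    HasRegularValue d (𝓕⁻ (gL d (-(κ : ℂ) ^ 2))) 1 (regK d κ) := by
  have hκ' : (κ : ℂ) ∈ rightHalfPlane := by simpa [rightHalfPlane] using hκ
  have hw := sq_mem_slitPlane hκ'
  refine ⟨_, green_ae_eq hd hw, ?_⟩
  simp only [green_eq d hw, kap_eq hκ', one_mul]
  exact (tendsto_greenK_sub hd hκ).comp tendsto_norm_punctured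

/-- The Nevanlinna identity with base point `κ = 1`. -/
lemma regK_eq (hd : d = 1 ∨ d = 2 ∨ d = 3) {κ : ℂ} (hκ : κ ∈ rightHalfPlane) :
    regK d κ = regK d 1 + (-κ ^ 2 - -1 ^ 2) * ∫ k : Pos d, gHat (-1 ^ 2) k * gHat (-κ ^ 2) k := by
  have h1 : (1 : ℂ) ∈ rightHalfPlane := by simp [rightHalfPlane]
  have hw1 := sq_mem_slitPlane h1
  refine eqOn_rightHalfPlane (f := regK d) (g := fun κ => regK d 1 +
    (-κ ^ 2 - -1 ^ 2) * ∫ k : Pos d, gHat (-1 ^ 2) k * gHat (-κ ^ 2) k) (differentiableOn_regK d)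
    ?_ (fun s hs => ?_) hκ
  · refine DifferentiableOn.const_add _ (DifferentiableOn.mul (by fun_prop) ?_)
    refine differentiableOn_integral_gHat (measurable_gHat _).aestronglyMeasurable ?_
    exact (memLp_japanese (by omega)).integrable_mul (memLp_gHat (by omega) hw1).norm
  · have hs' : (s : ℂ) ∈ rightHalfPlane := by simpa [rightHalfPlane] using hs
    have h2 := hasRegularValue_gL_real hd (κ := 1) one_pos
    rw [Complex.ofReal_one] at h2
    have h3 := hasRegularValue_gL_of (by omega) (sq_mem_slitPlane hs') hw1 h2
    exact (hasRegularValue_gL_real hd hs).unique (by omega) h3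

theorem hasRegularValue_gL (hd : d = 1 ∨ d = 2 ∨ d = 3) {w : ℂ} (hw : -w ∈ Complex.slitPlane) :
    HasRegularValue d (𝓕⁻ (gL d w)) 1 (regVal d w) := by
  have h1 : (1 : ℂ) ∈ rightHalfPlane := by simp [rightHalfPlane]
  have h2 := hasRegularValue_gL_real hd (κ := 1) one_pos
  rw [Complex.ofReal_one] at h2
  have h3 := hasRegularValue_gL_of (by omega) hw (sq_mem_slitPlane h1) h2
  have h4 := regK_eq hd (kap_mem hw)
  rw [kap_sq, neg_neg] at h4
  unfold regVal
  rwa [h4]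

/-- The regular value is a Nevanlinna function of the spectral parameter. -/
theorem regVal_sub (hd : d = 1 ∨ d = 2 ∨ d = 3) {w w' : ℂ} (hw : -w ∈ Complex.slitPlane)
    (hw' : -w' ∈ Complex.slitPlane) :
    regVal d w - regVal d w' = (w - w') * ∫ k : Pos d, gHat w' k * gHat w k := by
  have h := (hasRegularValue_gL hd hw).unique (by omega)
    (hasRegularValue_gL_of (by omega) hw hw' (hasRegularValue_gL hd hw'))
  rw [h]; ring

end RegularValues

/-! ### One channel of the point interaction, in Fourier space -/

section Channel

open FourierTransform
open scoped ComplexConjugate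

variable {d : ℕ} {a c : ℝ}

/-- The denominator in Krein's formula for the boundary condition `a q = c f`. -/
def kreinD (d : ℕ) (a c : ℝ) (w : ℂ) : ℂ := a - c * regVal d w

/-- `(ψ, φ)` lies in the graph of the point interaction with boundary condition `a q = c f`, with
charge `q`, everything being written in Fourier space: `φ = 4π²|k|² ψ - q`, and the regular value
`f` is the sum of `∫ (ψ - q ĝ_w)` and `q` times the regular value of `G^w`. -/
def IsChan (d : ℕ) (a c : ℝ) (w : ℂ) (ψ φ : L2 d) (q : ℂ) : Prop :=
  (φ =ᵐ[volume] fun k => symb k * ψ k - q) ∧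
    kreinD d a c w * q = c * ∫ k, (ψ k - q * gHat w k)

lemma conj_mem_slitPlane {w : ℂ} (hw : -w ∈ Complex.slitPlane) : -(conj w) ∈ Complex.slitPlane := by
  rw [Complex.mem_slitPlane_iff] at hw ⊢
  simpa using hw

lemma mem_slitPlane_of_im_ne_zero {w : ℂ} (hw : w.im ≠ 0) : -w ∈ Complex.slitPlane :=
  Complex.mem_slitPlane_iff.2 (Or.inr (by simpa using hw))

lemma mem_slitPlane_of_neg {x : ℝ} (hx : x < 0) : -(x : ℂ) ∈ Complex.slitPlane :=
  Complex.mem_slitPlane_iff.2 (Or.inl (by simpa using hx))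

lemma conj_kreinD {w : ℂ} (hw : -w ∈ Complex.slitPlane) :
    conj (kreinD d a c w) = kreinD d a c (conj w) := by
  simp [kreinD, conj_regVal d hw]

lemma measure_univ_pos : 0 < volume (Set.univ : Set (Pos d)) :=
  isOpen_univ.measure_pos volume Set.univ_nonempty

lemma integral_gHat_mul_gHat_ne_zero (hd : d < 4) {w w' : ℂ} (hw : -w ∈ Complex.slitPlane)
    (hw' : -w' ∈ Complex.slitPlane) {g : Pos d → ℝ} (hg : ∀ k, gHat w' k * gHat w k = g k)
    (hpos : ∀ k, 0 < g k) : ∫ k : Pos d, gHat w' k * gHat w k ≠ 0 := by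
  have hi : Integrable g := by
    have := (integrable_gHat_mul_gHat hd hw' hw).re
    simpa only [hg, RCLike.re_to_complex, Complex.ofReal_re] using this
  simp only [hg]
  rw [integral_complex_ofReal]
  refine Complex.ofReal_ne_zero.2 (ne_of_gt ?_)
  refine (integral_pos_iff_support_of_nonneg (fun k => (hpos k).le) hi).2 ?_
  have : Function.support g = Set.univ := by
    ext k; simpa using (hpos k).ne'
  rw [this]
  exact measure_univ_pos

/-- At a nonreal point the imaginary part is a nonzero multiple of `∫ |ĝ_w|²`. -/
lemma regVal_im_ne_zero (hd : d = 1 ∨ d = 2 ∨ d = 3) {w : ℂ} (hw : w.im ≠ 0) :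
    (regVal d w).im ≠ 0 := by
  have h1 := mem_slitPlane_of_im_ne_zero hw
  have h2 := conj_mem_slitPlane h1
  intro h0
  have h := regVal_sub hd h1 h2
  rw [← conj_regVal d h1, Complex.conj_eq_iff_im.2 h0, sub_self] at h
  rcases mul_eq_zero.1 h.symm with h3 | h3
  · have := congrArg Complex.im h3
    simp at this
    exact hw (by linarith)
  · refine integral_gHat_mul_gHat_ne_zero (by omega) h1 h2 (g := fun k => ‖gHat w k‖ ^ 2)
      (fun k => ?_) (fun k => ?_) h3
    · rw [← conj_gHat, Complex.conj_mul']; push_cast; rfl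
    · have := inv_ne_zero (symb_sub_ne_zero h1 k)
      have : 0 < ‖gHat w k‖ := norm_pos_iff.2 this
      positivity

lemma kreinD_ne_zero_of_im_ne_zero (hd : d = 1 ∨ d = 2 ∨ d = 3) (hac : a ≠ 0 ∨ c ≠ 0) {w : ℂ}
    (hw : w.im ≠ 0) : kreinD d a c w ≠ 0 := by
  intro h
  have h1 := regVal_im_ne_zero hd hw
  have h2 := congrArg Complex.im h
  simp [kreinD, h1] at h2
  rcases hac with h3 | h3
  · simp [kreinD, h2, h3] at h
  · exact h3 h2

lemma regVal_injOn_neg (hd : d = 1 ∨ d = 2 ∨ d = 3) {x y : ℝ} (hx : x < 0) (hy : y < 0)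
    (h : regVal d x = regVal d y) : x = y := by
  by_contra hne
  have h1 := mem_slitPlane_of_neg hx
  have h2 := mem_slitPlane_of_neg hy
  have h3 := regVal_sub hd h1 h2
  rw [h, sub_self] at h3
  rcases mul_eq_zero.1 h3.symm with h4 | h4
  · exact hne (by exact_mod_cast sub_eq_zero.1 h4)
  · refine integral_gHat_mul_gHat_ne_zero (by omega) h1 h2
      (g := fun k => (symb k - y)⁻¹ * (symb k - x)⁻¹) (fun k => ?_) (fun k => ?_) h4
    · simp [gHat]
    · have := symb_nonneg k
      exact mul_pos (inv_pos.2 (by linarith)) (inv_pos.2 (by linarith))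

lemma exists_neg_kreinD_ne_zero (hd : d = 1 ∨ d = 2 ∨ d = 3) (hac : a ≠ 0 ∨ c ≠ 0) :
    ∀ M : ℝ, ∃ x : ℝ, x < M ∧ x < 0 ∧ kreinD d a c x ≠ 0 := by
  intro M
  by_contra! h
  set m := min M 0
  have h1 := h (m - 1) (by linarith [min_le_left M 0]) (by linarith [min_le_right M 0])
  have h2 := h (m - 2) (by linarith [min_le_left M 0]) (by linarith [min_le_right M 0])
  simp only [kreinD, sub_eq_zero] at h1 h2
  by_cases hc : c = 0
  · rw [hc] at h1
    simp at h1
    rcases hac with h3 | h3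
    · exact h3 h1
    · exact h3 hc
  · have h3 : regVal d ((m - 1 : ℝ) : ℂ) = regVal d ((m - 2 : ℝ) : ℂ) :=
      mul_left_cancel₀ (Complex.ofReal_ne_zero.2 hc) (h1.symm.trans h2)
    have := regVal_injOn_neg hd (by linarith [min_le_right M 0])
      (by linarith [min_le_right M 0]) h3
    linarith

/-- Multiplication by `ĝ_w` on `L²`. -/
def mulG (d : ℕ) (w : ℂ) : L2 d →L[ℂ] L2 d :=
  open Classical in
  if h : MemLp (gHat w : Pos d → ℂ) ⊤ then
    (ContinuousLinearMap.mul ℂ ℂ).holderL volume ⊤ 2 2 h.toLp else 0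

lemma coeFn_mulG {w : ℂ} (hw : -w ∈ Complex.slitPlane) (f : L2 d) :
    mulG d w f =ᵐ[volume] fun k => gHat w k * f k := by
  unfold mulG
  rw [dif_pos (memLp_top_gHat hw)]
  filter_upwards [(ContinuousLinearMap.mul ℂ ℂ).coeFn_holder (r := 2)
    (memLp_top_gHat (d := d) hw).toLp f, MemLp.coeFn_toLp (memLp_top_gHat (d := d) hw)] with k h1 h2
  refine Eq.trans h1 ?_
  rw [ContinuousLinearMap.mul_apply', h2]

lemma inner_gL (hd : d < 4) {w : ℂ} (hw : -w ∈ Complex.slitPlane) (f : L2 d) :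
    inner ℂ (gL d (conj w)) f = ∫ k, gHat w k * f k := by
  rw [L2.inner_def]
  refine integral_congr_ae ?_
  filter_upwards [coeFn_gL hd (conj_mem_slitPlane hw)] with k hk
  rw [hk, RCLike.inner_apply, conj_gHat, Complex.conj_conj, mul_comm]

lemma inner_mulG {w : ℂ} (hw : -w ∈ Complex.slitPlane) (f g : L2 d) :
    inner ℂ (mulG d w f) g = inner ℂ f (mulG d (conj w) g) := by
  rw [L2.inner_def, L2.inner_def]
  refine integral_congr_ae ?_
  filter_upwards [coeFn_mulG hw f, coeFn_mulG (conj_mem_slitPlane hw) g] with k h1 h2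
  rw [h1, h2, RCLike.inner_apply, RCLike.inner_apply, map_mul, conj_gHat]
  ring

/-- Krein's formula for the resolvent of the point interaction, in Fourier space. -/
def kreinR (d : ℕ) (a c : ℝ) (w : ℂ) : L2 d →L[ℂ] L2 d :=
  mulG d w + (c / kreinD d a c w) • (innerSL ℂ (gL d (conj w))).smulRight (gL d w)

lemma kreinR_apply (w : ℂ) (f : L2 d) : kreinR d a c w f
    = mulG d w f + (c / kreinD d a c w * inner ℂ (gL d (conj w)) f) • gL d w := by
  simp [kreinR, smul_smul]

lemma coeFn_kreinR (hd : d < 4) {w : ℂ} (hw : -w ∈ Complex.slitPlane) (f : L2 d) :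
    kreinR d a c w f =ᵐ[volume] fun k =>
      gHat w k * (f k + c / kreinD d a c w * ∫ k, gHat w k * f k) := by
  rw [kreinR_apply, inner_gL hd hw]
  filter_upwards [Lp.coeFn_add (mulG d w f)
    ((c / kreinD d a c w * ∫ k, gHat w k * f k) • gL d w), coeFn_mulG hw f, coeFn_gL hd hw,
    Lp.coeFn_smul (c / kreinD d a c w * ∫ k, gHat w k * f k) (gL d w)] with k h1 h2 h3 h4
  rw [h1, Pi.add_apply, h4, Pi.smul_apply, h2, h3, smul_eq_mul]
  ring

lemma IsChan.ae_eq {w w' : ℂ} (hw : -w ∈ Complex.slitPlane) {ψ φ : L2 d} {q : ℂ}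
    (h : IsChan d a c w' ψ φ q) :
    (fun k => ψ k - q * gHat w k) =ᵐ[volume] fun k => gHat w k * (φ - w • ψ : L2 d) k := by
  filter_upwards [h.1, Lp.coeFn_sub φ (w • ψ), Lp.coeFn_smul w ψ] with k h1 h2 h3
  rw [h2, Pi.sub_apply, h3, Pi.smul_apply, h1, smul_eq_mul]
  have := symb_sub_ne_zero hw k
  unfold gHat
  field_simp
  ring

/-- The description of the graph does not depend on the auxiliary spectral parameter. -/
lemma IsChan.change (hd : d = 1 ∨ d = 2 ∨ d = 3) {w w' : ℂ} (hw : -w ∈ Complex.slitPlane)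
    (hw' : -w' ∈ Complex.slitPlane) {ψ φ : L2 d} {q : ℂ} (h : IsChan d a c w ψ φ q) :
    IsChan d a c w' ψ φ q := by
  refine ⟨h.1, ?_⟩
  have hd4 : d < 4 := by omega
  have h1 : Integrable fun k => ψ k - q * gHat w k :=
    (integrable_gHat_mul hd4 hw _).congr (h.ae_eq hw).symm
  have h2 : Integrable fun k : Pos d => q * (gHat w k - gHat w' k) := by
    simp only [gHat_sub hw hw']
    exact ((integrable_gHat_mul_gHat hd4 hw hw').const_mul _).const_mul _
  have h3 : ∫ k, (ψ k - q * gHat w' k) = (∫ k, (ψ k - q * gHat w k))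
      + ∫ k : Pos d, q * (gHat w k - gHat w' k) := by
    rw [← integral_add h1 h2]
    congr 1; ext k; ring
  have h4 : ∫ k : Pos d, q * (gHat w k - gHat w' k) = q * (regVal d w - regVal d w') := by
    rw [regVal_sub hd hw hw', integral_const_mul]
    simp only [gHat_sub hw hw']
    rw [integral_const_mul]
    simp only [mul_comm (gHat w' _)]
  have h5 := h.2
  rw [h3, h4, mul_add, ← h5]
  simp only [kreinD]
  ring

/-- The graph of the point interaction, in Fourier space, with the base point `w = -1`. The
integrability follows from the other conditions; it is included for the sake of additivity. -/
def chanGraph (d : ℕ) (a c : ℝ) : Submodule ℂ (L2 d × L2 d) where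
  carrier := {p | ∃ q, IsChan d a c (-1) p.1 p.2 q ∧ Integrable fun k => p.1 k - q * gHat (-1) k}
  zero_mem' := by
    refine ⟨0, ⟨?_, ?_⟩, ?_⟩
    · filter_upwards [Lp.coeFn_zero ℂ 2 (volume : Measure (Pos d))] with k hk
      simp only [Prod.fst_zero, Prod.snd_zero, hk]
      simp
    · rw [integral_congr_ae (g := fun _ => 0)]
      · simp
      · filter_upwards [Lp.coeFn_zero ℂ 2 (volume : Measure (Pos d))] with k hk
        simp only [Prod.fst_zero, hk]
        simp
    · refine (integrable_zero _ _ _).congr ?_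
      filter_upwards [Lp.coeFn_zero ℂ 2 (volume : Measure (Pos d))] with k hk
      simp only [Prod.fst_zero, hk]
      simp
  add_mem' := by
    rintro p p' ⟨q, ⟨h1, h2⟩, h3⟩ ⟨q', ⟨h1', h2'⟩, h3'⟩
    have he : (fun k => (p + p').1 k - (q + q') * gHat (-1) k) =ᵐ[volume]
        fun k => (p.1 k - q * gHat (-1) k) + (p'.1 k - q' * gHat (-1) k) := by
      filter_upwards [Lp.coeFn_add p.1 p'.1] with k hk
      rw [Prod.fst_add, hk, Pi.add_apply]; ring
    refine ⟨q + q', ⟨?_, ?_⟩, (h3.add h3').congr he.symm⟩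
    · filter_upwards [h1, h1', Lp.coeFn_add p.1 p'.1, Lp.coeFn_add p.2 p'.2] with k e1 e2 e3 e4
      rw [Prod.fst_add, Prod.snd_add, e3, e4, Pi.add_apply, Pi.add_apply, e1, e2]; ring
    · rw [integral_congr_ae he, integral_add h3 h3', mul_add, mul_add, h2, h2']
  smul_mem' := by
    rintro t p ⟨q, ⟨h1, h2⟩, h3⟩
    have he : (fun k => (t • p).1 k - (t * q) * gHat (-1) k) =ᵐ[volume]
        fun k => t * (p.1 k - q * gHat (-1) k) := by
      filter_upwards [Lp.coeFn_smul t p.1] with k hk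
      rw [Prod.smul_fst, hk, Pi.smul_apply, smul_eq_mul]; ring
    refine ⟨t * q, ⟨?_, ?_⟩, (h3.const_mul t).congr he.symm⟩
    · filter_upwards [h1, Lp.coeFn_smul t p.1, Lp.coeFn_smul t p.2] with k e1 e3 e4
      rw [Prod.smul_fst, Prod.smul_snd, e3, e4, Pi.smul_apply, Pi.smul_apply, e1, smul_eq_mul,
        smul_eq_mul]; ring
    · rw [integral_congr_ae he, integral_const_mul, mul_left_comm, h2]; ring

lemma neg_one_mem : -(-1 : ℂ) ∈ Complex.slitPlane := by simp

lemma mem_chanGraph_iff (hd : d = 1 ∨ d = 2 ∨ d = 3) {w : ℂ} (hw : -w ∈ Complex.slitPlane)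
    {p : L2 d × L2 d} : p ∈ chanGraph d a c ↔ ∃ q, IsChan d a c w p.1 p.2 q := by
  constructor
  · rintro ⟨q, h, -⟩
    exact ⟨q, h.change hd neg_one_mem hw⟩
  · rintro ⟨q, h⟩
    have h' := h.change hd hw neg_one_mem
    exact ⟨q, h', (integrable_gHat_mul (by omega) neg_one_mem _).congr (h'.ae_eq neg_one_mem).symm⟩

/-- The point interaction with boundary condition `a q = c f`, in Fourier space. -/
def chanOp (d : ℕ) (a c : ℝ) : L2 d →ₗ.[ℂ] L2 d := (chanGraph d a c).toLinearPMap

/-- The relation `chanGraph` is the graph of an operator, as a nonzero constant `-q` is not square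
integrable. -/
lemma chanOp_graph (hd : d = 1 ∨ d = 2 ∨ d = 3) : (chanOp d a c).graph = chanGraph d a c := by
  refine Submodule.toLinearPMap_graph_eq _ ?_
  rintro ⟨ψ, φ⟩ ⟨q, h, -⟩ h0
  simp only at h0
  subst h0
  have : NeZero d := ⟨by omega⟩
  have : Nontrivial (Pos d) := by
    apply Module.nontrivial_of_finrank_pos (R := ℝ)
    rw [finrank_euclideanSpace_fin]; omega
  have : NoncompactSpace (Pos d) := NormedSpace.noncompactSpace ℝ _
  have hq : φ =ᵐ[volume] fun _ => -q := by
    filter_upwards [h.1, Lp.coeFn_zero ℂ 2 (volume : Measure (Pos d))] with k h1 h2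
    rw [h1, h2]; simp
  have hm : MemLp (fun _ : Pos d => -q) 2 := (memLp_congr_ae hq).1 (Lp.memLp φ)
  rcases (memLp_const_iff (by norm_num) (by norm_num)).1 hm with h1 | h1
  · rw [h1] at hq
    exact (Lp.eq_zero_iff_ae_eq_zero).2 hq
  · rw [measure_univ_of_isAddLeftInvariant] at h1
    exact absurd h1 (lt_irrefl _)

lemma mem_chanOp_graph (hd : d = 1 ∨ d = 2 ∨ d = 3) {w : ℂ} (hw : -w ∈ Complex.slitPlane)
    {p : L2 d × L2 d} : p ∈ (chanOp d a c).graph ↔ ∃ q, IsChan d a c w p.1 p.2 q := by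
  rw [chanOp_graph hd, mem_chanGraph_iff hd hw]

/-- The points at which Krein's formula makes sense. -/
def chanSet (d : ℕ) (a c : ℝ) : Set ℂ := {w | -w ∈ Complex.slitPlane ∧ kreinD d a c w ≠ 0}

theorem isResolventFamily_chanOp (hd : d = 1 ∨ d = 2 ∨ d = 3) (hac : a ≠ 0 ∨ c ≠ 0) :
    IsResolventFamily (chanOp d a c) (chanSet d a c) (kreinR d a c) where
  mem_of_im_ne_zero w hw :=
    ⟨mem_slitPlane_of_im_ne_zero hw, kreinD_ne_zero_of_im_ne_zero hd hac hw⟩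
  exists_real := by
    obtain ⟨x, -, hx, h⟩ := exists_neg_kreinD_ne_zero (d := d) hd hac 0
    exact ⟨x, mem_slitPlane_of_neg hx, h⟩
  mem_graph := by
    rintro w ⟨hw, hD⟩ y
    have hd4 : d < 4 := by omega
    have hR := coeFn_kreinR (a := a) (c := c) hd4 hw y
    rw [mem_chanOp_graph hd hw]
    refine ⟨c / kreinD d a c w * ∫ k, gHat w k * y k, ?_, ?_⟩
    · filter_upwards [hR, Lp.coeFn_add y (w • kreinR d a c w y),
        Lp.coeFn_smul w (kreinR d a c w y)] with k h1 h2 h3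
      rw [h2, Pi.add_apply, h3, Pi.smul_apply, h1, smul_eq_mul]
      have := symb_sub_ne_zero hw k
      unfold gHat
      field_simp
      ring
    · have : ∫ k, (kreinR d a c w y k - c / kreinD d a c w * (∫ k, gHat w k * y k) * gHat w k)
          = ∫ k, gHat w k * y k := by
        refine integral_congr_ae ?_
        filter_upwards [hR] with k h1
        rw [h1]; ring
      rw [this, ← mul_assoc, mul_div_cancel₀ _ hD]
  left_inv := by
    rintro w ⟨hw, hD⟩ p hp
    have hd4 : d < 4 := by omega
    obtain ⟨q, h⟩ := (mem_chanOp_graph hd hw).1 hp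
    have h1 := h.ae_eq hw
    have h2 : q = c / kreinD d a c w * ∫ k, gHat w k * (p.2 - w • p.1 : L2 d) k := by
      rw [← integral_congr_ae h1, div_mul_eq_mul_div, eq_div_iff hD, mul_comm, h.2]
    refine Lp.ext ?_
    filter_upwards [coeFn_kreinR (a := a) (c := c) hd4 hw (p.2 - w • p.1), h1] with k h3 h4
    rw [h3, ← h2, mul_add, ← h4]; ring
  inner_left := by
    rintro w ⟨hw, hD⟩ x y
    rw [kreinR_apply, kreinR_apply, inner_add_left, inner_add_right, inner_mulG hw,
      inner_smul_left, inner_smul_right, Complex.conj_conj, map_mul, map_div₀, conj_kreinD hw,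
      inner_conj_symm, Complex.conj_ofReal]
    ring

end Channel

/-! ### Boundary values and eigenvectors of one channel -/

section BoundaryValues

open FourierTransform
open scoped ComplexConjugate

variable {d : ℕ} {a c : ℝ}

lemma nontrivial_Pos (hd : 0 < d) : Nontrivial (Pos d) := by
  apply Module.nontrivial_of_finrank_pos (R := ℝ)
  rwa [finrank_euclideanSpace_fin]

/-- `-i√x` is the boundary value of `√(-w)` as `w` tends to `x > 0` from the upper half-plane. -/
lemma regK_boundary (hd : d = 1 ∨ d = 2 ∨ d = 3) {s : ℝ} (hs : 0 < s) :
    ContinuousAt (regK d) (-Complex.I * s) ∧ 0 < (regK d (-Complex.I * s)).im := by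
  have hs0 : (s : ℂ) ≠ 0 := by exact_mod_cast hs.ne'
  have hI := Complex.I_ne_zero
  have hπ := Real.pi_pos
  rcases hd with rfl | rfl | rfl
  · refine ⟨?_, ?_⟩
    · unfold regK
      have : 2 * (-Complex.I * (s : ℂ)) ≠ 0 := by simp [hs0]
      fun_prop (disch := assumption)
    · have : regK 1 (-Complex.I * s) = ((1 / (2 * s) : ℝ) : ℂ) * Complex.I := by
        simp only [regK]
        push_cast
        field_simp
        rw [Complex.I_sq]
      rw [this, Complex.im_ofReal_mul]
      simpa using hs
  · have he : -Complex.I * (s : ℂ) / 2 = ((s / 2 : ℝ) : ℂ) * -Complex.I := by push_cast; ring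
    have hm : -Complex.I * (s : ℂ) / 2 ∈ Complex.slitPlane := by
      rw [he]
      refine Complex.mem_slitPlane_iff.2 (Or.inr ?_)
      simp [hs.ne']
    refine ⟨?_, ?_⟩
    · unfold regK
      fun_prop (disch := assumption)
    · simp only [regK]
      have h1 : (Complex.log (-Complex.I * s / 2)).im = -(Real.pi / 2) := by
        rw [he, Complex.log_im, Complex.arg_real_mul _ (by positivity), Complex.arg_neg_I]
      rw [show (2 * (Real.pi : ℂ)) = ((2 * Real.pi : ℝ) : ℂ) by push_cast; rfl,
        Complex.div_ofReal_im, Complex.neg_im, Complex.add_im, h1, Complex.ofReal_im]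
      have : 0 < Real.pi / 2 / (2 * Real.pi) := by positivity
      simpa using this
  · refine ⟨?_, ?_⟩
    · unfold regK
      fun_prop
    · simp only [regK]
      rw [show (4 * (Real.pi : ℂ)) = ((4 * Real.pi : ℝ) : ℂ) by push_cast; rfl,
        Complex.div_ofReal_im]
      have : 0 < s / (4 * Real.pi) := by positivity
      simpa using this

/-- The boundary value of the regular value from above the positive half-axis. -/
theorem tendsto_regVal (hd : d = 1 ∨ d = 2 ∨ d = 3) {x : ℝ} (hx : 0 < x) :
    ∃ L : ℂ, 0 < L.im ∧
      Tendsto (fun δ : ℝ => regVal d (x + δ * Complex.I)) (𝓝[>] 0) (𝓝 L) := by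
  have hs : 0 < √x := Real.sqrt_pos.2 hx
  obtain ⟨h1, h2⟩ := regK_boundary hd hs
  refine ⟨_, h2, ?_⟩
  have hsx : ((x : ℂ)) ^ (1 / 2 : ℂ) = (√x : ℝ) := by
    rw [Real.sqrt_eq_rpow, Complex.ofReal_cpow hx.le]
    norm_num
  have hkap : ∀ δ : ℝ, 0 < δ → kap (x + δ * Complex.I)
      = -Complex.I * ((x : ℂ) + δ * Complex.I) ^ (1 / 2 : ℂ) := by
    intro δ hδ
    set w : ℂ := x + δ * Complex.I with hw
    have hwim : 0 < w.im := by simpa [hw] using hδ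
    have hw0 : w ≠ 0 := fun h => by rw [h] at hwim; simp at hwim
    have hsq : (w ^ (1 / 2 : ℂ)) ^ 2 = w := by rw [← Complex.cpow_mul_nat]; norm_num
    have hmem : -Complex.I * w ^ (1 / 2 : ℂ) ∈ rightHalfPlane := by
      simp only [rightHalfPlane, Set.mem_ofPred_eq]
      have h3 : 0 < (w ^ (1 / 2 : ℂ)).im := by
        rw [Complex.cpow_def_of_ne_zero hw0, Complex.exp_im]
        have h4 := Complex.arg_le_pi w
        have h5 : 0 < w.arg := by
          rcases (Complex.arg_nonneg_iff.2 hwim.le).lt_or_eq with h | h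
          · exact h
          · have := (Complex.arg_eq_zero_iff.1 h.symm).2
            linarith
        refine mul_pos (Real.exp_pos _) (Real.sin_pos_of_pos_of_lt_pi ?_ ?_)
        · simp [Complex.log_im]; exact h5
        · simp [Complex.log_im]; linarith [Real.pi_pos]
      simpa using h3
    rw [← kap_eq hmem, mul_pow, hsq, neg_sq, Complex.I_sq, neg_one_mul, neg_neg]
  have hlim : Tendsto (fun δ : ℝ => -Complex.I * ((x : ℂ) + δ * Complex.I) ^ (1 / 2 : ℂ)) (𝓝[>] 0)
      (𝓝 (-Complex.I * (√x : ℝ))) := by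
    rw [← hsx]
    have hxs : (x : ℂ) + ((0 : ℝ) : ℂ) * Complex.I ∈ Complex.slitPlane := by
      simp [Complex.mem_slitPlane_iff, hx]
    have hc : ContinuousAt (fun δ : ℝ => -Complex.I * ((x : ℂ) + δ * Complex.I) ^ (1 / 2 : ℂ)) 0 := by
      fun_prop (disch := assumption)
    have := hc.tendsto
    simp only [Complex.ofReal_zero, zero_mul, add_zero] at this
    exact this.mono_left nhdsWithin_le_nhds
  refine (h1.tendsto.comp hlim).congr' ?_
  filter_upwards [self_mem_nhdsWithin] with δ hδ
  simp only [Function.comp, regVal, hkap δ hδ]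

lemma ae_symb_ne (hd : 0 < d) (e : ℝ) : ∀ᵐ k : Pos d, symb k ≠ e := by
  have := nontrivial_Pos hd
  have h0 := Measure.addHaar_sphere (volume : Measure (Pos d)) 0 (√e / (2 * Real.pi))
  have hπ := Real.pi_pos
  filter_upwards [compl_mem_ae_iff.2 h0] with k hk he
  refine hk ?_
  rw [mem_sphere_zero_iff_norm, ← he, symb, ← mul_pow, Real.sqrt_sq (by positivity)]
  field_simp

/-- The square integral of `ĝ_w` is read off from the imaginary part of the regular value. -/
lemma regVal_im (hd : d = 1 ∨ d = 2 ∨ d = 3) {w : ℂ} (hw : -w ∈ Complex.slitPlane) :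
    (regVal d w).im = w.im * ∫ k : Pos d, ‖gHat w k‖ ^ 2 := by
  have h := regVal_sub hd hw (conj_mem_slitPlane hw)
  have h1 : ∀ k : Pos d, gHat (conj w) k * gHat w k = ((‖gHat w k‖ ^ 2 : ℝ) : ℂ) := fun k => by
    rw [← conj_gHat, Complex.conj_mul']; push_cast; rfl
  simp only [h1] at h
  rw [integral_complex_ofReal, ← conj_regVal d hw, Complex.sub_conj, Complex.sub_conj] at h
  have h2 := congrArg Complex.im h
  simp at h2
  linarith

lemma norm_gHat_le_of_re {e δ : ℝ} {k : Pos d} (hk : symb k ≠ e) :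
    ‖gHat (e + δ * Complex.I) k‖ ≤ ‖gHat (e : ℂ) k‖ := by
  unfold gHat
  rw [norm_inv, norm_inv]
  have h1 : (symb k : ℂ) - e = ((symb k - e : ℝ) : ℂ) := by push_cast; rfl
  have h0 : 0 < ‖(symb k : ℂ) - e‖ := by
    rw [h1, Complex.norm_real]; exact norm_pos_iff.2 (sub_ne_zero.2 hk)
  refine inv_anti₀ h0 ?_
  have h2 := Complex.abs_re_le_norm ((symb k : ℂ) - (e + δ * Complex.I))
  rw [h1, Complex.norm_real]
  simpa using h2

/-- For `e ≥ 0` the function `1 / (4π²|k|² - e)` is not square integrable: otherwise the imaginary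
part of the regular value at `e + iδ` would be `O(δ)`. -/
theorem not_memLp_gHat (hd : d = 1 ∨ d = 2 ∨ d = 3) {e : ℝ} (he : 0 ≤ e) :
    ¬ MemLp (gHat (e : ℂ) : Pos d → ℂ) 2 := by
  intro hm
  have hsq := (memLp_two_iff_integrable_sq_norm hm.1).1 hm
  set C := ∫ k : Pos d, ‖gHat (e : ℂ) k‖ ^ 2 with hC
  have hC0 : 0 ≤ C := integral_nonneg fun k => by positivity
  have hbound : ∀ δ : ℝ, 0 < δ → (regVal d (e + δ * Complex.I)).im ≤ δ * C := by
    intro δ hδ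
    have him : ((e : ℂ) + δ * Complex.I).im = δ := by simp
    have hw : -((e : ℂ) + δ * Complex.I) ∈ Complex.slitPlane :=
      mem_slitPlane_of_im_ne_zero (by rw [him]; exact hδ.ne')
    rw [regVal_im hd hw, him]
    refine mul_le_mul_of_nonneg_left (integral_mono_ae ?_ hsq ?_) hδ.le
    · have := memLp_gHat (d := d) (by omega) hw
      exact (memLp_two_iff_integrable_sq_norm this.1).1 this
    · filter_upwards [ae_symb_ne (d := d) (by omega) e] with k hk
      exact pow_le_pow_left₀ (norm_nonneg _) (norm_gHat_le_of_re hk) 2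
  rcases he.lt_or_eq with he | rfl
  · obtain ⟨L, hL, ht⟩ := tendsto_regVal hd he
    have h1 : Tendsto (fun δ : ℝ => (regVal d (e + δ * Complex.I)).im) (𝓝[>] 0) (𝓝 L.im) :=
      (Complex.continuous_im.tendsto L).comp ht
    have h2 : Tendsto (fun δ : ℝ => δ * C) (𝓝[>] 0) (𝓝 0) := by
      have : Tendsto (fun δ : ℝ => δ * C) (𝓝 0) (𝓝 (0 * C)) := tendsto_id.mul_const C
      rw [zero_mul] at this
      exact this.mono_left nhdsWithin_le_nhds
    have h3 := le_of_tendsto_of_tendsto h1 h2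
      (by filter_upwards [self_mem_nhdsWithin] with δ hδ using hbound δ hδ)
    linarith
  -- at the threshold, take the ray `κ = s (1 - i)`, on which the spectral parameter is `2 i s²`
  · have hreg : ∀ s : ℝ, 0 < s → regVal d ((0 : ℝ) + (2 * s ^ 2 : ℝ) * Complex.I)
        = regK d (s * (1 - Complex.I)) := by
      intro s hs
      have hmem : (s : ℂ) * (1 - Complex.I) ∈ rightHalfPlane := by
        simpa [rightHalfPlane] using hs
      have hsq : (((0 : ℝ) : ℂ) + (2 * s ^ 2 : ℝ) * Complex.I) = -((s : ℂ) * (1 - Complex.I)) ^ 2 := by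
        push_cast
        linear_combination (s : ℂ) ^ 2 * Complex.I_sq
      rw [regVal, hsq, kap_eq hmem]
    -- there `Im regK ≥ m s`, which for small `s` contradicts the bound `2 s² C`
    have hlow : ∃ m > 0, ∀ s : ℝ, 0 < s → s ≤ 1 → m * s ≤ (regK d (s * (1 - Complex.I))).im := by
      have hπ := Real.pi_pos
      rcases hd with rfl | rfl | rfl
      · refine ⟨1 / 4, by norm_num, fun s hs hs1 => ?_⟩
        have : regK 1 (s * (1 - Complex.I)) = ((1 / (4 * s) : ℝ) : ℂ) * (1 + Complex.I) := by
          have hs0 : (s : ℂ) ≠ 0 := by exact_mod_cast hs.ne'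
          have h1 : (1 : ℂ) - Complex.I ≠ 0 := fun h => by
            have := congrArg Complex.re h
            simp at this
          simp only [regK]
          push_cast
          field_simp
          linear_combination 2 * Complex.I_sq
        rw [this, Complex.im_ofReal_mul]
        simp only [Complex.add_im, Complex.one_im, Complex.I_im, zero_add, mul_one]
        rw [div_mul_eq_mul_div, div_le_div_iff₀ (by norm_num) (by positivity)]
        nlinarith
      · refine ⟨1 / 8, by norm_num, fun s hs hs1 => ?_⟩
        have h1 : (Complex.log (s * (1 - Complex.I) / 2)).im = -(Real.pi / 4) := by
          have h2 : (s : ℂ) * (1 - Complex.I) / 2 = ((s / √2 : ℝ) : ℂ) *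
              (Complex.cos (-(Real.pi / 4) : ℝ) + Complex.sin (-(Real.pi / 4) : ℝ) * Complex.I) := by
            have h3 : (√2 : ℂ) ^ 2 = 2 := by
              rw [← Complex.ofReal_pow, Real.sq_sqrt (by norm_num)]; norm_num
            have h4 : (√2 : ℂ) ≠ 0 := by
              exact_mod_cast (Real.sqrt_pos.2 (by norm_num : (0 : ℝ) < 2)).ne'
            rw [← Complex.ofReal_cos, ← Complex.ofReal_sin, Real.cos_neg, Real.sin_neg,
              Real.cos_pi_div_four, Real.sin_pi_div_four]
            push_cast
            field_simp
            ring
          rw [h2, Complex.log_im, Complex.arg_mul_cos_add_sin_mul_I (by positivity)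
            ⟨by linarith, by linarith⟩]
        simp only [regK]
        rw [show (2 * (Real.pi : ℂ)) = ((2 * Real.pi : ℝ) : ℂ) by push_cast; rfl,
          Complex.div_ofReal_im, Complex.neg_im, Complex.add_im, h1, Complex.ofReal_im,
          le_div_iff₀ (by positivity)]
        nlinarith
      · refine ⟨1 / (4 * Real.pi), by positivity, fun s hs hs1 => ?_⟩
        simp only [regK]
        rw [show (4 * (Real.pi : ℂ)) = ((4 * Real.pi : ℝ) : ℂ) by push_cast; rfl,
          Complex.div_ofReal_im]
        simp
        exact le_of_eq (by ring)
    obtain ⟨m, hm0, hm1⟩ := hlow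
    set s := min 1 (m / (4 * (C + 1))) with hs
    have hs0 : 0 < s := by positivity
    have hs1 : s ≤ 1 := min_le_left _ _
    have hs2 : s * (4 * (C + 1)) ≤ m := by
      rw [← le_div_iff₀ (by positivity)]; exact min_le_right _ _
    have h1 := hbound (2 * s ^ 2) (by positivity)
    rw [hreg s hs0] at h1
    have h2 := hm1 s hs0 hs1
    nlinarith [mul_pos hs0 hm0]

/-- An eigenvector for the eigenvalue `e` is a multiple of `ĝ_e`. -/
lemma ae_eq_of_mem_opEigenspace (hd : d = 1 ∨ d = 2 ∨ d = 3) {e : ℝ} {ψ : L2 d}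
    (h : ψ ∈ opEigenspace (chanOp d a c) (e : ℂ)) :
    ∃ q : ℂ, ψ =ᵐ[volume] fun k => q * gHat (e : ℂ) k := by
  obtain ⟨q, h1, -⟩ := (mem_chanOp_graph (p := (ψ, (e : ℂ) • ψ)) hd neg_one_mem).1 h
  refine ⟨q, ?_⟩
  filter_upwards [h1, Lp.coeFn_smul (e : ℂ) ψ, ae_symb_ne (d := d) (by omega) e] with k h2 h3 h4
  rw [h3, Pi.smul_apply, smul_eq_mul] at h2
  have h5 : (symb k : ℂ) - e ≠ 0 := by
    rw [sub_ne_zero]; exact_mod_cast h4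
  unfold gHat
  field_simp
  linear_combination -h2

lemma opEigenspace_chanOp_of_nonneg (hd : d = 1 ∨ d = 2 ∨ d = 3) {e : ℝ} (he : 0 ≤ e) :
    opEigenspace (chanOp d a c) (e : ℂ) = ⊥ := by
  rw [eq_bot_iff]
  intro ψ hψ
  obtain ⟨q, hq⟩ := ae_eq_of_mem_opEigenspace hd hψ
  by_cases hq0 : q = 0
  · rw [Submodule.mem_bot]
    refine Lp.eq_zero_iff_ae_eq_zero.2 (hq.trans ?_)
    rw [hq0]; simp only [zero_mul]; rfl
  · exfalso
    refine not_memLp_gHat hd he ?_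
    have h1 : MemLp (fun k : Pos d => q * gHat (e : ℂ) k) 2 := (memLp_congr_ae hq).1 (Lp.memLp ψ)
    have h2 := h1.const_mul q⁻¹
    simpa only [inv_mul_cancel_left₀ hq0] using h2

lemma gL_ne_zero (hd : d < 4) {w : ℂ} (hw : -w ∈ Complex.slitPlane) : gL d w ≠ 0 := by
  intro h
  have h1 := coeFn_gL hd hw
  rw [h] at h1
  have h2 : ∀ᵐ k : Pos d, False := by
    filter_upwards [h1, Lp.coeFn_zero ℂ 2 (volume : Measure (Pos d))] with k h3 h4
    rw [h3] at h4
    exact inv_ne_zero (symb_sub_ne_zero hw k) h4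
  rw [eventually_false_iff_eq_bot, ae_eq_bot] at h2
  have := measure_univ_pos (d := d)
  rw [h2] at this
  simp at this

lemma opEigenspace_chanOp_of_zero (hd : d = 1 ∨ d = 2 ∨ d = 3) {e : ℝ} (he : e < 0)
    (hD : kreinD d a c e = 0) :
    opEigenspace (chanOp d a c) (e : ℂ) = Submodule.span ℂ {gL d e} := by
  have hw := mem_slitPlane_of_neg he
  have hg := coeFn_gL (d := d) (by omega) hw
  refine le_antisymm (fun ψ hψ => ?_) ?_
  · obtain ⟨q, hq⟩ := ae_eq_of_mem_opEigenspace hd hψ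
    refine Submodule.mem_span_singleton.2 ⟨q, Lp.ext ?_⟩
    filter_upwards [hq, hg, Lp.coeFn_smul q (gL d e)] with k h1 h2 h3
    rw [h3, h1, Pi.smul_apply, h2, smul_eq_mul]
  · rw [Submodule.span_singleton_le_iff_mem]
    refine (mem_chanOp_graph (p := (gL d e, (e : ℂ) • gL d e)) hd hw).2 ⟨1, ?_, ?_⟩
    · filter_upwards [hg, Lp.coeFn_smul (e : ℂ) (gL d e)] with k h1 h2
      rw [h2, Pi.smul_apply, h1, smul_eq_mul]
      have := symb_sub_ne_zero hw k
      unfold gHat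
      field_simp
      ring
    · rw [hD, integral_congr_ae (g := fun _ => 0)]
      · simp
      · filter_upwards [hg] with k h1
        rw [h1]; ring

/-- The eigenvalues of one channel are the negative zeros of Krein's denominator. -/
theorem opEigenspace_chanOp_ne_bot_iff (hd : d = 1 ∨ d = 2 ∨ d = 3) (hac : a ≠ 0 ∨ c ≠ 0) {e : ℝ} :
    opEigenspace (chanOp d a c) (e : ℂ) ≠ ⊥ ↔ e < 0 ∧ kreinD d a c e = 0 := by
  constructor
  · intro h
    have he : e < 0 := by
      by_contra h1
      exact h (opEigenspace_chanOp_of_nonneg hd (not_lt.1 h1))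
    refine ⟨he, ?_⟩
    by_contra h2
    exact h ((isResolventFamily_chanOp hd hac).eigenspace_eq_bot ⟨mem_slitPlane_of_neg he, h2⟩)
  · rintro ⟨he, hD⟩ h
    rw [opEigenspace_chanOp_of_zero hd he hD, Submodule.span_singleton_eq_bot] at h
    exact gL_ne_zero (by omega) (mem_slitPlane_of_neg he) h

lemma finrank_opEigenspace_chanOp (hd : d = 1 ∨ d = 2 ∨ d = 3) {e : ℝ} (he : e < 0)
    (hD : kreinD d a c e = 0) :
    Module.finrank ℂ (opEigenspace (chanOp d a c) (e : ℂ)) = 1 := by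
  rw [opEigenspace_chanOp_of_zero hd he hD]
  exact finrank_span_singleton (gL_ne_zero (by omega) (mem_slitPlane_of_neg he))

lemma eq_of_kreinD_eq_zero (hd : d = 1 ∨ d = 2 ∨ d = 3) (hac : a ≠ 0 ∨ c ≠ 0) {x y : ℝ}
    (hx : x < 0) (hy : y < 0) (h1 : kreinD d a c x = 0) (h2 : kreinD d a c y = 0) : x = y := by
  simp only [kreinD, sub_eq_zero] at h1 h2
  by_cases hc : c = 0
  · rw [hc] at h1
    simp at h1
    rcases hac with h3 | h3
    · exact absurd h1 h3
    · exact absurd hc h3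
  · exact regVal_injOn_neg hd hx hy
      (mul_left_cancel₀ (Complex.ofReal_ne_zero.2 hc) (h1.symm.trans h2))

end BoundaryValues

/-! ### Spectral measures of one channel -/

section ChannelSpectrum

open FourierTransform
open scoped ComplexConjugate

namespace IsResolventFamily

variable {E : Type*} [NormedAddCommGroup E] [InnerProductSpace ℂ E]
  {A : E →ₗ.[ℂ] E} {ρ : Set ℂ} {R : ℂ → E →L[ℂ] E} (hA : IsResolventFamily A ρ R)

include hA

lemma poisson_eq_im [CompleteSpace E] (ψ : E) (x : ℝ) {δ : ℝ} (hδ : δ ≠ 0) :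
    ∫ t : ℝ, δ / ((t - x) ^ 2 + δ ^ 2) ∂(specMeasure A ψ)
      = (inner ℂ ψ (R (x + δ * Complex.I) ψ)).im := by
  rw [hA.inner_resolvent_eq ψ (by simpa using hδ), im_stieltjes _ x hδ]

/-- The spectral measures do not charge the real points of `ρ`. -/
lemma specMeasure_eq_zero_of_subset [CompleteSpace E] (ψ : E) {B : Set ℝ}
    (h : ∀ x ∈ B, (x : ℂ) ∈ ρ) : specMeasure A ψ B = 0 := by
  refine measure_eq_zero_of_poisson_tendsto_zero _ fun x hx => ?_
  have hb : ∀ δ : ℝ, 0 < δ → ‖R (x + δ * Complex.I) ψ‖ ≤ 2 * ‖R x ψ‖ := by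
    intro δ hδ
    have him : ((x : ℂ) + δ * Complex.I).im = δ := by simp
    have hz : ((x : ℂ) + δ * Complex.I).im ≠ 0 := by rw [him]; exact hδ.ne'
    have h1 := hA.resolvent_sub (hA.mem_of_im_ne_zero _ hz) (h x hx) ψ
    have h2 := hA.norm_resolvent_le hz (R x ψ)
    rw [him, abs_of_pos hδ] at h2
    have h3 : R (x + δ * Complex.I) ψ = R x ψ + (δ * Complex.I) • R (x + δ * Complex.I) (R x ψ) := by
      rw [add_sub_cancel_left] at h1
      rw [← h1]; abel
    have h4 : ‖((δ : ℂ) * Complex.I) • R (x + δ * Complex.I) (R x ψ)‖ ≤ ‖R x ψ‖ := by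
      rw [norm_smul, norm_mul, Complex.norm_I, mul_one, Complex.norm_real,
        Real.norm_of_nonneg hδ.le]
      refine (mul_le_mul_of_nonneg_left h2 hδ.le).trans (le_of_eq ?_)
      field_simp
    rw [h3]
    linarith [norm_add_le (R x ψ) ((δ * Complex.I) • R (x + δ * Complex.I) (R x ψ))]
  -- the Poisson integral is `δ ‖R(x + iδ) ψ‖²`, which tends to zero
  have hlim : Tendsto (fun δ : ℝ => δ * (2 * ‖R x ψ‖) ^ 2) (𝓝[>] 0) (𝓝 0) := by
    have : Tendsto (fun δ : ℝ => δ * (2 * ‖R x ψ‖) ^ 2) (𝓝 0) (𝓝 (0 * (2 * ‖R x ψ‖) ^ 2)) :=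
      tendsto_id.mul_const _
    rw [zero_mul] at this
    exact this.mono_left nhdsWithin_le_nhds
  refine tendsto_of_tendsto_of_tendsto_of_le_of_le' tendsto_const_nhds hlim ?_ ?_
  · filter_upwards [self_mem_nhdsWithin] with δ hδ
    have hδ' : (0 : ℝ) < δ := hδ
    exact integral_nonneg fun t => by positivity
  · filter_upwards [self_mem_nhdsWithin] with δ hδ
    have hδ' : (0 : ℝ) < δ := hδ
    have him : ((x : ℂ) + δ * Complex.I).im = δ := by simp
    have hz : ((x : ℂ) + δ * Complex.I).im ≠ 0 := by rw [him]; exact hδ'.ne'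
    rw [hA.poisson_eq_im ψ x hδ'.ne', hA.im_inner_resolvent (hA.mem_of_im_ne_zero _ hz), him]
    gcongr
    exact hb δ hδ'

end IsResolventFamily

variable {d : ℕ} {a c : ℝ}

/-- The symbol pulls null sets back to null sets. -/
lemma volume_symb_preimage (hd : 0 < d) {B : Set ℝ} (hB : volume B = 0) :
    volume (symb ⁻¹' B : Set (Pos d)) = 0 := by
  have := nontrivial_Pos hd
  have hπ := Real.pi_pos
  -- by polar coordinates it is enough that the set `S` of the radii is null
  set S : Set ℝ := {y | 0 < y ∧ (2 * Real.pi) ^ 2 * y ^ 2 ∈ B} with hS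
  have hSnull : volume S = 0 := by
    have h1 : DifferentiableOn ℝ (fun t : ℝ => √(t / (2 * Real.pi) ^ 2)) (B ∩ Set.Ioi 0) := by
      intro t ht
      have : t / (2 * Real.pi) ^ 2 ≠ 0 := (div_pos ht.2 (by positivity)).ne'
      exact DifferentiableAt.differentiableWithinAt (by fun_prop (disch := assumption))
    have h2 := addHaar_image_eq_zero_of_differentiableOn_of_addHaar_eq_zero volume h1
      (measure_mono_null Set.inter_subset_left hB)
    refine measure_mono_null ?_ h2
    rintro y ⟨hy, hyB⟩
    refine ⟨_, ⟨hyB, show 0 < (2 * Real.pi) ^ 2 * y ^ 2 by positivity⟩, ?_⟩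
    simp only
    rw [mul_div_cancel_left₀ _ (by positivity), Real.sqrt_sq hy.le]
  set f : ℝ → ℝ := S.indicator 1 with hf
  have hf0 : (fun y : ℝ => y ^ (Module.finrank ℝ (Pos d) - 1) • f y) =ᵐ[volume] 0 := by
    filter_upwards [compl_mem_ae_iff.2 hSnull] with y hy
    simp only [hf, Set.indicator_of_notMem hy, smul_zero, Pi.zero_apply]
  have hint : Integrable (fun k : Pos d => f ‖k‖) := by
    rw [integrable_fun_norm_addHaar]
    exact ((integrable_zero ℝ ℝ volume).congr hf0.symm).integrableOn
  have hzero : ∫ k : Pos d, f ‖k‖ = 0 := by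
    rw [integral_fun_norm_addHaar, integral_congr_ae (ae_restrict_of_ae hf0)]
    simp
  have hae := (integral_eq_zero_iff_of_nonneg (fun k => Set.indicator_nonneg (by simp) _) hint).1 hzero
  rw [measure_eq_zero_iff_ae_notMem]
  filter_upwards [hae, ae_ne_zero hd] with k hk hk0 hkB
  have : ‖k‖ ∈ S := ⟨norm_pos_iff.2 hk0, hkB⟩
  simp [Set.indicator_of_mem this] at hk

/-- If the interaction is not felt by `ψ`, its spectral measure is that of `-Δ`: the image under
the symbol of the measure `|ψ|² dk`. -/
lemma specMeasure_of_decoupled (hd : d = 1 ∨ d = 2 ∨ d = 3) (hac : a ≠ 0 ∨ c ≠ 0) {ψ : L2 d}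
    (h : ∀ w : ℂ, w.im ≠ 0 → (c : ℂ) * inner ℂ (gL d (conj w)) ψ = 0) :
    ∃ ν : Measure (Pos d), IsFiniteMeasure ν ∧ ν ≪ volume ∧
      (∀ B, MeasurableSet B → (∀ᵐ k ∂volume, k ∈ B → ψ k = 0) → ν B = 0) ∧
      specMeasure (chanOp d a c) ψ = ν.map symb := by
  have hA := isResolventFamily_chanOp (d := d) (a := a) (c := c) hd hac
  obtain ⟨f, hf, hfψ⟩ : ∃ f : Pos d → ℂ, Measurable f ∧ ψ =ᵐ[volume] f :=
    ⟨_, (Lp.aestronglyMeasurable ψ).stronglyMeasurable_mk.measurable,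
      (Lp.aestronglyMeasurable ψ).ae_eq_mk⟩
  have hm : Measurable fun k => ‖f k‖₊ ^ 2 := by fun_prop
  set ν : Measure (Pos d) := volume.withDensity fun k => ((‖f k‖₊ ^ 2 : NNReal) : ENNReal) with hν
  have hfin : IsFiniteMeasure ν := by
    refine isFiniteMeasure_withDensity (ne_of_lt ?_)
    have h2 := (memLp_two_iff_integrable_sq_norm (Lp.memLp ψ).1).1 (Lp.memLp ψ)
    have h3 : Integrable fun k => ‖f k‖ ^ 2 := h2.congr (hfψ.mono fun k hk => by simp only [hk])
    have h4 := h3.hasFiniteIntegral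
    rw [hasFiniteIntegral_iff_enorm] at h4
    refine lt_of_le_of_lt (lintegral_mono fun k => ?_) h4
    rw [Real.enorm_eq_ofReal (by positivity), ENNReal.ofReal, ENNReal.coe_le_coe, Real.toNNReal_pow
      (norm_nonneg _), norm_toNNReal]
  refine ⟨ν, hfin, withDensity_absolutelyContinuous _ _, fun B hB hBψ => ?_, ?_⟩
  · rw [hν, withDensity_apply _ hB, lintegral_eq_zero_iff (by fun_prop)]
    refine (ae_restrict_iff' hB).2 ?_
    filter_upwards [hBψ, hfψ] with k h1 h2 hk
    have := h1 hk
    rw [h2] at this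
    simp [this]
  · refine hA.specMeasure_eq (hA.isSpectralMeasure_iff.2 ⟨?_, fun z hz => ?_⟩)
    · exact Measure.isFiniteMeasure_map ν symb
    · have hw := mem_slitPlane_of_im_ne_zero hz
      have hK : kreinR d a c z ψ = mulG d z ψ := by
        rw [kreinR_apply, div_mul_eq_mul_div, h z hz, zero_div, zero_smul, add_zero]
      rw [hK, integral_map (continuous_symb.measurable.aemeasurable)
        ((by fun_prop : Measurable fun t : ℝ => ((t : ℂ) - z)⁻¹).aestronglyMeasurable), hν,
        integral_withDensity_eq_integral_smul hm, L2.inner_def]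
      refine integral_congr_ae ?_
      filter_upwards [coeFn_mulG hw ψ, hfψ] with k h1 h2
      rw [h1, h2, RCLike.inner_apply, mul_assoc, Complex.mul_conj', NNReal.smul_def, gHat]
      simp [mul_comm]

lemma specMeasure_ac_of_decoupled (hd : d = 1 ∨ d = 2 ∨ d = 3) (hac : a ≠ 0 ∨ c ≠ 0) {ψ : L2 d}
    (h : ∀ w : ℂ, w.im ≠ 0 → (c : ℂ) * inner ℂ (gL d (conj w)) ψ = 0) :
    specMeasure (chanOp d a c) ψ ≪ volume := by
  obtain ⟨ν, -, hν, -, he⟩ := specMeasure_of_decoupled (a := a) (c := c) hd hac h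
  rw [he]
  refine Measure.AbsolutelyContinuous.mk fun B hB hB0 => ?_
  rw [Measure.map_apply continuous_symb.measurable hB]
  exact hν (volume_symb_preimage (by omega) hB0)

lemma integral_gHat_mul_gHat (hd : d = 1 ∨ d = 2 ∨ d = 3) {w w' : ℂ} (hw : -w ∈ Complex.slitPlane)
    (hw' : -w' ∈ Complex.slitPlane) (hne : w ≠ w') :
    ∫ k : Pos d, gHat w' k * gHat w k = (regVal d w - regVal d w') / (w - w') := by
  rw [regVal_sub hd hw hw', mul_div_cancel_left₀ _ (sub_ne_zero.2 hne)]

lemma inner_gL_gL (hd : d = 1 ∨ d = 2 ∨ d = 3) {w w' : ℂ} (hw : -w ∈ Complex.slitPlane)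
    (hw' : -w' ∈ Complex.slitPlane) (hne : w ≠ conj w') :
    inner ℂ (gL d w') (gL d w) = (regVal d w - regVal d (conj w')) / (w - conj w') := by
  have h1 := inner_gL (d := d) (by omega) (conj_mem_slitPlane hw') (gL d w)
  rw [Complex.conj_conj] at h1
  rw [h1, ← integral_gHat_mul_gHat hd hw (conj_mem_slitPlane hw') hne]
  refine integral_congr_ae ?_
  filter_upwards [coeFn_gL (d := d) (by omega) hw] with k hk
  rw [hk]

lemma mulG_gL (hd : d < 4) {w w' : ℂ} (hw : -w ∈ Complex.slitPlane)
    (hw' : -w' ∈ Complex.slitPlane) (hne : w ≠ w') :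
    mulG d w (gL d w') = (w - w')⁻¹ • (gL d w - gL d w') := by
  refine Lp.ext ?_
  filter_upwards [coeFn_mulG hw (gL d w'), coeFn_gL hd hw, coeFn_gL hd hw',
    Lp.coeFn_smul (w - w')⁻¹ (gL d w - gL d w'), Lp.coeFn_sub (gL d w) (gL d w')] with k h1 h2 h3 h4 h5
  rw [h1, h4, Pi.smul_apply, h5, Pi.sub_apply, h2, h3, gHat_sub hw hw', smul_eq_mul,
    inv_mul_cancel_left₀ (sub_ne_zero.2 hne)]

/-- The diagonal matrix elements of the resolvent at the vectors `ĝ_w` have finite boundary values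
on the positive half-axis. -/
lemma tendsto_inner_kreinR (hd : d = 1 ∨ d = 2 ∨ d = 3) (hc : c ≠ 0) {w₁ : ℂ}
    (hw₁ : w₁.im ≠ 0) {x : ℝ} (hx : 0 < x) : ∃ M : ℂ, Tendsto (fun δ : ℝ =>
      inner ℂ (gL d w₁) (kreinR d a c (x + δ * Complex.I) (gL d w₁))) (𝓝[>] 0) (𝓝 M) := by
  obtain ⟨L, hL, hreg⟩ := tendsto_regVal hd hx
  have hs1 := mem_slitPlane_of_im_ne_zero hw₁
  have hs1c := conj_mem_slitPlane hs1
  have hw : Tendsto (fun δ : ℝ => (x : ℂ) + δ * Complex.I) (𝓝[>] 0) (𝓝 x) := by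
    have hcont : Continuous fun δ : ℝ => (x : ℂ) + δ * Complex.I := by fun_prop
    have := hcont.tendsto 0
    simp only [Complex.ofReal_zero, zero_mul, add_zero] at this
    exact this.mono_left nhdsWithin_le_nhds
  have hx1 : (x : ℂ) - w₁ ≠ 0 := fun h => hw₁ (by rw [← sub_eq_zero.1 h, Complex.ofReal_im])
  have hx1c : (x : ℂ) - conj w₁ ≠ 0 := fun h => hw₁ (by
    have := congrArg Complex.im h
    simpa using this)
  -- the boundary value of Krein's denominator has a nonzero imaginary part
  have hD : (a : ℂ) - c * L ≠ 0 := fun h => by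
    have := congrArg Complex.im h
    simp [hc, hL.ne'] at this
  have l1 := (hreg.sub_const (regVal d w₁)).div (hw.sub_const w₁) hx1
  have l2 := (hreg.sub_const (regVal d (conj w₁))).div (hw.sub_const (conj w₁)) hx1c
  have l3 : Tendsto (fun δ : ℝ => (c : ℂ) / kreinD d a c (x + δ * Complex.I)) (𝓝[>] 0)
      (𝓝 (c / (a - c * L))) :=
    tendsto_const_nhds.div (tendsto_const_nhds.sub (hreg.const_mul (c : ℂ))) hD
  have l4 := ((hw.sub_const w₁).inv₀ hx1).mul (l2.sub_const (inner ℂ (gL d w₁) (gL d w₁)))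
  refine ⟨_, (l4.add ((l3.mul l1).mul l2)).congr' ?_⟩
  have hne1 : ∀ᶠ δ : ℝ in 𝓝[>] 0, (x : ℂ) + δ * Complex.I - w₁ ≠ 0 := by
    exact (hw.sub_const w₁).eventually_ne hx1
  have hne2 : ∀ᶠ δ : ℝ in 𝓝[>] 0, (x : ℂ) + δ * Complex.I - conj w₁ ≠ 0 := by
    exact (hw.sub_const (conj w₁)).eventually_ne hx1c
  filter_upwards [self_mem_nhdsWithin, hne1, hne2] with δ hδ h1 h2
  have hδ' : (0 : ℝ) < δ := hδ
  have hs : -((x : ℂ) + δ * Complex.I) ∈ Complex.slitPlane :=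
    mem_slitPlane_of_im_ne_zero (by simpa using hδ'.ne')
  have h1' : (x : ℂ) + δ * Complex.I ≠ w₁ := sub_ne_zero.1 h1
  have h2' : (x : ℂ) + δ * Complex.I ≠ conj w₁ := sub_ne_zero.1 h2
  have e1 : inner ℂ (gL d (conj ((x : ℂ) + δ * Complex.I))) (gL d w₁)
      = (regVal d (x + δ * Complex.I) - regVal d w₁) / ((x : ℂ) + δ * Complex.I - w₁) := by
    rw [inner_gL_gL hd hs1 (conj_mem_slitPlane hs) (by rw [Complex.conj_conj]; exact h1'.symm),
      Complex.conj_conj, ← neg_sub, ← neg_sub ((x : ℂ) + δ * Complex.I), neg_div_neg_eq]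
  rw [kreinR_apply, inner_add_right, inner_smul_right, e1, mulG_gL (by omega) hs hs1 h1',
    inner_smul_right, inner_sub_right, inner_gL_gL hd hs hs1 h2']
  rfl

/-- One channel: its only eigenvalues are the negative zeros of Krein's denominator; apart from them
the spectrum is absolutely continuous and contained in `[0, ∞)`. -/
theorem isACAbove_chanOp (hd : d = 1 ∨ d = 2 ∨ d = 3) (hac : a ≠ 0 ∨ c ≠ 0) :
    IsACAbove (chanOp d a c) 0 := by
  have hA := isResolventFamily_chanOp (d := d) (a := a) (c := c) hd hac
  have hbelow : ∀ ψ, ∀ B : Set ℝ, B ⊆ Set.Iio 0 →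
      (∀ x ∈ B, opEigenspace (chanOp d a c) (x : ℂ) = ⊥) → specMeasure (chanOp d a c) ψ B = 0 := by
    intro ψ B hB h
    refine hA.specMeasure_eq_zero_of_subset ψ fun x hx => ⟨mem_slitPlane_of_neg (hB hx), fun hD => ?_⟩
    exact (opEigenspace_chanOp_ne_bot_iff hd hac).2 ⟨hB hx, hD⟩ (h x hx)
  refine ⟨?_, ?_, ?_, hbelow⟩
  · refine Set.Subsingleton.finite fun x hx y hy => ?_
    obtain ⟨h1, h2⟩ := (opEigenspace_chanOp_ne_bot_iff hd hac).1 hx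
    obtain ⟨h3, h4⟩ := (opEigenspace_chanOp_ne_bot_iff hd hac).1 hy
    exact eq_of_kreinD_eq_zero hd hac h1 h3 h2 h4
  · intro e
    by_cases h : opEigenspace (chanOp d a c) (e : ℂ) = ⊥
    · rw [h]; infer_instance
    · obtain ⟨h1, h2⟩ := (opEigenspace_chanOp_ne_bot_iff hd hac).1 h
      rw [opEigenspace_chanOp_of_zero hd h1 h2]
      infer_instance
  -- away from `0` the vectors `ĝ_w` have bounded Poisson integrals, and `0` is not an atom
  · intro ψ B hB h
    have hpos : ∀ C : Set ℝ, volume C = 0 → C ⊆ Set.Ioi 0 → ∀ ψ, specMeasure (chanOp d a c) ψ C = 0 := by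
      intro C hC hC0
      by_cases hc : c = 0
      · intro ψ
        exact specMeasure_ac_of_decoupled hd hac (by simp [hc]) hC
      · refine hA.specMeasure_eq_zero_of_total (S := {φ | ∃ w₁ : ℂ, w₁.im ≠ 0 ∧ φ = gL d w₁}) ?_ ?_
        · rintro _ ⟨w₁, hw₁, rfl⟩
          refine measure_eq_zero_of_poisson_bounded _ hC fun x hx => ?_
          obtain ⟨M, hM⟩ := tendsto_inner_kreinR (a := a) hd hc hw₁ (hC0 hx)
          have h1 := ((Complex.continuous_im.tendsto M).comp hM).eventually
            (eventually_le_nhds (lt_add_one M.im))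
          refine ⟨M.im + 1, ?_⟩
          filter_upwards [h1, self_mem_nhdsWithin] with δ h2 hδ
          rw [hA.poisson_eq_im _ _ (ne_of_gt hδ)]
          exact h2
        · intro ψ hψ
          refine specMeasure_ac_of_decoupled hd hac (fun w hw => ?_) hC
          rw [hψ _ ⟨conj w, by simpa using hw, rfl⟩, mul_zero]
    have hsplit : B ⊆ (B ∩ Set.Iio 0) ∪ {0} ∪ (B ∩ Set.Ioi 0) := by
      intro x hx
      rcases lt_trichotomy x 0 with h1 | h1 | h1
      · exact Or.inl (Or.inl ⟨hx, h1⟩)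
      · exact Or.inl (Or.inr h1)
      · exact Or.inr ⟨hx, h1⟩
    refine measure_mono_null hsplit (measure_union_null (measure_union_null ?_ ?_) ?_)
    · exact hbelow ψ _ Set.inter_subset_right fun x hx => h x hx.1
    · rw [hA.specMeasure_singleton_eq_zero_iff]
      intro x hx
      rw [opEigenspace_chanOp_of_nonneg hd le_rfl] at hx
      rw [(Submodule.mem_bot ℂ).1 hx, inner_zero_left]
    · exact hpos _ (measure_mono_null Set.inter_subset_left hB) Set.inter_subset_right ψ

end ChannelSpectrum

/-! ### Odd functions supported in spherical shells -/

section Shells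

open scoped ComplexConjugate

variable {d : ℕ} {a c : ℝ}

/-- An odd function living on the shell `4π²|k|² ∈ J`. Being odd, it does not feel the point
interaction. -/
def shellFun (i : Fin d) (J : Set ℝ) (k : Pos d) : ℂ := (symb ⁻¹' J).indicator (fun k => (k i : ℂ)) k

lemma shellFun_neg (i : Fin d) (J : Set ℝ) (k : Pos d) : shellFun i J (-k) = -shellFun i J k := by
  have h : (-k ∈ symb ⁻¹' J) ↔ (k ∈ symb ⁻¹' J) := by simp [symb]
  unfold shellFun
  by_cases hk : k ∈ symb ⁻¹' J
  · rw [Set.indicator_of_mem (h.2 hk), Set.indicator_of_mem hk]; simp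
  · rw [Set.indicator_of_notMem (fun h' => hk (h.1 h')), Set.indicator_of_notMem hk, neg_zero]

lemma measurable_shellFun (i : Fin d) {J : Set ℝ} (hJ : MeasurableSet J) :
    Measurable (shellFun i J) :=
  Measurable.indicator (by fun_prop) (continuous_symb.measurable hJ)

lemma memLp_shellFun (i : Fin d) {J : Set ℝ} (hJ : MeasurableSet J) {M : ℝ}
    (hJM : J ⊆ Set.Iio M) {g : Pos d → ℂ} (hg : Measurable g) {C : ℝ}
    (hgC : ∀ k, symb k ∈ J → ‖g k‖ ≤ C) : MemLp (fun k => g k * shellFun i J k) 2 := by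
  have hπ := Real.pi_pos
  have hnorm : ∀ k : Pos d, symb k ∈ J → ‖k‖ ≤ √M := by
    intro k hk
    have h1 : symb k < M := hJM hk
    rw [symb] at h1
    refine Real.le_sqrt_of_sq_le (le_trans ?_ h1.le)
    have : (1 : ℝ) ≤ (2 * Real.pi) ^ 2 := by nlinarith [Real.pi_gt_three]
    nlinarith [sq_nonneg ‖k‖]
  have hfin : volume (symb ⁻¹' J : Set (Pos d)) ≠ ⊤ := by
    refine ((measure_mono fun k hk => ?_).trans_lt
      (measure_closedBall_lt_top (x := (0 : Pos d)) (r := √M))).ne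
    simpa using hnorm k hk
  refine MemLp.of_le_mul (c := C * √M) (memLp_indicator_const 2 (continuous_symb.measurable hJ)
    (1 : ℝ) (Or.inr hfin)) ((hg.mul (measurable_shellFun i hJ)).aestronglyMeasurable)
    (Eventually.of_forall fun k => ?_)
  unfold shellFun
  by_cases hk : k ∈ symb ⁻¹' J
  · rw [Set.indicator_of_mem hk, Set.indicator_of_mem hk, norm_mul, norm_one, mul_one]
    refine mul_le_mul (hgC k hk) ?_ (norm_nonneg _) ((norm_nonneg _).trans (hgC k hk))
    rw [Complex.norm_real]
    exact (PiLp.norm_apply_le k i).trans (hnorm k hk)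
  · rw [Set.indicator_of_notMem hk, Set.indicator_of_notMem hk]; simp

lemma integral_even_mul_shellFun (i : Fin d) (J : Set ℝ) {g : Pos d → ℂ} (hg : ∀ k, g (-k) = g k) :
    ∫ k, g k * shellFun i J k = 0 := by
  have h := integral_neg_eq_self (fun k => g k * shellFun i J k) (volume : Measure (Pos d))
  simp only [hg, shellFun_neg, mul_neg] at h
  rw [integral_neg] at h
  have : (2 : ℂ) * ∫ k, g k * shellFun i J k = 0 := by linear_combination -h
  simpa using this

lemma not_ae_shellFun_eq_zero (i : Fin d) {J : Set ℝ} (hJ : IsOpen J) {t : ℝ} (ht : 0 < t)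
    (htJ : t ∈ J) : ¬ ∀ᵐ k, shellFun i J k = 0 := by
  intro h
  have hπ := Real.pi_pos
  have hopen : IsOpen {k : Pos d | symb k ∈ J ∧ 0 < k i} :=
    (hJ.preimage continuous_symb).inter (isOpen_lt continuous_const (EuclideanSpace.proj (𝕜 := ℝ) i).continuous)
  have hne : {k : Pos d | symb k ∈ J ∧ 0 < k i}.Nonempty := by
    refine ⟨EuclideanSpace.single i (√t / (2 * Real.pi)), ?_, ?_⟩
    · have : symb (EuclideanSpace.single i (√t / (2 * Real.pi)) : Pos d) = t := by
        rw [symb, PiLp.norm_single, Real.norm_of_nonneg (by positivity), div_pow,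
          Real.sq_sqrt ht.le]
        field_simp
      rwa [this]
    · have : 0 < √t / (2 * Real.pi) := by positivity
      simpa using this
  refine (hopen.measure_pos volume hne).ne' ?_
  rw [measure_eq_zero_iff_ae_notMem]
  filter_upwards [h] with k hk hkm
  rw [shellFun, Set.indicator_of_mem (show k ∈ symb ⁻¹' J from hkm.1)] at hk
  exact hkm.2.ne' (by exact_mod_cast hk)

/-- Every point of `[0, ∞)` is approached by infinitely many orthogonal shells. -/
theorem hasShells_chanOp (hd : d = 1 ∨ d = 2 ∨ d = 3) (hac : a ≠ 0 ∨ c ≠ 0) :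
    HasShells (chanOp d a c) 0 := by
  intro x hx ε hε
  let i : Fin d := ⟨0, by omega⟩
  -- disjoint intervals accumulating at `x` from above
  let J : ℕ → Set ℝ := fun n => Set.Ioo (x + ε / (n + 2)) (x + ε / (n + 1))
  have hJm : ∀ n, MeasurableSet (J n) := fun n => measurableSet_Ioo
  have hJε : ∀ n, ∀ t ∈ J n, 0 < t - x ∧ t - x < ε := by
    intro n t ht
    have h1 : 0 < ε / ((n : ℝ) + 2) := by positivity
    have h2 : ε / ((n : ℝ) + 1) ≤ ε :=
      div_le_self hε.le (by linarith [n.cast_nonneg (α := ℝ)])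
    exact ⟨by linarith [ht.1], by linarith [ht.2]⟩
  have hJM : ∀ n, J n ⊆ Set.Iio (x + ε) := fun n t ht => by
    have := (hJε n t ht).2
    simp only [Set.mem_Iio]; linarith
  have hdisj : ∀ m n, m < n → ∀ t, t ∈ J m → t ∉ J n := by
    intro m n hmn t htm htn
    have h1 : ε / ((n : ℝ) + 1) ≤ ε / ((m : ℝ) + 2) := by
      have : (m : ℝ) + 1 ≤ n := by exact_mod_cast hmn
      exact div_le_div_of_nonneg_left hε.le (by positivity) (by linarith)
    linarith [htm.1, htn.2]
  have hu : ∀ n, MemLp (fun k => (1 : ℂ) * shellFun i (J n) k) 2 := fun n =>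
    memLp_shellFun i (hJm n) (hJM n) measurable_const (C := 1) fun k _ => by simp
  have hv : ∀ n, MemLp (fun k => (symb k : ℂ) * shellFun i (J n) k) 2 := fun n =>
    memLp_shellFun i (hJm n) (hJM n) (C := x + ε)
      (by have := continuous_symb (d := d); fun_prop) fun k hk => by
        rw [Complex.norm_real, Real.norm_of_nonneg (symb_nonneg k)]
        exact le_of_lt (hJM n hk)
  have hcu : ∀ n, (hu n).toLp =ᵐ[volume] shellFun i (J n) := fun n => by
    filter_upwards [(hu n).coeFn_toLp] with k hk
    rw [hk, one_mul]
  have hcv : ∀ n, (hv n).toLp =ᵐ[volume] fun k => (symb k : ℂ) * shellFun i (J n) k := fun n =>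
    (hv n).coeFn_toLp
  -- odd functions are orthogonal to the radial functions `ĝ_w`
  have hdec : ∀ n, ∀ w : ℂ, w.im ≠ 0 → (c : ℂ) * inner ℂ (gL d (conj w)) (hu n).toLp = 0 := by
    intro n w hw
    rw [inner_gL (by omega) (mem_slitPlane_of_im_ne_zero hw), integral_congr_ae
      ((hcu n).mono fun k hk => by simp only [hk] : _ =ᵐ[volume]
        fun k => gHat w k * shellFun i (J n) k), integral_even_mul_shellFun, mul_zero]
    intro k
    simp [gHat, symb]
  refine ⟨fun n => (hu n).toLp, fun n => (hv n).toLp, fun n h0 => ?_, fun m n hmn => ?_, fun n => ?_,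
    fun n => ?_, fun n => ?_, fun n => specMeasure_ac_of_decoupled hd hac (hdec n)⟩
  · have hmid : (x + ε / (n + 2) + (x + ε / (n + 1))) / 2 ∈ J n := by
      have : ε / ((n : ℝ) + 2) < ε / ((n : ℝ) + 1) := by gcongr; norm_num
      constructor <;> linarith
    have hpos : 0 < (x + ε / (n + 2) + (x + ε / (n + 1))) / 2 := by
      linarith [(hJε n _ hmid).1]
    refine not_ae_shellFun_eq_zero i isOpen_Ioo hpos hmid ?_
    have h1 := hcu n
    simp only at h0
    rw [h0] at h1
    change ∀ᵐ k, shellFun i (J n) k = 0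
    filter_upwards [h1, Lp.coeFn_zero ℂ 2 (volume : Measure (Pos d))] with k h2 h3
    rw [← h2, h3]; rfl
  · simp only
    rw [L2.inner_def]
    refine integral_eq_zero_of_ae ?_
    filter_upwards [hcu m, hcu n] with k h1 h2
    rw [h1, h2, RCLike.inner_apply]
    by_cases hk : symb k ∈ J m
    · have hk' : symb k ∉ J n := by
        rcases lt_or_gt_of_ne hmn with h | h
        · exact hdisj m n h _ hk
        · exact fun h' => hdisj n m h _ h' hk
      rw [shellFun, Set.indicator_of_notMem (show k ∉ symb ⁻¹' J n from hk')]
      simp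
    · rw [shellFun, shellFun, Set.indicator_of_notMem (show k ∉ symb ⁻¹' J m from hk)]
      simp
  · refine (mem_chanOp_graph hd neg_one_mem).2 ⟨0, ?_, ?_⟩
    · filter_upwards [hcu n, hcv n] with k h1 h2
      rw [h1, h2, sub_zero]
    · have h1 := integral_even_mul_shellFun i (J n) (g := fun _ => 1) fun _ => rfl
      rw [mul_zero, integral_congr_ae ((hcu n).mono fun k hk => by simp only [hk]; ring : _ =ᵐ[volume]
        fun k => 1 * shellFun i (J n) k), h1, mul_zero]
  · refine Lp.norm_le_mul_norm_of_ae_le_mul ?_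
    filter_upwards [hcu n, hcv n, Lp.coeFn_sub (hv n).toLp ((x : ℂ) • (hu n).toLp),
      Lp.coeFn_smul (x : ℂ) (hu n).toLp] with k h1 h2 h3 h4
    rw [h3, Pi.sub_apply, h4, Pi.smul_apply, h1, h2, smul_eq_mul, ← sub_mul, norm_mul]
    by_cases hk : symb k ∈ J n
    · gcongr
      obtain ⟨h5, h6⟩ := hJε n _ hk
      rw [← Complex.ofReal_sub, Complex.norm_real, Real.norm_of_nonneg h5.le]
      exact h6.le
    · rw [shellFun, Set.indicator_of_notMem (show k ∉ symb ⁻¹' J n from hk)]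
      simp
  · obtain ⟨ν, -, -, hν, he⟩ := specMeasure_of_decoupled (a := a) (c := c) hd hac (hdec n)
    have hm : MeasurableSet {t : ℝ | ‖(t : ℂ) - x‖ < ε}ᶜ :=
      (measurableSet_lt (by fun_prop) measurable_const).compl
    rw [he, Measure.map_apply continuous_symb.measurable hm]
    refine hν _ (continuous_symb.measurable hm) ?_
    filter_upwards [hcu n] with k h1 hk
    rw [h1, shellFun, Set.indicator_of_notMem]
    intro hkJ
    obtain ⟨h5, h6⟩ := hJε n _ hkJ
    refine hk ?_
    simp only [Set.mem_ofPred_eq]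
    rw [← Complex.ofReal_sub, Complex.norm_real, Real.norm_of_nonneg h5.le]
    exact h6

end Shells

/-! ### Orthogonal sums of shifted operators -/

section DirectSum

open scoped ComplexConjugate

variable {ι K : Type*} [Fintype ι] [NormedAddCommGroup K] [InnerProductSpace ℂ K]

/-- `A` is unitarily equivalent, by `U` in each component, to the orthogonal sum of the operators
`T + b i`. -/
def IsShiftedSum (A : PiLp 2 (fun _ : ι => K) →ₗ.[ℂ] PiLp 2 (fun _ : ι => K))
    (T : K →ₗ.[ℂ] K) (U : K ≃ₗᵢ[ℂ] K) (b : ι → ℝ) : Prop :=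
  ∀ p, p ∈ A.graph ↔ ∀ i, (U (p.1 i), U (p.2 i) - (b i : ℂ) • U (p.1 i)) ∈ T.graph

/-- The resolvent of a sum of shifted operators. -/
def sumResolvent (R : ℂ → K →L[ℂ] K) (U : K ≃ₗᵢ[ℂ] K) (b : ι → ℝ) (z : ℂ) :
    PiLp 2 (fun _ : ι => K) →L[ℂ] PiLp 2 (fun _ : ι => K) :=
  ((PiLp.continuousLinearEquiv 2 ℂ (fun _ : ι => K)).symm : (ι → K) →L[ℂ] _).comp
    (ContinuousLinearMap.pi fun i => ((U.symm : K →L[ℂ] K).comp (R (z - b i))).comp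
      ((U : K →L[ℂ] K).comp (PiLp.proj 2 (fun _ : ι => K) i)))

omit [Fintype ι] in
@[simp] lemma sumResolvent_apply (R : ℂ → K →L[ℂ] K) (U : K ≃ₗᵢ[ℂ] K) (b : ι → ℝ) (z : ℂ)
    (x : PiLp 2 (fun _ : ι => K)) (i : ι) :
    sumResolvent R U b z x i = U.symm (R (z - b i) (U (x i))) := rfl

namespace IsShiftedSum

variable {A : PiLp 2 (fun _ : ι => K) →ₗ.[ℂ] PiLp 2 (fun _ : ι => K)} {T : K →ₗ.[ℂ] K}
  {U : K ≃ₗᵢ[ℂ] K} {b : ι → ℝ} (hS : IsShiftedSum A T U b)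
  {ρ : Set ℂ} {R : ℂ → K →L[ℂ] K} (hT : IsResolventFamily T ρ R)
  (hreal : ∃ s : ℝ, ∀ i, ((s - b i : ℝ) : ℂ) ∈ ρ)

include hS

include hT hreal in
theorem isResolventFamily :
    IsResolventFamily A {z | ∀ i, z - b i ∈ ρ} (sumResolvent R U b) where
  mem_of_im_ne_zero z hz i := hT.mem_of_im_ne_zero _ (by simpa using hz)
  exists_real := by
    obtain ⟨s, hs⟩ := hreal
    exact ⟨s, fun i => by simpa using hs i⟩
  mem_graph z hz y := by
    refine (hS _).2 fun i => ?_
    have h := hT.mem_graph _ (hz i) (U (y i))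
    have he : U ((y + z • sumResolvent R U b z y) i) - (b i : ℂ) • U (sumResolvent R U b z y i)
        = U (y i) + (z - b i) • R (z - b i) (U (y i)) := by
      rw [PiLp.add_apply, PiLp.smul_apply, sumResolvent_apply, map_add, map_smul,
        LinearIsometryEquiv.apply_symm_apply, sub_smul]
      abel
    simp only
    rw [he, sumResolvent_apply, LinearIsometryEquiv.apply_symm_apply]
    exact h
  left_inv z hz p hp := by
    ext i
    have h := hT.left_inv _ (hz i) _ ((hS p).1 hp i)
    have he : U ((p.2 - z • p.1) i) = (U (p.2 i) - (b i : ℂ) • U (p.1 i)) - (z - b i) • U (p.1 i) := by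
      rw [PiLp.sub_apply, PiLp.smul_apply, map_sub, map_smul, sub_smul]
      abel
    rw [sumResolvent_apply, he, h, LinearIsometryEquiv.symm_apply_apply]
  inner_left z hz x y := by
    rw [PiLp.inner_apply, PiLp.inner_apply]
    refine Finset.sum_congr rfl fun i _ => ?_
    rw [sumResolvent_apply, sumResolvent_apply, LinearIsometryEquiv.inner_map_eq_flip U.symm,
      LinearIsometryEquiv.symm_symm, hT.inner_left _ (hz i), LinearIsometryEquiv.inner_map_eq_flip U,
      map_sub, Complex.conj_ofReal]

lemma mem_opEigenspace_iff {z : ℂ} {x : PiLp 2 (fun _ : ι => K)} :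
    x ∈ opEigenspace A z ↔ ∀ i, U (x i) ∈ opEigenspace T (z - b i) := by
  refine (hS (x, z • x)).trans (forall_congr' fun i => ?_)
  have he : U ((z • x) i) - (b i : ℂ) • U (x i) = (z - b i) • U (x i) := by
    rw [PiLp.smul_apply, map_smul, sub_smul]
  simp only
  rw [he]
  rfl

lemma toLp_single_mem_opEigenspace [DecidableEq ι] {z : ℂ} {i : ι} {x : K}
    (hx : x ∈ opEigenspace T (z - b i)) :
    WithLp.toLp 2 (Pi.single i (U.symm x)) ∈ opEigenspace A z := by
  rw [hS.mem_opEigenspace_iff]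
  intro j
  by_cases h : j = i
  · subst h
    simpa using hx
  · have : (WithLp.toLp 2 (Pi.single i (U.symm x)) : PiLp 2 (fun _ : ι => K)) j = 0 := by
      simp [h]
    rw [this, map_zero]
    exact zero_mem _

lemma opEigenspace_eq_bot_iff {z : ℂ} :
    opEigenspace A z = ⊥ ↔ ∀ i, opEigenspace T (z - b i) = ⊥ := by
  classical
  constructor
  · intro h i
    rw [eq_bot_iff]
    intro x hx
    have h1 := hS.toLp_single_mem_opEigenspace hx
    rw [h, Submodule.mem_bot] at h1
    have h2 := congrArg (fun y : PiLp 2 (fun _ : ι => K) => y i) h1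
    simpa using h2
  · intro h
    rw [eq_bot_iff]
    intro x hx
    rw [Submodule.mem_bot]
    ext i
    have h1 := hS.mem_opEigenspace_iff.1 hx i
    rw [h i, Submodule.mem_bot] at h1
    simpa using h1

/-- The components of an eigenvector are eigenvectors. -/
def eigenComponent (z : ℂ) (i : ι) : opEigenspace A z →ₗ[ℂ] opEigenspace T (z - b i) where
  toFun x := ⟨U ((x : PiLp 2 (fun _ : ι => K)) i), hS.mem_opEigenspace_iff.1 x.2 i⟩
  map_add' x y := Subtype.ext (by simp)
  map_smul' c x := Subtype.ext (by simp)

/-- If only the component `i` has the eigenvalue, the eigenspaces have the same dimension. -/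
lemma finrank_opEigenspace {z : ℂ} {i : ι} (h : ∀ j, j ≠ i → opEigenspace T (z - b j) = ⊥) :
    Module.finrank ℂ (opEigenspace A z) = Module.finrank ℂ (opEigenspace T (z - b i)) := by
  classical
  let f := hS.eigenComponent z i
  have hf : ∀ x : opEigenspace A z, (f x : K) = U ((x : PiLp 2 (fun _ : ι => K)) i) := fun x => rfl
  refine (LinearEquiv.ofBijective f ⟨?_, ?_⟩).finrank_eq
  · rw [injective_iff_map_eq_zero]
    intro x hx
    have h0 : U ((x : PiLp 2 (fun _ : ι => K)) i) = 0 := by rw [← hf, hx]; rfl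
    refine Subtype.ext ?_
    ext j
    by_cases hj : j = i
    · subst hj; simpa using h0
    · have h1 := hS.mem_opEigenspace_iff.1 x.2 j
      rw [h j hj, Submodule.mem_bot] at h1
      simpa using h1
  · rintro ⟨y, hy⟩
    refine ⟨⟨_, hS.toLp_single_mem_opEigenspace hy⟩, Subtype.ext ?_⟩
    rw [hf]
    simp

variable [CompleteSpace K]

include hT hreal

/-- The spectral measures of the sum are sums of shifted spectral measures of the components. -/
lemma specMeasure_eq_sum (ψ : PiLp 2 (fun _ : ι => K)) :
    specMeasure A ψ = ∑ i, (specMeasure T (U (ψ i))).map (fun t => t + b i) := by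
  refine (hS.isResolventFamily hT hreal).specMeasure_eq
    ((hS.isResolventFamily hT hreal).isSpectralMeasure_iff.2 ⟨?_, fun z hz => ?_⟩)
  · infer_instance
  · rw [integral_finsetSum_measure, PiLp.inner_apply]
    · refine Finset.sum_congr rfl fun i _ => ?_
      rw [integral_map (by fun_prop) ((by fun_prop : Measurable fun t : ℝ =>
        ((t : ℂ) - z)⁻¹).aestronglyMeasurable), sumResolvent_apply,
        ← LinearIsometryEquiv.inner_map_eq_flip U, hT.inner_resolvent_eq _ (by simpa using hz)]
      refine integral_congr_ae (Eventually.of_forall fun t => ?_)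
      simp only
      congr 1; push_cast; ring
    · intro i _
      exact integrable_inv_ofReal_sub _ hz

lemma specMeasure_eq_zero_iff (ψ : PiLp 2 (fun _ : ι => K)) (B : Set ℝ) :
    specMeasure A ψ B = 0 ↔ ∀ i, specMeasure T (U (ψ i)) ((fun t => t + b i) ⁻¹' B) = 0 := by
  rw [hS.specMeasure_eq_sum hT hreal, Measure.finsetSum_apply, Finset.sum_eq_zero_iff]
  simp only [Finset.mem_univ, true_imp_iff]
  refine forall_congr' fun i => ?_
  rw [show (fun t => t + b i) = MeasurableEquiv.addRight (b i) from rfl, MeasurableEquiv.map_apply]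

theorem isACAbove {m : ℝ} (hm : ∀ i, m ≤ b i) (h : IsACAbove T 0) : IsACAbove A m := by
  have hshift : ∀ (x : ℝ) (i : ι), ((x - b i : ℝ) : ℂ) = (x : ℂ) - b i := fun x i => by push_cast; rfl
  have hpre : ∀ (B : Set ℝ) (i : ι), (∀ x ∈ B, opEigenspace A (x : ℂ) = ⊥) →
      ∀ t ∈ (fun t => t + b i) ⁻¹' B, opEigenspace T (t : ℂ) = ⊥ := by
    intro B i hB t ht
    have := hS.opEigenspace_eq_bot_iff.1 (hB _ ht) i
    rwa [← hshift, add_sub_cancel_right] at this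
  refine ⟨?_, fun e => ?_, fun ψ B hB hBe => ?_, fun ψ B hB hBe => ?_⟩
  · have hfin : (⋃ i, (fun t => t + b i) '' {e : ℝ | opEigenspace T (e : ℂ) ≠ ⊥}).Finite :=
      Set.finite_iUnion fun i => h.finite.image _
    refine hfin.subset fun e he => ?_
    have he' : ¬ opEigenspace A (e : ℂ) = ⊥ := he
    rw [hS.opEigenspace_eq_bot_iff] at he'
    push Not at he'
    obtain ⟨i, hi⟩ := he'
    rw [← hshift] at hi
    exact Set.mem_iUnion.2 ⟨i, e - b i, hi, by simp⟩
  · have hfd : ∀ i, FiniteDimensional ℂ (opEigenspace T ((e : ℂ) - b i)) := fun i => by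
      rw [← hshift]; exact h.finiteDimensional _
    let f : opEigenspace A (e : ℂ) →ₗ[ℂ] ∀ i, opEigenspace T ((e : ℂ) - b i) :=
      LinearMap.pi fun i => hS.eigenComponent e i
    refine Module.Finite.of_injective f ?_
    rw [injective_iff_map_eq_zero]
    intro x hx
    refine Subtype.ext ?_
    ext i
    have h1 : U ((x : PiLp 2 (fun _ : ι => K)) i) = 0 := congrArg Subtype.val (congrFun hx i)
    simpa using h1
  · rw [hS.specMeasure_eq_zero_iff hT hreal]
    intro i
    refine h.null _ _ ?_ (hpre B i hBe)
    rw [measure_preimage_add_right, hB]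
  · rw [hS.specMeasure_eq_zero_iff hT hreal]
    intro i
    refine h.below _ _ (fun t ht => ?_) (hpre B i hBe)
    have h1 : t + b i < m := hB ht
    have h2 := hm i
    simp only [Set.mem_Iio]; linarith

theorem hasShells {m : ℝ} {i : ι} (hi : b i = m) (h : HasShells T 0) : HasShells A m := by
  classical
  intro x hx ε hε
  obtain ⟨u, v, h1, h2, h3, h4, h5, h6⟩ := h (x - m) (by linarith) ε hε
  have hne : ∀ (y : K) (j : ι), j ≠ i →
      (WithLp.toLp 2 (Pi.single i y) : PiLp 2 (fun _ : ι => K)) j = 0 := fun y j hj => by simp [hj]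
  have heq : ∀ y : K, (WithLp.toLp 2 (Pi.single i y) : PiLp 2 (fun _ : ι => K)) i = y :=
    fun y => by simp
  have hnorm : ∀ y : K, ‖(WithLp.toLp 2 (Pi.single i y) : PiLp 2 (fun _ : ι => K))‖ = ‖y‖ :=
    fun y => PiLp.norm_single 2 (fun _ : ι => K) i y
  have hzero : specMeasure T (0 : K) = 0 := by
    have := hT.specMeasure_smul 0 0
    simpa using this
  have hspec : ∀ (y : K) (B : Set ℝ), specMeasure T y ((fun t => t + b i) ⁻¹' B) = 0 →
      specMeasure A (WithLp.toLp 2 (Pi.single i (U.symm y))) B = 0 := by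
    intro y B hB
    rw [hS.specMeasure_eq_zero_iff hT hreal]
    intro j
    by_cases hj : j = i
    · subst hj
      rw [heq, LinearIsometryEquiv.apply_symm_apply]
      exact hB
    · rw [hne _ j hj, map_zero, hzero]; rfl
  refine ⟨fun n => WithLp.toLp 2 (Pi.single i (U.symm (u n))),
    fun n => WithLp.toLp 2 (Pi.single i (U.symm (v n + (m : ℂ) • u n))), fun n h0 => ?_,
    fun j k hjk => ?_, fun n => ?_, fun n => ?_, fun n => ?_, fun n => ?_⟩
  · have := congrArg (fun y : PiLp 2 (fun _ : ι => K) => y i) h0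
    simp only at this
    exact h1 n (by simpa using this)
  · simp only
    rw [PiLp.inner_apply, Finset.sum_eq_single i]
    · rw [heq, heq, LinearIsometryEquiv.inner_map_map]
      exact h2 hjk
    · intro l _ hl
      rw [hne _ l hl, inner_zero_left]
    · simp
  · refine (hS _).2 fun j => ?_
    by_cases hj : j = i
    · subst hj
      simp only [Pi.single_eq_same]
      rw [LinearIsometryEquiv.apply_symm_apply, LinearIsometryEquiv.apply_symm_apply, hi,
        add_sub_cancel_right]
      exact h3 n
    · simp only [Pi.single_eq_of_ne hj]
      rw [map_zero, smul_zero, sub_zero]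
      exact T.graph.zero_mem
  · have he : (WithLp.toLp 2 (Pi.single i (U.symm (v n + (m : ℂ) • u n))) -
        (x : ℂ) • WithLp.toLp 2 (Pi.single i (U.symm (u n))) : PiLp 2 (fun _ : ι => K))
        = WithLp.toLp 2 (Pi.single i (U.symm (v n - ((x - m : ℝ) : ℂ) • u n))) := by
      rw [← WithLp.toLp_smul, ← WithLp.toLp_sub, ← Pi.single_smul, ← Pi.single_sub, ← map_smul,
        ← map_sub]
      congr 3
      push_cast
      rw [sub_smul]; abel
    simp only
    rw [he, hnorm, hnorm, LinearIsometryEquiv.norm_map, LinearIsometryEquiv.norm_map]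
    exact h4 n
  · refine hspec _ _ ?_
    have : (fun t => t + b i) ⁻¹' {t : ℝ | ‖(t : ℂ) - x‖ < ε}ᶜ
        = {t : ℝ | ‖(t : ℂ) - ((x - m : ℝ) : ℂ)‖ < ε}ᶜ := by
      ext t
      simp only [Set.mem_preimage, Set.mem_compl_iff, Set.mem_ofPred_eq, hi]
      rw [show (((t + m : ℝ) : ℂ) - x) = (t : ℂ) - ((x - m : ℝ) : ℂ) by push_cast; ring]
    rw [this]
    exact h5 n
  · intro B hB
    refine hspec _ _ (h6 n ?_)
    rw [measure_preimage_add_right, hB]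

end IsShiftedSum

end DirectSum

/-! ### The Hamiltonian as a sum of shifted point interactions -/

section Hamiltonian

open FourierTransform

variable {d : ℕ}

/-- The boundary condition of the Hamiltonian reads `bcCharge * q = bcValue * f`. -/
def bcCharge (d : ℕ) (α : ℝ) : ℝ := if d = 1 then 1 else α

/-- The coefficient of the regular value in the boundary condition, see `bcCharge`. -/
def bcValue (d : ℕ) (α : ℝ) : ℝ := if d = 1 then -α else 1

lemma bc_ne_zero (d : ℕ) (α : ℝ) : bcCharge d α ≠ 0 ∨ bcValue d α ≠ 0 := by
  unfold bcCharge bcValue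
  split <;> simp

lemma boundaryCondition_iff {α : ℝ} {q f : ℂ} :
    BoundaryCondition d α q f ↔ (bcCharge d α : ℂ) * q = bcValue d α * f := by
  unfold BoundaryCondition bcCharge bcValue
  split
  · simp
  · rename_i h
    rw [if_neg h, if_neg h]; simp

lemma fourier_sub_smul_fourierInv (x g : L2 d) (t : ℂ) :
    (𝓕 (x - t • 𝓕⁻ g : L2 d) : L2 d) = 𝓕 x - t • g := by
  have h := (Lp.fourierTransformₗᵢ (Pos d) ℂ).map_sub x (t • 𝓕⁻ g)
  rw [map_smul] at h
  have h2 : (𝓕 (𝓕⁻ g : L2 d) : L2 d) = g := fourier_fourierInv_eq g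
  exact h.trans (congrArg (fun y : L2 d => 𝓕 x - t • y) h2)

/-- Subtracting the singular part from an element of the domain of a point interaction leaves an
element of `H²`. -/
lemma sobolev_sub_green_iff (hd : d < 4) {z : ℂ} {b : ℝ} (hw : -(z - b) ∈ Complex.slitPlane)
    {u v : L2 d} {q : ℂ} :
    (TemperedDistribution.MemSobolev 2 2 ((u - q • 𝓕⁻ (gL d (z - b)) : L2 d) : 𝓢'(Pos d, ℂ)) ∧
      ((v - (z * q) • 𝓕⁻ (gL d (z - b)) : L2 d) : 𝓢'(Pos d, ℂ)) =
        -Δ ((u - q • 𝓕⁻ (gL d (z - b)) : L2 d) : 𝓢'(Pos d, ℂ))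
          + (b : ℂ) • ((u - q • 𝓕⁻ (gL d (z - b)) : L2 d) : 𝓢'(Pos d, ℂ))) ↔
    (𝓕 v - (b : ℂ) • 𝓕 u : L2 d) =ᵐ[volume] fun k => symb k * (𝓕 u : L2 d) k - q := by
  rw [sobolev_laplacian_iff]
  rw [fourier_sub_smul_fourierInv, fourier_sub_smul_fourierInv]
  refine eventually_congr ?_
  filter_upwards [coeFn_gL hd hw, Lp.coeFn_sub (𝓕 v) ((z * q) • gL d (z - b)),
    Lp.coeFn_sub (𝓕 u) (q • gL d (z - b)), Lp.coeFn_smul (z * q) (gL d (z - b)),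
    Lp.coeFn_smul q (gL d (z - b)), Lp.coeFn_sub (𝓕 v) ((b : ℂ) • 𝓕 u),
    Lp.coeFn_smul (b : ℂ) (𝓕 u)] with k h1 h2 h3 h4 h5 h6 h7
  rw [h2, h3, h6, Pi.sub_apply, Pi.sub_apply, Pi.sub_apply, h4, h5, h7, Pi.smul_apply,
    Pi.smul_apply, Pi.smul_apply, h1]
  simp only [smul_eq_mul]
  have h8 : ((symb k : ℂ) - (z - b)) * gHat (z - b) k = 1 :=
    mul_inv_cancel₀ (symb_sub_ne_zero hw k)
  constructor
  · intro h
    linear_combination h - q * h8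
  · intro h
    linear_combination h + q * h8

/-- The regular value of an element of the domain of a point interaction. -/
lemma hasRegularValue_iff (hd : d = 1 ∨ d = 2 ∨ d = 3) {w : ℂ} (hw : -w ∈ Complex.slitPlane)
    {u φ : L2 d} {q f : ℂ} (h : φ =ᵐ[volume] fun k => symb k * (𝓕 u : L2 d) k - q) :
    HasRegularValue d u q f ↔
      f = (∫ k, ((𝓕 u : L2 d) k - q * gHat w k)) + q * regVal d w := by
  have hd4 : d < 4 := by omega
  have hae : (𝓕 (u - q • 𝓕⁻ (gL d w) : L2 d) : L2 d)
      =ᵐ[volume] fun k => (𝓕 u : L2 d) k - q * gHat w k := by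
    rw [fourier_sub_smul_fourierInv]
    filter_upwards [coeFn_gL hd4 hw, Lp.coeFn_sub (𝓕 u) (q • gL d w),
      Lp.coeFn_smul q (gL d w)] with k h1 h2 h3
    rw [h2, Pi.sub_apply, h3, Pi.smul_apply, h1, smul_eq_mul]
  -- the zero boundary condition is satisfied by every charge
  have hchan : IsChan d 0 0 w (𝓕 u) φ q := ⟨h, by simp [kreinD]⟩
  have hint : Integrable (𝓕 (u - q • 𝓕⁻ (gL d w) : L2 d) : L2 d) :=
    (integrable_gHat_mul hd4 hw _).congr (hae.trans (hchan.ae_eq hw)).symm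
  have h1 := (hasRegularValue_of_integrable _ hint).add ((hasRegularValue_gL hd hw).smul q)
  rw [sub_add_cancel, zero_add, mul_one, integral_congr_ae hae] at h1
  exact ⟨fun h2 => h2.unique (by omega) h1, fun h2 => h2 ▸ h1⟩

/-- In Fourier space, the component `σ` of the Hamiltonian is a point interaction shifted by
`b = σβ`. -/
theorem mem_chanOp_graph_iff (hd : d = 1 ∨ d = 2 ∨ d = 3) {z : ℂ} {b : ℝ} (α : ℝ)
    (hw : -(z - b) ∈ Complex.slitPlane) {u v : L2 d} :
    (𝓕 u, 𝓕 v - (b : ℂ) • 𝓕 u) ∈ (chanOp d (bcCharge d α) (bcValue d α)).graph ↔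
    ∃ (r s : L2 d) (q f : ℂ),
      (TemperedDistribution.MemSobolev 2 2 (r : 𝓢'(Pos d, ℂ)) ∧
        (s : 𝓢'(Pos d, ℂ)) = -Δ (r : 𝓢'(Pos d, ℂ)) + (b : ℂ) • (r : 𝓢'(Pos d, ℂ))) ∧
      (u =ᵐ[volume] fun x => r x + q * green d (z - b) ‖x‖) ∧
      (v =ᵐ[volume] fun x => s x + z * (q * green d (z - b) ‖x‖)) ∧
      HasRegularValue d u q f ∧ BoundaryCondition d α q f := by
  have hd4 : d < 4 := by omega
  have hsub : ∀ (x y : L2 d) (t : ℂ), x = y - t • 𝓕⁻ (gL d (z - b)) ↔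
      y =ᵐ[volume] fun k => x k + t * green d (z - b) ‖k‖ := by
    intro x y t
    rw [eq_sub_iff_add_eq, eq_comm, Lp.ext_iff]
    refine eventually_congr ?_
    filter_upwards [green_ae_eq hd hw, Lp.coeFn_add x (t • 𝓕⁻ (gL d (z - b))),
      Lp.coeFn_smul t (𝓕⁻ (gL d (z - b)) : L2 d)] with k h1 h2 h3
    rw [h2, Pi.add_apply, h3, Pi.smul_apply, smul_eq_mul, h1]
  rw [mem_chanOp_graph hd hw]
  constructor
  · rintro ⟨q, h1, h2⟩
    simp only at h1 h2
    refine ⟨u - q • 𝓕⁻ (gL d (z - b)), v - (z * q) • 𝓕⁻ (gL d (z - b)), q, _,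
      (sobolev_sub_green_iff hd4 hw).2 h1, (hsub _ _ _).1 rfl, ?_,
      (hasRegularValue_iff hd hw h1).2 rfl, ?_⟩
    · simpa only [mul_assoc] using (hsub _ v (z * q)).1 rfl
    · rw [boundaryCondition_iff, mul_add, ← h2]
      simp only [kreinD]; ring
  · rintro ⟨r, s, q, f, h1, h2, h3, h4, h5⟩
    simp only [← mul_assoc] at h3
    obtain rfl := (hsub _ _ _).2 h2
    obtain rfl := (hsub _ _ _).2 h3
    have h6 := (sobolev_sub_green_iff hd4 hw).1 h1
    refine ⟨q, h6, ?_⟩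
    rw [boundaryCondition_iff, (hasRegularValue_iff hd hw h6).1 h4, mul_add] at h5
    simp only [kreinD]
    linear_combination h5

/-- The shift `σβ` of the component `σ`. -/
def channelShift (β : ℝ) (σ : ℤˣ) : ℝ := ((σ : ℤ) : ℝ) * β

lemma ofReal_channelShift (β : ℝ) (σ : ℤˣ) : (channelShift β σ : ℂ) = sgn σ * β := by
  simp [channelShift, sgn]

lemma channelShift_one (β : ℝ) : channelShift β 1 = β := by simp [channelShift]

lemma channelShift_neg_one (β : ℝ) : channelShift β (-1) = -β := by simp [channelShift]

lemma im_sub_channelShift {z : ℂ} (β : ℝ) (σ : ℤˣ) :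
    (z - channelShift β σ : ℂ).im = z.im := by simp

lemma mem_hamiltonianGraph_iff (hd : d = 1 ∨ d = 2 ∨ d = 3) {α β : ℝ} {z : ℂ} (hz : z.im ≠ 0)
    (p : StateSpace d × StateSpace d) : p ∈ hamiltonianGraph d α β z ↔
      ∀ σ, (𝓕 (p.1 σ), 𝓕 (p.2 σ) - (channelShift β σ : ℂ) • 𝓕 (p.1 σ)) ∈
        (chanOp d (bcCharge d α) (bcValue d α)).graph := by
  have hw : ∀ σ, -(z - channelShift β σ) ∈ Complex.slitPlane := fun σ =>
    mem_slitPlane_of_im_ne_zero (by rwa [im_sub_channelShift])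
  simp only [mem_chanOp_graph_iff hd α (hw _)]
  simp only [ofReal_channelShift]
  constructor
  · rintro ⟨r, hr, q, f, h⟩ σ
    exact ⟨r.1 σ, r.2 σ, q σ, f σ, hr σ, h σ⟩
  · intro h
    choose r s q f hr h using h
    exact ⟨(WithLp.toLp 2 r, WithLp.toLp 2 s), hr, q, f, h⟩

lemma hamiltonian_graph (hd : d = 1 ∨ d = 2 ∨ d = 3) {α β : ℝ} {z : ℂ} (hz : z.im ≠ 0) :
    (hamiltonian d α β z).graph = hamiltonianGraph d α β z := by
  refine Submodule.toLinearPMap_graph_eq _ ?_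
  rintro ⟨x, y⟩ hx h0
  simp only at h0
  subst h0
  have h := (mem_hamiltonianGraph_iff hd hz _).1 hx
  ext1 σ
  have h1 := h σ
  have hF0 : (𝓕 (0 : L2 d) : L2 d) = 0 := (Lp.fourierTransformₗᵢ (Pos d) ℂ).map_zero
  simp only [PiLp.zero_apply, hF0, smul_zero, sub_zero] at h1 ⊢
  have h2 := LinearPMap.graph_fst_eq_zero_snd _ h1 rfl
  exact (Lp.fourierTransformₗᵢ (Pos d) ℂ).map_eq_zero_iff.1 h2

theorem isShiftedSum_hamiltonian (hd : d = 1 ∨ d = 2 ∨ d = 3) {α β : ℝ} {z : ℂ}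
    (hz : z.im ≠ 0) :
    IsShiftedSum (hamiltonian d α β z) (chanOp d (bcCharge d α) (bcValue d α))
      (Lp.fourierTransformₗᵢ (Pos d) ℂ) (channelShift β) := fun p => by
  rw [hamiltonian_graph hd hz]
  exact mem_hamiltonianGraph_iff hd hz p

/-- Krein's denominator has at most one zero on the negative half-line, so a point far to the left
lies in the resolvent sets of all shifted channels. -/
lemma exists_forall_mem_chanSet (hd : d = 1 ∨ d = 2 ∨ d = 3) {a c : ℝ} (hac : a ≠ 0 ∨ c ≠ 0)
    (β : ℝ) : ∃ s : ℝ, ∀ σ, ((s - channelShift β σ : ℝ) : ℂ) ∈ chanSet d a c := by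
  have hshift : ∀ σ, |channelShift β σ| ≤ |β| := fun σ => by
    rcases Int.units_eq_one_or σ with rfl | rfl
    · rw [channelShift_one]
    · rw [channelShift_neg_one, abs_neg]
  obtain ⟨m, hm0, hm⟩ : ∃ m : ℝ, m ≤ 0 ∧ ∀ x : ℝ, x < m → kreinD d a c x ≠ 0 := by
    by_cases h : ∃ x : ℝ, x < 0 ∧ kreinD d a c x = 0
    · obtain ⟨x, hx, hD⟩ := h
      refine ⟨x, hx.le, fun y hy hy0 => hy.ne ?_⟩
      exact eq_of_kreinD_eq_zero hd hac (hy.trans hx) hx hy0 hD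
    · push Not at h
      exact ⟨0, le_rfl, h⟩
  refine ⟨m - |β| - 1, fun σ => ?_⟩
  have h1 : m - |β| - 1 - channelShift β σ < m := by
    have := (abs_le.1 (hshift σ)).1
    linarith
  exact ⟨mem_slitPlane_of_neg (h1.trans_le hm0), hm _ h1⟩

end Hamiltonian

/-! ### Bound states of a single channel -/

section BoundStates

variable {α : ℝ}

lemma kreinD_neg_sq (d : ℕ) (a c : ℝ) {s : ℝ} (hs : 0 < s) :
    kreinD d a c (-(s : ℂ) ^ 2) = a - c * regK d s := by
  rw [kreinD, regVal, kap_ofReal hs]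

lemma exists_eq_neg_sq {e : ℝ} (he : e < 0) : ∃ s : ℝ, 0 < s ∧ e = -s ^ 2 :=
  ⟨√(-e), Real.sqrt_pos.2 (by linarith), by rw [Real.sq_sqrt (by linarith), neg_neg]⟩

lemma kreinD_one_eq_zero_iff {e : ℝ} (he : e < 0) :
    kreinD 1 (bcCharge 1 α) (bcValue 1 α) e = 0 ↔ α < 0 ∧ e = -(α ^ 2 / 4) := by
  obtain ⟨s, hs, rfl⟩ := exists_eq_neg_sq he
  have h1 : kreinD 1 (bcCharge 1 α) (bcValue 1 α) ((-s ^ 2 : ℝ) : ℂ)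
      = ((1 + α * (1 / (2 * s)) : ℝ) : ℂ) := by
    push_cast
    rw [kreinD_neg_sq 1 _ _ hs]
    simp [bcCharge, bcValue, regK]
  have h2 : 1 + α * (1 / (2 * s)) = 0 ↔ α = -(2 * s) := by
    field_simp
    constructor <;> intro h <;> linarith
  rw [h1, Complex.ofReal_eq_zero, h2]
  constructor
  · rintro rfl
    exact ⟨by linarith, by ring⟩
  · rintro ⟨h3, h4⟩
    nlinarith

lemma muOf_pos (α : ℝ) : 0 < muOf α := by unfold muOf; positivity

lemma kreinD_two_eq_zero_iff {e : ℝ} (he : e < 0) :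
    kreinD 2 (bcCharge 2 α) (bcValue 2 α) e = 0 ↔ e = -(1 / muOf α) := by
  obtain ⟨s, hs, rfl⟩ := exists_eq_neg_sq he
  have hπ := Real.pi_pos
  set γ := Real.eulerMascheroniConstant with hγ
  have h1 : kreinD 2 (bcCharge 2 α) (bcValue 2 α) ((-s ^ 2 : ℝ) : ℂ)
      = ((α + (Real.log (s / 2) + γ) / (2 * Real.pi) : ℝ) : ℂ) := by
    push_cast
    rw [kreinD_neg_sq 2 _ _ hs]
    simp only [bcCharge, bcValue, regK]
    rw [Complex.ofReal_log (by positivity)]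
    push_cast
    simp
    ring
  have h2 : α + (Real.log (s / 2) + γ) / (2 * Real.pi) = 0 ↔
      Real.log ((s / 2) ^ 2) = -(2 * (γ + 2 * Real.pi * α)) := by
    rw [Real.log_pow]
    push_cast
    field_simp
    constructor <;> intro h <;> linarith
  have h3 : muOf α = Real.exp (2 * (γ + 2 * Real.pi * α)) / 4 := rfl
  rw [h1, Complex.ofReal_eq_zero, h2, h3, neg_inj]
  constructor
  · intro h
    have h4 : (s / 2) ^ 2 = Real.exp (-(2 * (γ + 2 * Real.pi * α))) := by
      rw [← h, Real.exp_log (by positivity)]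
    rw [Real.exp_neg] at h4
    rw [one_div_div]
    field_simp at h4 ⊢
    linarith
  · intro h
    have h4 : (s / 2) ^ 2 = Real.exp (-(2 * (γ + 2 * Real.pi * α))) := by
      rw [div_pow, h, Real.exp_neg]
      field_simp
      norm_num
    rw [h4, Real.log_exp]

lemma kreinD_three_eq_zero_iff {e : ℝ} (he : e < 0) :
    kreinD 3 (bcCharge 3 α) (bcValue 3 α) e = 0 ↔ α < 0 ∧ e = -((4 * Real.pi * α) ^ 2) := by
  obtain ⟨s, hs, rfl⟩ := exists_eq_neg_sq he
  have hπ := Real.pi_pos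
  have h1 : kreinD 3 (bcCharge 3 α) (bcValue 3 α) ((-s ^ 2 : ℝ) : ℂ)
      = ((α + s / (4 * Real.pi) : ℝ) : ℂ) := by
    push_cast
    rw [kreinD_neg_sq 3 _ _ hs]
    simp [bcCharge, bcValue, regK]
    ring
  have h2 : α + s / (4 * Real.pi) = 0 ↔ s = -(4 * Real.pi * α) := by
    field_simp
    constructor <;> intro h <;> linarith
  rw [h1, Complex.ofReal_eq_zero, h2]
  constructor
  · rintro rfl
    refine ⟨?_, by ring⟩
    by_contra! h
    have := mul_nonneg (mul_nonneg (by norm_num : (0 : ℝ) ≤ 4) hπ.le) h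
    linarith
  · rintro ⟨h3, h4⟩
    have h5 : 0 < -(4 * Real.pi * α) := by
      have := mul_pos (mul_pos (by norm_num : (0 : ℝ) < 4) hπ) (neg_pos.2 h3)
      linarith
    rw [← sq_eq_sq₀ hs.le h5.le]
    linarith [neg_sq (4 * Real.pi * α)]

end BoundStates

/-! ### The spectra of the Hamiltonian -/

section Assembly

variable {d : ℕ} {α β : ℝ} {z : ℂ}

theorem isResolventFamily_hamiltonian (hd : d = 1 ∨ d = 2 ∨ d = 3) (hz : z.im ≠ 0) :
    IsResolventFamily (hamiltonian d α β z)
      {w | ∀ σ, w - channelShift β σ ∈ chanSet d (bcCharge d α) (bcValue d α)}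
      (sumResolvent (kreinR d (bcCharge d α) (bcValue d α))
        (Lp.fourierTransformₗᵢ (Pos d) ℂ) (channelShift β)) :=
  (isShiftedSum_hamiltonian hd hz).isResolventFamily
    (isResolventFamily_chanOp hd (bc_ne_zero d α)) (exists_forall_mem_chanSet hd (bc_ne_zero d α) β)

theorem isACAbove_hamiltonian (hd : d = 1 ∨ d = 2 ∨ d = 3) (hβ : 0 < β) (hz : z.im ≠ 0) :
    IsACAbove (hamiltonian d α β z) (-β) := by
  refine (isShiftedSum_hamiltonian hd hz).isACAbove
    (isResolventFamily_chanOp hd (bc_ne_zero d α)) (exists_forall_mem_chanSet hd (bc_ne_zero d α) β)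
    (fun σ => ?_) (isACAbove_chanOp hd (bc_ne_zero d α))
  rcases Int.units_eq_one_or σ with rfl | rfl
  · rw [channelShift_one]; linarith
  · rw [channelShift_neg_one]

theorem hasShells_hamiltonian (hd : d = 1 ∨ d = 2 ∨ d = 3) (hz : z.im ≠ 0) :
    HasShells (hamiltonian d α β z) (-β) :=
  (isShiftedSum_hamiltonian hd hz).hasShells
    (isResolventFamily_chanOp hd (bc_ne_zero d α)) (exists_forall_mem_chanSet hd (bc_ne_zero d α) β)
    (channelShift_neg_one β) (hasShells_chanOp hd (bc_ne_zero d α))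

/-- The eigenvalues of the Hamiltonian are the zeros of Krein's denominators of the two channels. -/
lemma opEigenspace_hamiltonian_ne_bot_iff (hd : d = 1 ∨ d = 2 ∨ d = 3) (hz : z.im ≠ 0) {x : ℝ} :
    opEigenspace (hamiltonian d α β z) (x : ℂ) ≠ ⊥ ↔ ∃ σ, x - channelShift β σ < 0 ∧
      kreinD d (bcCharge d α) (bcValue d α) ((x - channelShift β σ : ℝ) : ℂ) = 0 := by
  rw [Ne, (isShiftedSum_hamiltonian hd hz).opEigenspace_eq_bot_iff, not_forall]
  refine exists_congr fun σ => ?_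
  rw [← opEigenspace_chanOp_ne_bot_iff hd (bc_ne_zero d α)]
  push_cast
  rfl

lemma pointSpectrum_hamiltonian_eq_empty (hd : d = 1 ∨ d = 2 ∨ d = 3) (hz : z.im ≠ 0)
    (h : ∀ e : ℝ, e < 0 → kreinD d (bcCharge d α) (bcValue d α) e ≠ 0) :
    pointSpectrum (hamiltonian d α β z) = ∅ := by
  rw [Set.eq_empty_iff_forall_notMem]
  intro w hw
  obtain ⟨e, rfl, he⟩ := (isResolventFamily_hamiltonian hd hz).mem_pointSpectrum_iff.1 hw
  obtain ⟨σ, h1, h2⟩ := (opEigenspace_hamiltonian_ne_bot_iff hd hz).1 he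
  exact h _ h1 h2

section OneZero

variable (hd : d = 1 ∨ d = 2 ∨ d = 3) (hz : z.im ≠ 0) {X : ℝ} (hX : 0 < X)
  (h : ∀ e : ℝ, e < 0 → (kreinD d (bcCharge d α) (bcValue d α) e = 0 ↔ e = -X))

include hd hz hX h

lemma opEigenspace_hamiltonian_ne_bot_iff_of_zero {x : ℝ} :
    opEigenspace (hamiltonian d α β z) (x : ℂ) ≠ ⊥ ↔ x = -β - X ∨ x = β - X := by
  rw [opEigenspace_hamiltonian_ne_bot_iff hd hz]
  constructor
  · rintro ⟨σ, h1, h2⟩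
    have h3 := (h _ h1).1 h2
    rcases Int.units_eq_one_or σ with rfl | rfl
    · rw [channelShift_one] at h3; right; linarith
    · rw [channelShift_neg_one] at h3; left; linarith
  · rintro (rfl | rfl)
    · have h1 : -β - X - channelShift β (-1) = -X := by rw [channelShift_neg_one]; ring
      exact ⟨-1, by linarith, (h _ (by linarith)).2 h1⟩
    · have h1 : β - X - channelShift β 1 = -X := by rw [channelShift_one]; ring
      exact ⟨1, by linarith, (h _ (by linarith)).2 h1⟩

lemma pointSpectrum_hamiltonian_of_zero :
    pointSpectrum (hamiltonian d α β z) = {((-β - X : ℝ) : ℂ), ((β - X : ℝ) : ℂ)} := by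
  ext w
  rw [(isResolventFamily_hamiltonian hd hz).mem_pointSpectrum_iff]
  simp only [opEigenspace_hamiltonian_ne_bot_iff_of_zero hd hz hX h, Set.mem_insert_iff,
    Set.mem_singleton_iff]
  constructor
  · rintro ⟨e, rfl, rfl | rfl⟩
    · exact Or.inl rfl
    · exact Or.inr rfl
  · rintro (rfl | rfl)
    · exact ⟨_, rfl, Or.inl rfl⟩
    · exact ⟨_, rfl, Or.inr rfl⟩

/-- The eigenvalues are simple as the two channels contribute different ones. -/
lemma isSimpleEigenvalue_hamiltonian (hβ : 0 < β) (σ : ℤˣ) :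
    IsSimpleEigenvalue (hamiltonian d α β z) ((channelShift β σ - X : ℝ) : ℂ) := by
  have hbot : ∀ τ, τ ≠ σ → opEigenspace (chanOp d (bcCharge d α) (bcValue d α))
      (((channelShift β σ - X : ℝ) : ℂ) - channelShift β τ) = ⊥ := by
    intro τ hτ
    by_contra hne
    rw [← Complex.ofReal_sub] at hne
    obtain ⟨h1, h2⟩ := (opEigenspace_chanOp_ne_bot_iff hd (bc_ne_zero d α)).1 hne
    have h3 := (h _ h1).1 h2
    rcases Int.units_eq_one_or σ with rfl | rfl <;> rcases Int.units_eq_one_or τ with rfl | rfl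
    · exact hτ rfl
    · rw [channelShift_one, channelShift_neg_one] at h3; linarith
    · rw [channelShift_one, channelShift_neg_one] at h3; linarith
    · exact hτ rfl
  have hE : ((channelShift β σ - X : ℝ) : ℂ) - channelShift β σ = ((-X : ℝ) : ℂ) := by
    push_cast; ring
  unfold IsSimpleEigenvalue
  rw [(isShiftedSum_hamiltonian hd hz).finrank_opEigenspace hbot, hE]
  exact finrank_opEigenspace_chanOp hd (by linarith) ((h _ (by linarith)).2 rfl)

/-- The conclusions of the theorem when Krein's denominator has the single negative zero `-X`. -/
lemma spectrum_hamiltonian_of_zero (hβ : 0 < β) :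
    (pointSpectrum (hamiltonian d α β z) = {((-β - X : ℝ) : ℂ), ((β - X : ℝ) : ℂ)} ∧
      IsSimpleEigenvalue (hamiltonian d α β z) ((-β - X : ℝ) : ℂ) ∧
      IsSimpleEigenvalue (hamiltonian d α β z) ((β - X : ℝ) : ℂ) ∧ -β - X < -β) ∧
    (2 * β < X → β - X < -β ∧
      pointSpectrum (hamiltonian d α β z) = discreteSpectrum (hamiltonian d α β z) ∧
      EssSpectrumOnlyAC (hamiltonian d α β z)) ∧
    (X ≤ 2 * β → ((β - X : ℝ) : ℂ) ∈ contSpectrum (hamiltonian d α β z) ∧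
      -β ≤ β - X ∧ β - X < β) := by
  have h1 := isSimpleEigenvalue_hamiltonian hd hz hX h hβ (-1)
  have h2 := isSimpleEigenvalue_hamiltonian hd hz hX h hβ 1
  rw [channelShift_neg_one] at h1
  rw [channelShift_one] at h2
  have hA := isResolventFamily_hamiltonian (α := α) (β := β) hd hz
  have hm := isACAbove_hamiltonian (α := α) hd hβ hz
  have hS := hasShells_hamiltonian (α := α) (β := β) hd hz
  refine ⟨⟨pointSpectrum_hamiltonian_of_zero hd hz hX h, h1, h2, by linarith⟩, fun h3 => ?_,
    fun h3 => ⟨hA.mem_contSpectrum hm hS (by linarith), by linarith, by linarith⟩⟩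
  have hlt : ∀ e : ℝ, opEigenspace (hamiltonian d α β z) (e : ℂ) ≠ ⊥ → e < -β := fun e he => by
    rcases (opEigenspace_hamiltonian_ne_bot_iff_of_zero hd hz hX h).1 he with rfl | rfl <;> linarith
  exact ⟨by linarith, hA.pointSpectrum_eq_discreteSpectrum hm hS hlt,
    hA.essSpectrumOnlyAC hm hS hlt⟩

end OneZero

end Assembly

/-! ### Real roots of the determinant -/

section RealRoots

variable {d : ℕ} {α β : ℝ}

lemma upperSqrt_eq (w : ℂ) : upperSqrt w = Complex.I * kap w := rfl

lemma norm_kap (w : ℂ) : ‖kap w‖ = √‖w‖ := by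
  rw [← Real.sqrt_sq (norm_nonneg (kap w)), ← norm_pow, kap_sq, norm_neg]

lemma kap_ofReal_mul {s : ℝ} (hs : 0 < s) {w : ℂ} (hw : -w ∈ Complex.slitPlane) :
    kap (((s ^ 2 : ℝ) : ℂ) * w) = s * kap w := by
  have h1 : (s : ℂ) * kap w ∈ rightHalfPlane := by
    have h2 : 0 < (kap w).re := kap_mem hw
    simp only [rightHalfPlane, Set.mem_ofPred_eq, Complex.re_ofReal_mul]
    positivity
  rw [← kap_eq h1, mul_pow, kap_sq]
  congr 1
  push_cast; ring

lemma log_I_mul {κ : ℂ} (hκ : κ ∈ rightHalfPlane) :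
    Complex.log (Complex.I * κ) = Complex.log κ + Complex.I * Real.pi / 2 := by
  have h0 := ne_zero_of_mem_rightHalfPlane hκ
  have h1 := Complex.abs_arg_lt_pi_div_two_iff.2 (Or.inl hκ)
  rw [abs_lt] at h1
  rw [Complex.log_mul Complex.I_ne_zero h0, Complex.log_I]
  · ring
  · rw [Complex.arg_I]
    constructor <;> linarith [Real.pi_pos]

/-- The diagonal entries of `Γ₀` are Krein's denominators, up to a constant factor. -/
lemma kreinD_eq_gammaEntry (hd : d = 1 ∨ d = 2 ∨ d = 3) (hα : d = 2 ∨ α ≠ 0) :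
    ∃ t : ℂ, t ≠ 0 ∧ ∀ w : ℂ, -w ∈ Complex.slitPlane →
      gammaEntry d α w = t * kreinD d (bcCharge d α) (bcValue d α) w := by
  have hπ : (Real.pi : ℂ) ≠ 0 := Complex.ofReal_ne_zero.2 Real.pi_ne_zero
  have hI := Complex.I_ne_zero
  rcases hd with rfl | rfl | rfl
  · have hα0 : (α : ℂ) ≠ 0 := by
      rcases hα with h | h
      · omega
      · exact_mod_cast h
    refine ⟨-(1 / α), by simpa using hα0, fun w hw => ?_⟩
    have h0 := ne_zero_of_mem_rightHalfPlane (kap_mem hw)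
    simp only [gammaEntry, kreinD, regVal, regK, bcCharge, bcValue, upperSqrt_eq, if_true]
    push_cast
    field_simp
    ring
  · refine ⟨1, one_ne_zero, fun w hw => ?_⟩
    have hκ := kap_mem hw
    set γ := Real.eulerMascheroniConstant with hγ
    set s : ℝ := Real.exp (γ + 2 * Real.pi * α) / 2 with hs
    have hs0 : 0 < s := by positivity
    have hμ : muOf α = s ^ 2 := by
      rw [hs, div_pow, ← Real.exp_nat_mul]
      unfold muOf
      push_cast
      rw [← hγ]
      norm_num
    have hlog : Real.log s = γ + 2 * Real.pi * α - Real.log 2 := by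
      rw [hs, Real.log_div (Real.exp_ne_zero _) two_ne_zero, Real.log_exp]
    have h1 : (s : ℂ) * kap w ∈ rightHalfPlane := by
      have h2 : 0 < (kap w).re := hκ
      simp only [rightHalfPlane, Set.mem_ofPred_eq, Complex.re_ofReal_mul]
      positivity
    have h2 : Complex.log (kap w / 2) = Complex.log (kap w) - Real.log 2 := by
      rw [show kap w / 2 = ((2⁻¹ : ℝ) : ℂ) * kap w by push_cast; ring,
        Complex.log_ofReal_mul (by norm_num) (ne_zero_of_mem_rightHalfPlane hκ), Real.log_inv]
      push_cast; ring
    simp only [gammaEntry, kreinD, regVal, regK, bcCharge, bcValue, upperSqrt_eq]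
    rw [hμ, kap_ofReal_mul hs0 hw, log_I_mul h1,
      Complex.log_ofReal_mul hs0 (ne_zero_of_mem_rightHalfPlane hκ), hlog, h2]
    push_cast
    simp
    field_simp
    ring
  · refine ⟨1, one_ne_zero, fun w hw => ?_⟩
    simp only [gammaEntry, kreinD, regVal, regK, bcCharge, bcValue, upperSqrt_eq]
    simp
    field_simp
    ring

lemma isRealRoot_iff (hd : d = 1 ∨ d = 2 ∨ d = 3) (hα : d = 2 ∨ α ≠ 0) {x : ℝ} :
    IsRealRoot d α β x ↔
      Tendsto (fun z : ℂ => kreinD d (bcCharge d α) (bcValue d α) (z - channelShift β 1) *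
        kreinD d (bcCharge d α) (bcValue d α) (z - channelShift β (-1)))
        (𝓝[{z : ℂ | z.im ≠ 0}] (x : ℂ)) (𝓝 0) := by
  obtain ⟨t, ht, h⟩ := kreinD_eq_gammaEntry hd hα
  have hev : (fun z => (gammaZero d α β z).det) =ᶠ[𝓝[{z : ℂ | z.im ≠ 0}] (x : ℂ)] fun z : ℂ =>
      t ^ 2 * (kreinD d (bcCharge d α) (bcValue d α) (z - channelShift β 1) *
        kreinD d (bcCharge d α) (bcValue d α) (z - channelShift β (-1))) := by
    filter_upwards [self_mem_nhdsWithin] with z hz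
    have hw : ∀ σ, gammaEntry d α (z - sgn σ * β)
        = t * kreinD d (bcCharge d α) (bcValue d α) (z - channelShift β σ) := fun σ => by
      rw [← ofReal_channelShift]
      exact h _ (mem_slitPlane_of_im_ne_zero (by rw [im_sub_channelShift]; exact hz))
    unfold gammaZero
    rw [Matrix.det_diagonal, UnitsInt.univ, Finset.prod_pair (by decide), hw, hw]
    ring
  unfold IsRealRoot
  rw [tendsto_congr' hev]
  constructor
  · intro h1
    have h2 := h1.const_mul (t ^ 2)⁻¹
    rw [mul_zero] at h2
    refine h2.congr fun z => ?_
    rw [inv_mul_cancel_left₀ (pow_ne_zero 2 ht)]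
  · intro h1
    simpa using h1.const_mul (t ^ 2)

lemma abs_log_le {t : ℝ} (ht : 0 < t) : |Real.log t| ≤ t + t⁻¹ := by
  have h1 := Real.log_le_sub_one_of_pos ht
  have h2 := Real.one_sub_inv_le_log_of_pos ht
  have h3 := inv_pos.2 ht
  rw [abs_le]
  constructor <;> linarith

/-- Krein's denominator grows slowly at infinity and has at most a square root singularity at the
threshold. -/
lemma exists_norm_kreinD_le (hd : d = 1 ∨ d = 2 ∨ d = 3) (a c : ℝ) :
    ∃ C > 0, ∀ w : ℂ, -w ∈ Complex.slitPlane →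
      ‖kreinD d a c w‖ ≤ C * (1 + ‖kap w‖ + ‖kap w‖⁻¹) := by
  suffices h : ∃ C > 0, ∀ w : ℂ, -w ∈ Complex.slitPlane →
      ‖regVal d w‖ ≤ C * (1 + ‖kap w‖ + ‖kap w‖⁻¹) by
    obtain ⟨C, hC, h⟩ := h
    refine ⟨|a| + |c| * C + 1, by positivity, fun w hw => ?_⟩
    have h1 : ‖kreinD d a c w‖ ≤ |a| + |c| * ‖regVal d w‖ := by
      unfold kreinD
      refine (norm_sub_le _ _).trans ?_
      rw [norm_mul, Complex.norm_real, Complex.norm_real, Real.norm_eq_abs, Real.norm_eq_abs]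
    have h2 := mul_le_mul_of_nonneg_left (h w hw) (abs_nonneg c)
    have h3 : 0 ≤ ‖kap w‖ + ‖kap w‖⁻¹ := by positivity
    nlinarith [mul_nonneg (abs_nonneg a) h3]
  have hπ := Real.pi_pos
  rcases hd with rfl | rfl | rfl
  · refine ⟨1, one_pos, fun w hw => ?_⟩
    simp only [regVal, regK]
    have h3 := inv_nonneg.2 (norm_nonneg (kap w))
    have h4 := norm_nonneg (kap w)
    rw [norm_div, norm_mul, norm_one, Complex.norm_ofNat, one_div, mul_inv]
    linarith
  · set γ := Real.eulerMascheroniConstant with hγ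
    refine ⟨2 + Real.pi + |γ|, by positivity, fun w hw => ?_⟩
    simp only [regVal, regK]
    have h0 : 0 < ‖kap w‖ := norm_pos_iff.2 (ne_zero_of_mem_rightHalfPlane (kap_mem hw))
    have h1 : ‖Complex.log (kap w / 2)‖ ≤ (‖kap w‖ / 2 + (‖kap w‖ / 2)⁻¹) + Real.pi := by
      refine (Complex.norm_le_abs_re_add_abs_im _).trans (add_le_add ?_ ?_)
      · rw [Complex.log_re, norm_div, Complex.norm_ofNat]
        exact abs_log_le (by positivity)
      · rw [Complex.log_im]
        exact Complex.abs_arg_le_pi _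
    have h2 : ‖-(Complex.log (kap w / 2) + (γ : ℂ)) / (2 * Real.pi)‖
        ≤ ‖Complex.log (kap w / 2)‖ + |γ| := by
      rw [norm_div, norm_neg, norm_mul, Complex.norm_ofNat, Complex.norm_real, Real.norm_eq_abs,
        abs_of_pos hπ]
      have h5 : ‖Complex.log (kap w / 2) + (γ : ℂ)‖ ≤ ‖Complex.log (kap w / 2)‖ + |γ| := by
        refine (norm_add_le _ _).trans ?_
        rw [Complex.norm_real, Real.norm_eq_abs]
      refine (div_le_self (norm_nonneg _) ?_).trans h5
      linarith [Real.pi_gt_three]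
    have h3 : 0 < ‖kap w‖⁻¹ := inv_pos.2 h0
    have h4 : (‖kap w‖ / 2)⁻¹ = 2 * ‖kap w‖⁻¹ := by rw [inv_div]; ring
    rw [h4] at h1
    nlinarith [mul_nonneg (add_pos hπ zero_lt_one).le (add_pos h0 h3).le,
      mul_nonneg (abs_nonneg γ) (add_pos h0 h3).le]
  · refine ⟨1, one_pos, fun w hw => ?_⟩
    simp only [regVal, regK]
    have h3 := inv_nonneg.2 (norm_nonneg (kap w))
    have h4 := norm_nonneg (kap w)
    rw [norm_div, norm_neg, norm_mul, Complex.norm_ofNat, Complex.norm_real, Real.norm_eq_abs,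
        abs_of_pos hπ]
    have : ‖kap w‖ / (4 * Real.pi) ≤ ‖kap w‖ := div_le_self h4 (by linarith [Real.pi_gt_three])
    linarith

/-- The singularity at the threshold is weaker than a pole. -/
lemma tendsto_mul_kreinD (hd : d = 1 ∨ d = 2 ∨ d = 3) (a c y : ℝ) :
    Tendsto (fun w : ℂ => (w - y) * kreinD d a c w) (𝓝[{w : ℂ | w.im ≠ 0}] (y : ℂ)) (𝓝 0) := by
  obtain ⟨C, hC, h⟩ := exists_norm_kreinD_le hd a c
  have hid : Tendsto (fun w : ℂ => w) (𝓝[{w : ℂ | w.im ≠ 0}] (y : ℂ)) (𝓝 (y : ℂ)) :=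
    tendsto_id.mono_left nhdsWithin_le_nhds
  have h1 : Tendsto (fun w : ℂ => ‖w - y‖) (𝓝[{w : ℂ | w.im ≠ 0}] (y : ℂ)) (𝓝 0) := by
    simpa using (hid.sub_const (y : ℂ)).norm
  have h2 : Tendsto (fun w : ℂ => √‖w‖) (𝓝[{w : ℂ | w.im ≠ 0}] (y : ℂ)) (𝓝 √‖(y : ℂ)‖) :=
    (Real.continuous_sqrt.tendsto _).comp hid.norm
  have h3 : Tendsto (fun w : ℂ => ‖w - y‖ * (√‖w‖)⁻¹) (𝓝[{w : ℂ | w.im ≠ 0}] (y : ℂ)) (𝓝 0) := by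
    by_cases hy : y = 0
    · subst hy
      have h4 : (fun w : ℂ => ‖w - (0 : ℝ)‖ * (√‖w‖)⁻¹) = fun w => √‖w‖ := by
        ext w
        rw [Complex.ofReal_zero, sub_zero, ← div_eq_mul_inv, Real.div_sqrt]
      rw [h4]
      simpa using h2
    · have h4 : √‖(y : ℂ)‖ ≠ 0 := by
        refine (Real.sqrt_pos.2 (norm_pos_iff.2 ?_)).ne'
        exact_mod_cast hy
      simpa using h1.mul (h2.inv₀ h4)
  have h5 := ((h1.add (h1.mul h2)).add h3).const_mul C
  rw [zero_mul, add_zero, add_zero, mul_zero] at h5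
  refine squeeze_zero_norm' ?_ h5
  filter_upwards [self_mem_nhdsWithin] with w hw
  have h6 := h w (mem_slitPlane_of_im_ne_zero hw)
  rw [norm_kap] at h6
  rw [norm_mul]
  calc ‖w - y‖ * ‖kreinD d a c w‖ ≤ ‖w - y‖ * (C * (1 + √‖w‖ + (√‖w‖)⁻¹)) := by gcongr
    _ = _ := by ring

lemma isBigO_kreinD (a c : ℝ) {e : ℝ} (he : e < 0) (hD : kreinD d a c e = 0) :
    (kreinD d a c) =O[𝓝 (e : ℂ)] fun w => w - e := by
  have h1 : DifferentiableAt ℂ (kreinD d a c) e :=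
    ((differentiableAt_regVal (mem_slitPlane_of_neg he)).const_mul _).const_sub _
  simpa [hD] using h1.isBigO_sub

lemma tendsto_sub_channelShift (β x : ℝ) (σ : ℤˣ) :
    Tendsto (fun z : ℂ => z - channelShift β σ) (𝓝[{z : ℂ | z.im ≠ 0}] (x : ℂ))
      (𝓝[{z : ℂ | z.im ≠ 0}] ((x - channelShift β σ : ℝ) : ℂ)) := by
  refine tendsto_nhdsWithin_iff.2 ⟨?_, ?_⟩
  · rw [Complex.ofReal_sub]
    exact (tendsto_id.sub_const _).mono_left nhdsWithin_le_nhds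
  · filter_upwards [self_mem_nhdsWithin] with z hz
    rw [im_sub_channelShift]
    exact hz

/-- At an eigenvalue one factor of the determinant vanishes linearly, which beats the possible
threshold singularity of the other factor. -/
lemma tendsto_kreinD_mul (hd : d = 1 ∨ d = 2 ∨ d = 3) (a c : ℝ) {x : ℝ} {σ : ℤˣ} (τ : ℤˣ)
    (hx : x - channelShift β σ < 0)
    (hD : kreinD d a c ((x - channelShift β σ : ℝ) : ℂ) = 0) :
    Tendsto (fun z : ℂ => kreinD d a c (z - channelShift β σ) *
      kreinD d a c (z - channelShift β τ)) (𝓝[{z : ℂ | z.im ≠ 0}] (x : ℂ)) (𝓝 0) := by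
  have h1 := (isBigO_kreinD a c hx hD).comp_tendsto
    ((tendsto_sub_channelShift β x σ).mono_right nhdsWithin_le_nhds)
  have h2 := (tendsto_mul_kreinD hd a c _).comp (tendsto_sub_channelShift β x τ)
  refine (h1.mul (Asymptotics.isBigO_refl (fun z : ℂ => kreinD d a c (z - channelShift β τ)) _)).trans_tendsto
    (h2.congr fun z => ?_)
  simp only [Function.comp_apply]
  push_cast
  ring

/-- Away from its zeros Krein's denominator is bounded below along vertical lines. At the threshold
this needs `α ≠ 0` in dimensions one and three. -/
lemma exists_le_norm_kreinD (hd : d = 1 ∨ d = 2 ∨ d = 3) (hα : d = 2 ∨ α ≠ 0) {y : ℝ}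
    (h : y < 0 → kreinD d (bcCharge d α) (bcValue d α) y ≠ 0) :
    ∃ m > 0, ∀ᶠ δ : ℝ in 𝓝[>] 0,
      m ≤ ‖kreinD d (bcCharge d α) (bcValue d α) (y + δ * Complex.I)‖ := by
  set a := bcCharge d α with ha
  set c := bcValue d α with hc
  have hlim : ∀ L : ℂ, L ≠ 0 → Tendsto (fun δ : ℝ => kreinD d a c (y + δ * Complex.I)) (𝓝[>] 0) (𝓝 L) →
      ∃ m > 0, ∀ᶠ δ : ℝ in 𝓝[>] 0, m ≤ ‖kreinD d a c (y + δ * Complex.I)‖ := by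
    intro L hL ht
    have hL' := norm_pos_iff.2 hL
    exact ⟨‖L‖ / 2, by positivity, (ht.norm.eventually (lt_mem_nhds (half_lt_self hL'))).mono
      fun δ hδ => hδ.le⟩
  have hline : Tendsto (fun δ : ℝ => (y : ℂ) + δ * Complex.I) (𝓝[>] 0) (𝓝 (y : ℂ)) := by
    have h1 : Continuous fun δ : ℝ => (y : ℂ) + δ * Complex.I := by fun_prop
    have h2 := (h1.tendsto 0).mono_left (nhdsWithin_le_nhds (s := Set.Ioi 0))
    simpa using h2
  have hslit : ∀ᶠ δ : ℝ in 𝓝[>] 0, -((y : ℂ) + δ * Complex.I) ∈ Complex.slitPlane := by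
    filter_upwards [self_mem_nhdsWithin] with δ hδ
    refine mem_slitPlane_of_im_ne_zero ?_
    simpa using (ne_of_gt hδ)
  rcases lt_trichotomy y 0 with hy | rfl | hy
  · have h1 : ContinuousAt (kreinD d a c) (y : ℂ) :=
      (((differentiableAt_regVal (mem_slitPlane_of_neg hy)).const_mul _).const_sub _).continuousAt
    exact hlim _ (h hy) (h1.tendsto.comp hline)
  · have hκ : Tendsto (fun δ : ℝ => kap ((0 : ℝ) + δ * Complex.I)) (𝓝[>] 0) (𝓝 0) := by
      rw [tendsto_zero_iff_norm_tendsto_zero]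
      simp only [norm_kap]
      have h1 := (Real.continuous_sqrt.tendsto _).comp hline.norm
      simpa [Function.comp_def] using h1
    have hπ := Real.pi_pos
    rcases hd with rfl | rfl | rfl
    -- the regular value `1 / (2κ)` blows up at the threshold
    · have hα0 : (α : ℂ) ≠ 0 := by
        rcases hα with h | h
        · omega
        · exact_mod_cast h
      have h1 : Tendsto (fun δ : ℝ => 2 * kap ((0 : ℝ) + δ * Complex.I) + α) (𝓝[>] 0) (𝓝 α) := by
        simpa using (hκ.const_mul 2).add_const (α : ℂ)
      have hα1 := norm_pos_iff.2 hα0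
      refine ⟨‖(α : ℂ)‖ / 2, by positivity, ?_⟩
      filter_upwards [h1.norm.eventually (lt_mem_nhds (half_lt_self hα1)), hslit,
        (hκ.norm.eventually (gt_mem_nhds (show ‖(0 : ℂ)‖ < 1 / 2 by norm_num)))] with δ h2 h3 h4
      have h5 := ne_zero_of_mem_rightHalfPlane (kap_mem h3)
      have h6 : 2 * kap ((0 : ℝ) + δ * Complex.I) + α
          = 2 * kap ((0 : ℝ) + δ * Complex.I) * kreinD 1 a c ((0 : ℝ) + δ * Complex.I) := by
        simp only [kreinD, regVal, regK, ha, hc, bcCharge, bcValue, if_true]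
        generalize kap ((0 : ℝ) + δ * Complex.I) = κ at h5
        push_cast
        field_simp
        ring
      rw [h6, norm_mul, norm_mul, Complex.norm_ofNat] at h2
      refine h2.le.trans (mul_le_of_le_one_left (norm_nonneg _) (by linarith))
    -- the logarithm blows up at the threshold
    · refine ⟨1, one_pos, ?_⟩
      have h1 : Tendsto (fun δ : ℝ => ‖kap ((0 : ℝ) + δ * Complex.I) / 2‖) (𝓝[>] 0) (𝓝[≠] 0) := by
        refine tendsto_nhdsWithin_iff.2 ⟨by simpa using (hκ.div_const 2).norm, ?_⟩
        filter_upwards [hslit] with δ h3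
        have h5 := ne_zero_of_mem_rightHalfPlane (kap_mem h3)
        simpa using h5
      have h2 := Real.tendsto_log_nhdsNE_zero.comp h1
      filter_upwards [h2.eventually
        (eventually_le_atBot (-(2 * Real.pi * (1 + α) + Real.eulerMascheroniConstant)))] with δ h3
      simp only [Function.comp_apply] at h3
      have h4 : (kreinD 2 a c ((0 : ℝ) + δ * Complex.I)).re
          = α + (Real.log ‖kap ((0 : ℝ) + δ * Complex.I) / 2‖ + Real.eulerMascheroniConstant)
            / (2 * Real.pi) := by
        have h5 : kreinD 2 a c ((0 : ℝ) + δ * Complex.I)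
            = α + (Complex.log (kap ((0 : ℝ) + δ * Complex.I) / 2)
              + Real.eulerMascheroniConstant) / ((2 * Real.pi : ℝ) : ℂ) := by
          simp only [kreinD, regVal, regK, ha, hc, bcCharge, bcValue]
          push_cast
          simp
          ring
        rw [h5, Complex.add_re, Complex.div_ofReal_re, Complex.add_re, Complex.log_re,
          Complex.ofReal_re, Complex.ofReal_re]
      have h6 : (Real.log ‖kap ((0 : ℝ) + δ * Complex.I) / 2‖ + Real.eulerMascheroniConstant)
            / (2 * Real.pi) ≤ -(1 + α) := by
        rw [div_le_iff₀ (by positivity)]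
        linarith
      have h7 := Complex.abs_re_le_norm (kreinD 2 a c ((0 : ℝ) + δ * Complex.I))
      rw [h4] at h7
      linarith [neg_le_abs (α + (Real.log ‖kap ((0 : ℝ) + δ * Complex.I) / 2‖
        + Real.eulerMascheroniConstant) / (2 * Real.pi))]
    · have hα0 : (α : ℂ) ≠ 0 := by
        rcases hα with h | h
        · omega
        · exact_mod_cast h
      refine hlim α hα0 ?_
      have h1 := (hκ.div_const (4 * Real.pi : ℂ)).const_add (α : ℂ)
      simp only [zero_div, add_zero] at h1
      refine h1.congr fun δ => ?_
      simp only [kreinD, regVal, regK, ha, hc, bcCharge, bcValue]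
      push_cast
      simp
      ring
  -- on the positive half-axis the boundary value is not even real
  · obtain ⟨L, hL, ht⟩ := tendsto_regVal hd hy
    refine hlim (a - c * L) (fun h0 => ?_) ((ht.const_mul _).const_sub _)
    have h1 := congrArg Complex.im h0
    simp only [Complex.sub_im, Complex.ofReal_im, Complex.im_ofReal_mul, Complex.zero_im,
      zero_sub, neg_eq_zero, mul_eq_zero] at h1
    have hc0 : c ≠ 0 := by
      rw [hc]
      unfold bcValue
      rcases hd with rfl | rfl | rfl <;> simp_all
    rcases h1 with h1 | h1
    · exact hc0 h1
    · exact hL.ne' h1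

theorem isRealRoot_iff_exists (hd : d = 1 ∨ d = 2 ∨ d = 3) (hα : d = 2 ∨ α ≠ 0) {x : ℝ} :
    IsRealRoot d α β x ↔ ∃ σ, x - channelShift β σ < 0 ∧
      kreinD d (bcCharge d α) (bcValue d α) ((x - channelShift β σ : ℝ) : ℂ) = 0 := by
  rw [isRealRoot_iff hd hα]
  constructor
  · intro ht
    by_contra! hcon
    obtain ⟨m, hm, h1⟩ := exists_le_norm_kreinD hd hα (hcon 1)
    obtain ⟨n, hn, h2⟩ := exists_le_norm_kreinD hd hα (hcon (-1))
    have hline : Tendsto (fun δ : ℝ => (x : ℂ) + δ * Complex.I) (𝓝[>] 0)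
        (𝓝[{z : ℂ | z.im ≠ 0}] (x : ℂ)) := by
      refine tendsto_nhdsWithin_iff.2 ⟨?_, ?_⟩
      · have h1 : Continuous fun δ : ℝ => (x : ℂ) + δ * Complex.I := by fun_prop
        have h2 := (h1.tendsto 0).mono_left (nhdsWithin_le_nhds (s := Set.Ioi 0))
        simpa using h2
      · filter_upwards [self_mem_nhdsWithin] with δ hδ
        simpa using (ne_of_gt hδ)
    have h3 := (ht.comp hline).norm
    rw [norm_zero] at h3
    obtain ⟨δ, h4, h5, h6⟩ :=
      ((h3.eventually (gt_mem_nhds (mul_pos hm hn))).and (h1.and h2)).exists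
    have h7 : ∀ σ, (x : ℂ) + δ * Complex.I - channelShift β σ
        = ((x - channelShift β σ : ℝ) : ℂ) + δ * Complex.I := fun σ => by push_cast; ring
    simp only [Function.comp_apply] at h4
    rw [h7, h7, norm_mul] at h4
    exact absurd h4 (not_lt.2 (mul_le_mul h5 h6 hn.le (norm_nonneg _)))
  · rintro ⟨σ, h1, h2⟩
    rcases Int.units_eq_one_or σ with rfl | rfl
    · exact tendsto_kreinD_mul hd _ _ (-1) h1 h2
    · simpa only [mul_comm] using tendsto_kreinD_mul hd _ _ 1 h1 h2

theorem pointSpectrum_hamiltonian_eq_realRoots (hd : d = 1 ∨ d = 2 ∨ d = 3) (hα : d = 2 ∨ α ≠ 0)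
    {z : ℂ} (hz : z.im ≠ 0) :
    pointSpectrum (hamiltonian d α β z) = ((↑) : ℝ → ℂ) '' {x | IsRealRoot d α β x} := by
  ext w
  rw [(isResolventFamily_hamiltonian hd hz).mem_pointSpectrum_iff]
  simp only [opEigenspace_hamiltonian_ne_bot_iff hd hz, Set.mem_image, Set.mem_ofPred_eq,
    isRealRoot_iff_exists hd hα]
  constructor
  · rintro ⟨e, rfl, h⟩
    exact ⟨e, h, rfl⟩
  · rintro ⟨e, h, rfl⟩
    exact ⟨e, rfl, h⟩

end RealRoots

/-! ### The thresholds -/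

section Thresholds

variable {α β : ℝ}

lemma neg_mul_sqrt_le_iff {k : ℝ} (hk : 0 < k) (hβ : 0 < β) (hα : α < 0) :
    -k * √(2 * β) ≤ α ↔ α ^ 2 ≤ k ^ 2 * (2 * β) := by
  rw [← Real.sq_sqrt (show 0 ≤ 2 * β by positivity), ← mul_pow, ← neg_sq α,
    sq_le_sq₀ (by linarith) (by positivity), Real.sqrt_sq (by positivity)]
  constructor <;> intro h <;> linarith

lemma lt_neg_mul_sqrt_iff {k : ℝ} (hk : 0 < k) (hβ : 0 < β) :
    α < -k * √(2 * β) ↔ α < 0 ∧ k ^ 2 * (2 * β) < α ^ 2 := by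
  have h1 : 0 ≤ k * √(2 * β) := by positivity
  constructor
  · intro h
    have hα : α < 0 := by linarith
    exact ⟨hα, not_le.1 fun h2 => not_le.2 h ((neg_mul_sqrt_le_iff hk hβ hα).2 h2)⟩
  · rintro ⟨hα, h⟩
    exact not_le.1 fun h2 => not_le.2 h ((neg_mul_sqrt_le_iff hk hβ hα).1 h2)

end Thresholds

end

theorem theorem2 (α β : ℝ) (hβ : 0 < β) (z : ℂ) (hz : z.im ≠ 0) :
    (∀ d : ℕ, d = 1 ∨ d = 2 ∨ d = 3 →
      essSpectrum (hamiltonian d α β z) = ((↑) : ℝ → ℂ) '' Set.Ici (-β)) ∧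
    (∀ d : ℕ, d = 1 ∨ d = 2 ∨ d = 3 → (d = 2 ∨ α ≠ 0) →
      pointSpectrum (hamiltonian d α β z) = ((↑) : ℝ → ℂ) '' {x | IsRealRoot d α β x}) ∧
    -- dimension one
    ((0 ≤ α → pointSpectrum (hamiltonian 1 α β z) = ∅) ∧
      (α < 0 →
        pointSpectrum (hamiltonian 1 α β z) =
          {((-β - α ^ 2 / 4 : ℝ) : ℂ), ((β - α ^ 2 / 4 : ℝ) : ℂ)} ∧
        IsSimpleEigenvalue (hamiltonian 1 α β z) ((-β - α ^ 2 / 4 : ℝ) : ℂ) ∧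
        IsSimpleEigenvalue (hamiltonian 1 α β z) ((β - α ^ 2 / 4 : ℝ) : ℂ) ∧
        -β - α ^ 2 / 4 < -β) ∧
      (α < -2 * √(2 * β) →
        β - α ^ 2 / 4 < -β ∧
        pointSpectrum (hamiltonian 1 α β z) = discreteSpectrum (hamiltonian 1 α β z) ∧
        EssSpectrumOnlyAC (hamiltonian 1 α β z)) ∧
      (-2 * √(2 * β) ≤ α → α < 0 →
        ((β - α ^ 2 / 4 : ℝ) : ℂ) ∈ contSpectrum (hamiltonian 1 α β z) ∧
        -β ≤ β - α ^ 2 / 4 ∧ β - α ^ 2 / 4 < β)) ∧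
    -- dimension two
    ((pointSpectrum (hamiltonian 2 α β z) =
          {((-β - 1 / muOf α : ℝ) : ℂ), ((β - 1 / muOf α : ℝ) : ℂ)} ∧
        IsSimpleEigenvalue (hamiltonian 2 α β z) ((-β - 1 / muOf α : ℝ) : ℂ) ∧
        IsSimpleEigenvalue (hamiltonian 2 α β z) ((β - 1 / muOf α : ℝ) : ℂ) ∧
        -β - 1 / muOf α < -β) ∧
      (2 * β * muOf α < 1 →
        β - 1 / muOf α < -β ∧
        pointSpectrum (hamiltonian 2 α β z) = discreteSpectrum (hamiltonian 2 α β z) ∧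
        EssSpectrumOnlyAC (hamiltonian 2 α β z)) ∧
      (1 ≤ 2 * β * muOf α →
        ((β - 1 / muOf α : ℝ) : ℂ) ∈ contSpectrum (hamiltonian 2 α β z) ∧
        -β ≤ β - 1 / muOf α ∧ β - 1 / muOf α < β)) ∧
    -- dimension three
    ((0 ≤ α → pointSpectrum (hamiltonian 3 α β z) = ∅) ∧
      (α < 0 →
        pointSpectrum (hamiltonian 3 α β z) =
          {((-β - (4 * Real.pi * α) ^ 2 : ℝ) : ℂ), ((β - (4 * Real.pi * α) ^ 2 : ℝ) : ℂ)} ∧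
        IsSimpleEigenvalue (hamiltonian 3 α β z) ((-β - (4 * Real.pi * α) ^ 2 : ℝ) : ℂ) ∧
        IsSimpleEigenvalue (hamiltonian 3 α β z) ((β - (4 * Real.pi * α) ^ 2 : ℝ) : ℂ) ∧
        -β - (4 * Real.pi * α) ^ 2 < -β) ∧
      (α < -(√(2 * β) / (4 * Real.pi)) →
        β - (4 * Real.pi * α) ^ 2 < -β ∧
        pointSpectrum (hamiltonian 3 α β z) = discreteSpectrum (hamiltonian 3 α β z) ∧
        EssSpectrumOnlyAC (hamiltonian 3 α β z)) ∧
      (-(√(2 * β) / (4 * Real.pi)) ≤ α → α < 0 →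
        ((β - (4 * Real.pi * α) ^ 2 : ℝ) : ℂ) ∈ contSpectrum (hamiltonian 3 α β z) ∧
        -β ≤ β - (4 * Real.pi * α) ^ 2 ∧ β - (4 * Real.pi * α) ^ 2 < β)) := by
  have spec1 := fun h : α < 0 => spectrum_hamiltonian_of_zero (d := 1) (α := α) (by simp) hz
    (X := α ^ 2 / 4) (by have := h.ne; positivity)
    (fun e he => by rw [kreinD_one_eq_zero_iff he, and_iff_right h]) hβ
  have spec2 := spectrum_hamiltonian_of_zero (d := 2) (α := α) (by simp) hz
    (one_div_pos.2 (muOf_pos α)) (fun e he => kreinD_two_eq_zero_iff he) hβ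
  have spec3 := fun h : α < 0 => spectrum_hamiltonian_of_zero (d := 3) (α := α) (by simp) hz
    (X := (4 * Real.pi * α) ^ 2) (by have := h.ne; positivity)
    (fun e he => by rw [kreinD_three_eq_zero_iff he, and_iff_right h]) hβ
  refine ⟨fun d hd => ?_, fun d hd hα => pointSpectrum_hamiltonian_eq_realRoots hd hα hz,
    ⟨fun h => ?_, fun h => ?_, fun h => ?_, fun h h0 => ?_⟩, ⟨?_, fun h => ?_, fun h => ?_⟩,
    ⟨fun h => ?_, fun h => ?_, fun h => ?_, fun h h0 => ?_⟩⟩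
  · exact (isResolventFamily_hamiltonian hd hz).essSpectrum_eq (isACAbove_hamiltonian hd hβ hz)
      (hasShells_hamiltonian hd hz)
  · exact pointSpectrum_hamiltonian_eq_empty (by simp) hz fun e he hD =>
      not_lt.2 h ((kreinD_one_eq_zero_iff he).1 hD).1
  · exact (spec1 h).1
  · obtain ⟨h0, h1⟩ := (lt_neg_mul_sqrt_iff two_pos hβ).1 h
    exact (spec1 h0).2.1 (by linarith)
  · have h1 := (neg_mul_sqrt_le_iff two_pos hβ h0).1 h
    exact (spec1 h0).2.2 (by linarith)
  · exact spec2.1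
  · refine spec2.2.1 ?_
    rwa [lt_div_iff₀ (muOf_pos α)]
  · refine spec2.2.2 ?_
    rwa [div_le_iff₀ (muOf_pos α)]
  · exact pointSpectrum_hamiltonian_eq_empty (by simp) hz fun e he hD =>
      not_lt.2 h ((kreinD_three_eq_zero_iff he).1 hD).1
  · exact (spec3 h).1
  · rw [div_eq_inv_mul, ← neg_mul] at h
    obtain ⟨h0, h1⟩ := (lt_neg_mul_sqrt_iff (by positivity) hβ).1 h
    refine (spec3 h0).2.1 ?_
    rwa [inv_pow, inv_mul_lt_iff₀ (by positivity), ← mul_pow] at h1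
  · rw [div_eq_inv_mul, ← neg_mul] at h
    have h1 := (neg_mul_sqrt_le_iff (by positivity) hβ h0).1 h
    refine (spec3 h0).2.2 ?_
    rwa [inv_pow, le_inv_mul_iff₀ (by positivity), ← mul_pow] at h1
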